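/- **Setting.** Let $(M,D,J)$ be a CR hypersurface of CR dimension $n$: $M$ is a smooth (for instance real-analytic) manifold of dimension $2n+1$, $D\subset TM$ is a subbundle of corank one, $J$ is a field of complex structures on $D$, and $D_{10}=\{X-iJX\mid X\in D\}$ is involutive; put $D_{01}=\overline{D_{10}}$. Its Freeman sequence is $F^{-1}_{10}=D_{10}$ and, for $p\ge 0$, $F^{p}_{10}$ is the left kernel of the higher Levi form $(X,Y)\mapsto [X,Y] \bmod F^{p-1}_{10}\oplus D_{01}$, $X\in F^{p-1}_{10}$, $Y\in D_{01}$; put $F^p=F^p_{10}\oplus\overline{F^p_{10}}$. Assume that $(M,D,J)$ is regular (all $F^p_{10}$ are subbundles) and $k$-nondegenerate at a point $x$, $k\ge 1$: $F^p|_x\ne 0$ for $-1\le p\le k-2$ and $F^{k-1}|_x=0$. Let $\mathfrak g$ be the Lie algebra of germs at $x$ of infinitesimal CR automorphisms of $(M,D,J)$, or any Lie subalgebra of it (such as the one given by the infinitesimal CR automorphisms defined on all of $M$), and assume that $\mathfrak g$ is transitive at $x$: the evaluation $\mathrm{ev}_x:\mathfrak g\to T_xM$ is onto. Write $\widehat V=V\otimes\mathbb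 C$. Let $\mathfrak q=\{\xi\in\widehat{\mathfrak g}\mid \mathrm{ev}_x(\xi)\in D_{10}\}$, so that $(\mathfrak g,\mathfrak q)$ is the CR algebra of the germ. The contact filtration of $\mathfrak g$ is $\mathfrak g^{-1}=\{\xi\mid \mathrm{ev}_x(\xi)\in D\}$, $\mathfrak g^{q}=\mathfrak g^{q+1}+[\mathfrak g^{-1},\mathfrak g^{q+1}]$ for $q\le -2$, and $\mathfrak g^{p}=\{\xi\in\mathfrak g^{p-1}\mid[\xi,\mathfrak g^{-1}]\subset\mathfrak g^{p-1}\}$ for $p\ge 0$. Assume that $\mathfrak g$ is a trivial filtered deformation of its associated graded Lie algebra, and fix an identification $\mathfrak g\cong\mathrm{gr}(\mathfrak g)$, that is, a Lie algebra grading $\mathfrak g=\bigoplus_{j\in\mathbb Z}\mathfrak g_j$ with $\mathfrak g^p=\bigoplus_{j\ge p}\mathfrak g_j$ for all $p$. Let $\mathfrak c=\bigoplus_{p\ge -2}\mathfrak c_p$ be the contact algebra, the maximal transitive prolongation of the Heisenberg algebra $\mathfrak c_-=\mathfrak c_{-2}\oplus\mathfrak c_{-1}$ of dimension $2r+1$,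 with grading element $E$. For $\mathfrak J\in\mathfrak c_0$ acting trivially on $\mathfrak c_{-2}$ and as a complex structure on $\mathfrak c_{-1}$, the eigenvalues of $\mathrm{ad}\,\mathfrak J$ on $\widehat{\mathfrak c}_p$ are $i\ell$ with $\ell=p+2,p,\dots,-p,-p-2$. Let $\mathfrak u_p$ be the sum of all its eigenspaces in $\widehat{\mathfrak c}_p$ except that of the minimal eigenvalue $-i(p+2)$. The universal CR algebra is $(\mathfrak c,\mathfrak u)$ with $\mathfrak u=\bigoplus_{p\ge -1}\mathfrak u_p$. A $k$-nondegenerate model (in the sense of Santi) is a graded Lie subalgebra $\mathfrak a=\bigoplus\mathfrak a_p$ of $\mathfrak c$ such that (i) $\mathfrak a_-=\mathfrak c_-$; (ii) $E\in\mathfrak a_0$; (iii) $\widehat{\mathfrak a}_p=(\widehat{\mathfrak a}_p\cap\mathfrak u_p)+(\widehat{\mathfrak a}_p\cap\overline{\mathfrak u}_p)$ for $p\ge 0$; (iv) the projection of $\widehat{\mathfrak a}_p$ to the $\mathrm{ad}\,\mathfrak J$-eigenspace of maximal eigenvalue $i(p+2)$ in $\widehat{\mathfrak c}_p$ is nonzero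 for $-2\le p\le k-2$ and zero for all $p\ge k-1$. **Theorem.** There are $r$ and an injective homomorphism of graded Lie algebras $\mathfrak g\to\mathfrak c$ that maps $\mathfrak g_{-2}\oplus\mathfrak g_{-1}$ onto $\mathfrak c_-$, together with an element $\mathfrak J\in\mathfrak c_0$ as above which acts on $\mathfrak c_{-1}=\mathfrak g_{-1}\cong D|_x/\mathrm{Re}(F^0)|_x$ as the complex structure induced by $J|_x$. For every such homomorphism and $\mathfrak J$, regarding $\mathfrak g$ as a subalgebra of $\mathfrak c$: if the identification $\mathfrak g\cong\mathrm{gr}(\mathfrak g)$ is aligned, i.e. $\mathfrak u_{-1}\subset\mathfrak q$, then 1. $\mathfrak q=\widehat{\mathfrak g}\cap\mathfrak u$, and $(\mathfrak g,\mathfrak q)$ is a $\mathbb Z$-graded CR subalgebra of the universal CR algebra $(\mathfrak c,\mathfrak u)$; 2. $\mathfrak g+\mathbb R E$ is a $k$-nondegenerate model. -/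

import Mathlib

open scoped Manifold ContDiff TensorProduct Topology
open VectorField

set_option linter.unusedSectionVars false

noncomputable section

namespace CR

/-! ### Complexification of a real vector space -/

section Complexification

variable {V : Type*} [AddCommGroup V] [Module ℝ V]

/-- The real part `ℂ ⊗ V → V`. -/
def cre : ℂ ⊗[ℝ] V →ₗ[ℝ] V :=
  (TensorProduct.lid ℝ V).toLinearMap ∘ₗ LinearMap.rTensor V Complex.reLm

/-- The imaginary part `ℂ ⊗ V → V`. -/
def cim : ℂ ⊗[ℝ] V →ₗ[ℝ] V :=
  (TensorProduct.lid ℝ V).toLinearMap ∘ₗ LinearMap.rTensor V Complex.imLm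

@[simp] theorem cre_tmul (z : ℂ) (v : V) : cre (z ⊗ₜ[ℝ] v) = z.re • v := by simp [cre]

@[simp] theorem cim_tmul (z : ℂ) (v : V) : cim (z ⊗ₜ[ℝ] v) = z.im • v := by simp [cim]

theorem cre_smul (c : ℂ) (w : ℂ ⊗[ℝ] V) : cre (c • w) = c.re • cre w - c.im • cim w := by
  induction w using TensorProduct.induction_on with
  | zero => simp
  | tmul z v => simp [TensorProduct.smul_tmul', sub_smul, mul_smul]
  | add a b ha hb => simp only [smul_add, map_add, ha, hb]; abel

theorem cim_smul (c : ℂ) (w : ℂ ⊗[ℝ] V) : cim (c • w) = c.re • cim w + c.im • cre w := by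
  induction w using TensorProduct.induction_on with
  | zero => simp
  | tmul z v => simp [TensorProduct.smul_tmul', add_smul, mul_smul]
  | add a b ha hb => simp only [smul_add, map_add, ha, hb]; abel

/-- Complex conjugation on `ℂ ⊗ V`, with fixed points `1 ⊗ V`. -/
def conj : ℂ ⊗[ℝ] V →ₛₗ[starRingEnd ℂ] ℂ ⊗[ℝ] V where
  toFun := LinearMap.rTensor V Complex.conjAe.toLinearMap
  map_add' := map_add _
  map_smul' c w := by
    induction w using TensorProduct.induction_on with
    | zero => simp
    | tmul z v => simp [TensorProduct.smul_tmul']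
    | add a b ha hb => simp only [smul_add, map_add, ha, hb]

/-- The complex conjugate of a complex subspace of `ℂ ⊗ V`. -/
def conjSubmodule (W : Submodule ℂ (ℂ ⊗[ℝ] V)) : Submodule ℂ (ℂ ⊗[ℝ] V) := W.map conj

end Complexification

/-! ### Real and complex vector fields on a manifold of dimension `d` -/

section VectorFields

variable {d : ℕ} {M : Type*} [TopologicalSpace M] [ChartedSpace (EuclideanSpace ℝ (Fin d)) M]
  [IsManifold (𝓡 d) ∞ M]

/-- The tangent space `T_y M`. -/
abbrev T (d : ℕ) {M : Type*} [TopologicalSpace M] [ChartedSpace (EuclideanSpace ℝ (Fin d)) M]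
    (y : M) : Type := TangentSpace (𝓡 d) y

/-- The complexified tangent space at `y`. -/
abbrev CT (d : ℕ) {M : Type*} [TopologicalSpace M] [ChartedSpace (EuclideanSpace ℝ (Fin d)) M]
    (y : M) : Type := ℂ ⊗[ℝ] T d y

/-- The (everywhere defined, arbitrary) vector field `X` is smooth on `U`. -/
def SmoothOn (U : Set M) (X : ∀ y : M, T d y) : Prop :=
  ContMDiffOn (𝓡 d) (𝓡 d).tangent ∞ (fun y => (⟨y, X y⟩ : TangentBundle (𝓡 d) M)) U

/-- The complex vector field `Z` is smooth on `U`. -/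
def CSmoothOn (U : Set M) (Z : ∀ y : M, CT d y) : Prop :=
  SmoothOn U (fun y => cre (Z y)) ∧ SmoothOn U (fun y => cim (Z y))

/-- The Lie bracket of vector fields. -/
def bracket (X Y : ∀ y : M, T d y) : ∀ y : M, T d y := mlieBracket (𝓡 d) X Y

/-- The complex bilinear extension of the Lie bracket to complex vector fields. -/
def cbracket (Z W : ∀ y : M, CT d y) : ∀ y : M, CT d y := fun y =>
  (1 : ℂ) ⊗ₜ[ℝ] (bracket (fun y => cre (Z y)) (fun y => cre (W y)) y
      - bracket (fun y => cim (Z y)) (fun y => cim (W y)) y)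
    + Complex.I ⊗ₜ[ℝ] (bracket (fun y => cre (Z y)) (fun y => cim (W y)) y
      + bracket (fun y => cim (Z y)) (fun y => cre (W y)) y)

/-- `Z` is on `U` a smooth section of the family `F` of complex tangent subspaces. -/
def IsSectionOn (U : Set M) (F : ∀ y : M, Submodule ℂ (CT d y)) (Z : ∀ y : M, CT d y) : Prop :=
  CSmoothOn U Z ∧ ∀ y ∈ U, Z y ∈ F y

/-- The family `D` of tangent subspaces is a smooth subbundle of `TM`: locally it has a smooth
frame. -/
def IsSubbundle (D : ∀ y : M, Submodule ℝ (T d y)) : Prop :=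
  ∀ x : M, ∃ U : Set M, IsOpen U ∧ x ∈ U ∧ ∃ (r : ℕ) (X : Fin r → ∀ y : M, T d y),
    (∀ i, SmoothOn U (X i)) ∧ ∀ y ∈ U, LinearIndependent ℝ (fun i => X i y) ∧
      Submodule.span ℝ (Set.range fun i => X i y) = D y

/-- The family `F` of complex tangent subspaces is a smooth subbundle of the complexified tangent
bundle. -/
def IsCSubbundle (F : ∀ y : M, Submodule ℂ (CT d y)) : Prop :=
  ∀ x : M, ∃ U : Set M, IsOpen U ∧ x ∈ U ∧ ∃ (r : ℕ) (Z : Fin r → ∀ y : M, CT d y),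
    (∀ i, CSmoothOn U (Z i)) ∧ ∀ y ∈ U, LinearIndependent ℂ (fun i => Z i y) ∧
      Submodule.span ℂ (Set.range fun i => Z i y) = F y

theorem SmoothOn.mono {U V : Set M} {X : ∀ y : M, T d y} (h : SmoothOn U X) (hV : V ⊆ U) :
    SmoothOn V X := ContMDiffOn.mono (M := M) h hV

theorem SmoothOn.at {U : Set M} {X : ∀ y : M, T d y} (h : SmoothOn U X) (hU : IsOpen U)
    {y : M} (hy : y ∈ U) :
    ContMDiffAt (𝓡 d) (𝓡 d).tangent ∞
      (fun y => (⟨y, X y⟩ : TangentBundle (𝓡 d) M)) y :=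
  ContMDiffOn.contMDiffAt (M := M) (s := U) h (hU.mem_nhds hy)

theorem SmoothOn.mdiffAt {U : Set M} {X : ∀ y : M, T d y} (h : SmoothOn U X) (hU : IsOpen U)
    {y : M} (hy : y ∈ U) :
    MDifferentiableAt (𝓡 d) (𝓡 d).tangent
      (fun y => (⟨y, X y⟩ : TangentBundle (𝓡 d) M)) y :=
  (h.at hU hy).mdifferentiableAt (by simp)

theorem SmoothOn.zero (U : Set M) : SmoothOn U (0 : ∀ y : M, T d y) :=
  (Bundle.contMDiff_zeroSection ℝ (TangentSpace (𝓡 d) (M := M))).contMDiffOn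

theorem SmoothOn.add {U : Set M} {X Y : ∀ y : M, T d y} (hX : SmoothOn U X)
    (hY : SmoothOn U Y) : SmoothOn U (X + Y) :=
  ContMDiffOn.add_section (V := TangentSpace (𝓡 d) (M := M)) hX hY

theorem SmoothOn.smul {U : Set M} {X : ∀ y : M, T d y} (c : ℝ) (hX : SmoothOn U X) :
    SmoothOn U (c • X) :=
  ContMDiffOn.const_smul_section (V := TangentSpace (𝓡 d) (M := M)) hX

theorem SmoothOn.bracket {U : Set M} (hU : IsOpen U) {X Y : ∀ y : M, T d y}
    (hX : SmoothOn U X) (hY : SmoothOn U Y) : SmoothOn U (bracket X Y) := by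
  intro y hy
  have hm : IsManifold (𝓡 d) (((⊤ : ℕ∞) : ℕ∞ω) + 1) M := by
    have : ((⊤ : ℕ∞) : ℕ∞ω) + 1 = ∞ := rfl
    rw [this]; infer_instance
  have h2 : IsManifold (𝓡 d) (minSmoothness ℝ 2) M := by
    rw [minSmoothness_of_isRCLikeNormedField]; infer_instance
  exact (ContMDiffAt.mlieBracket_vectorField (m := ⊤) (n := ⊤)
    (hX.at hU hy) (hY.at hU hy) (by simp)).contMDiffWithinAt

theorem bracket_jacobi {U : Set M} (hU : IsOpen U) {X Y Z : ∀ y : M, T d y}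
    (hX : SmoothOn U X) (hY : SmoothOn U Y) (hZ : SmoothOn U Z) {y : M} (hy : y ∈ U) :
    bracket X (bracket Y Z) y = bracket (bracket X Y) Z y + bracket Y (bracket X Z) y := by
  have h3 : IsManifold (𝓡 d) (minSmoothness ℝ 3) M := by
    rw [minSmoothness_of_isRCLikeNormedField]; infer_instance
  have hle : minSmoothness ℝ 2 ≤ ∞ := by
    rw [minSmoothness_of_isRCLikeNormedField]; exact ENat.LEInfty.out
  exact leibniz_identity_mlieBracket_apply ((hX.at hU hy).of_le hle) ((hY.at hU hy).of_le hle)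
    ((hZ.at hU hy).of_le hle)

theorem bracket_add_left {U : Set M} (hU : IsOpen U) {X Y : ∀ y : M, T d y}
    (hX : SmoothOn U X) (hY : SmoothOn U Y) (Z : ∀ y : M, T d y) {y : M} (hy : y ∈ U) :
    bracket (X + Y) Z y = bracket X Z y + bracket Y Z y :=
  mlieBracket_add_left (hX.mdiffAt hU hy) (hY.mdiffAt hU hy)

theorem bracket_smul_left {U : Set M} (hU : IsOpen U) {X : ∀ y : M, T d y}
    (hX : SmoothOn U X) (c : ℝ) (Z : ∀ y : M, T d y) {y : M} (hy : y ∈ U) :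
    bracket (c • X) Z y = c • bracket X Z y :=
  mlieBracket_const_smul_left (hX.mdiffAt hU hy)

theorem bracket_swap (X Y : ∀ y : M, T d y) (y : M) : bracket X Y y = - bracket Y X y :=
  mlieBracket_swap_apply

theorem bracket_congr {X X' Y Y' : ∀ y : M, T d y} {y : M} (hX : ∀ᶠ z in 𝓝 y, X z = X' z)
    (hY : ∀ᶠ z in 𝓝 y, Y z = Y' z) : bracket X Y y = bracket X' Y' y :=
  Filter.EventuallyEq.mlieBracket_vectorField_eq hX hY

/-- A real vector field as a complex one. -/
def ofReal (X : ∀ y : M, T d y) : ∀ y : M, CT d y := fun y => (1 : ℂ) ⊗ₜ[ℝ] X y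

theorem cre_ofReal (X : ∀ y : M, T d y) : (fun y => cre (ofReal X y)) = X := by
  funext y; simp [ofReal]

theorem cim_ofReal (X : ∀ y : M, T d y) : (fun y => cim (ofReal X y)) = 0 := by
  funext y; simp [ofReal]

theorem bracket_zero_left (X : ∀ y : M, T d y) : bracket 0 X = 0 := mlieBracket_zero_left

theorem cbracket_ofReal (X : ∀ y : M, T d y) (Z : ∀ y : M, CT d y) (y : M) :
    cbracket (ofReal X) Z y = (1 : ℂ) ⊗ₜ[ℝ] bracket X (fun y => cre (Z y)) y
      + Complex.I ⊗ₜ[ℝ] bracket X (fun y => cim (Z y)) y := by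
  simp only [cbracket, cre_ofReal, cim_ofReal, bracket_zero_left]
  simp

theorem cre_cbracket_ofReal (X : ∀ y : M, T d y) (Z : ∀ y : M, CT d y) :
    (fun y => cre (cbracket (ofReal X) Z y)) = bracket X (fun y => cre (Z y)) := by
  funext y; simp [cbracket_ofReal]

theorem cim_cbracket_ofReal (X : ∀ y : M, T d y) (Z : ∀ y : M, CT d y) :
    (fun y => cim (cbracket (ofReal X) Z y)) = bracket X (fun y => cim (Z y)) := by
  funext y; simp [cbracket_ofReal]

theorem cbracket_add_left {U : Set M} (hU : IsOpen U) {Z Z' : ∀ y : M, CT d y}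
    (hZ : CSmoothOn U Z) (hZ' : CSmoothOn U Z') (W : ∀ y : M, CT d y) {y : M} (hy : y ∈ U) :
    cbracket (Z + Z') W y = cbracket Z W y + cbracket Z' W y := by
  have h1 : (fun y => cre ((Z + Z') y)) = (fun y => cre (Z y)) + fun y => cre (Z' y) := by
    funext y; simp
  have h2 : (fun y => cim ((Z + Z') y)) = (fun y => cim (Z y)) + fun y => cim (Z' y) := by
    funext y; simp
  simp only [cbracket, h1, h2, bracket_add_left hU hZ.1 hZ'.1 _ hy,
    bracket_add_left hU hZ.2 hZ'.2 _ hy, TensorProduct.tmul_add, TensorProduct.tmul_sub]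
  abel

theorem CSmoothOn.add {U : Set M} {Z Z' : ∀ y : M, CT d y} (hZ : CSmoothOn U Z)
    (hZ' : CSmoothOn U Z') : CSmoothOn U (Z + Z') := by
  refine ⟨?_, ?_⟩
  · simpa using! hZ.1.add hZ'.1
  · simpa using! hZ.2.add hZ'.2

theorem CSmoothOn.mono {U V : Set M} {Z : ∀ y : M, CT d y} (h : CSmoothOn U Z) (hV : V ⊆ U) :
    CSmoothOn V Z := ⟨h.1.mono hV, h.2.mono hV⟩

theorem IsSectionOn.mono {U V : Set M} {F : ∀ y : M, Submodule ℂ (CT d y)} {Z : ∀ y : M, CT d y}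
    (h : IsSectionOn U F Z) (hV : V ⊆ U) : IsSectionOn V F Z :=
  ⟨h.1.mono hV, fun y hy => h.2 y (hV hy)⟩

theorem cre_smul_field (c : ℂ) (Z : ∀ y : M, CT d y) : (fun y => cre ((c • Z) y)) =
    c.re • (fun y => cre (Z y)) + (-c.im) • fun y => cim (Z y) := by
  funext y; simp [cre_smul, sub_eq_add_neg]

theorem cim_smul_field (c : ℂ) (Z : ∀ y : M, CT d y) : (fun y => cim ((c • Z) y)) =
    c.re • (fun y => cim (Z y)) + c.im • fun y => cre (Z y) := by
  funext y; simp [cim_smul]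

theorem CSmoothOn.smul {U : Set M} {Z : ∀ y : M, CT d y} (c : ℂ) (hZ : CSmoothOn U Z) :
    CSmoothOn U (c • Z) := by
  refine ⟨?_, ?_⟩
  · rw [cre_smul_field]; exact (hZ.1.smul _).add (hZ.2.smul _)
  · rw [cim_smul_field]; exact (hZ.2.smul _).add (hZ.1.smul _)

theorem cbracket_smul_left {U : Set M} (hU : IsOpen U) {Z : ∀ y : M, CT d y}
    (hZ : CSmoothOn U Z) (c : ℂ) (W : ∀ y : M, CT d y) {y : M} (hy : y ∈ U) :
    cbracket (c • Z) W y = c • cbracket Z W y := by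
  have key (a b : T d y) : c • ((1 : ℂ) ⊗ₜ[ℝ] a + Complex.I ⊗ₜ[ℝ] b) =
      (1 : ℂ) ⊗ₜ[ℝ] (c.re • a - c.im • b) + Complex.I ⊗ₜ[ℝ] (c.re • b + c.im • a) := by
    have e1 : c = c.re • (1 : ℂ) + c.im • Complex.I := by
      apply Complex.ext <;> simp
    have e2 : c * Complex.I = c.re • Complex.I - c.im • (1 : ℂ) := by
      apply Complex.ext <;> simp
    rw [smul_add, TensorProduct.smul_tmul', TensorProduct.smul_tmul', smul_eq_mul, smul_eq_mul,
      mul_one, e2]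
    nth_rewrite 1 [e1]
    simp only [TensorProduct.add_tmul, TensorProduct.sub_tmul, TensorProduct.tmul_add,
      TensorProduct.tmul_sub, TensorProduct.smul_tmul]
    abel
  simp only [cbracket, key, cre_smul_field, cim_smul_field,
    bracket_add_left hU (hZ.1.smul _) (hZ.2.smul _) _ hy,
    bracket_add_left hU (hZ.2.smul _) (hZ.1.smul _) _ hy,
    bracket_smul_left hU hZ.1 _ _ hy, bracket_smul_left hU hZ.2 _ _ hy]
  congr 2
  · module
  · module

theorem CSmoothOn.zero (U : Set M) : CSmoothOn U (0 : ∀ y : M, CT d y) := by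
  refine ⟨?_, ?_⟩
  · simpa using! SmoothOn.zero U
  · simpa using! SmoothOn.zero U

theorem cbracket_zero_left (W : ∀ y : M, CT d y) (y : M) : cbracket 0 W y = 0 := by
  have h1 : (fun y : M => cre ((0 : ∀ y : M, CT d y) y)) = 0 := by funext y; simp
  have h2 : (fun y : M => cim ((0 : ∀ y : M, CT d y) y)) = 0 := by funext y; simp
  simp only [cbracket, h1, h2, bracket_zero_left]
  simp

/-- The left kernel at `y` of the form `(Z, W) ↦ [Z, W]` from sections of `F` and sections of `G`
to the quotient by `F + G`: the values at `y` of the local sections `Z` of `F` near `y` such that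
`[Z, W]` at `y` lies in `F + G` for all local sections `W` of `G` near `y`. -/
def leftKernel (F G : ∀ y : M, Submodule ℂ (CT d y)) (y : M) : Submodule ℂ (CT d y) where
  carrier := {v | ∃ U : Set M, IsOpen U ∧ y ∈ U ∧ ∃ Z : ∀ y : M, CT d y, IsSectionOn U F Z ∧
    Z y = v ∧ ∀ (V : Set M) (W : ∀ y : M, CT d y), IsOpen V → y ∈ V → IsSectionOn V G W →
      cbracket Z W y ∈ F y ⊔ G y}
  add_mem' := by
    rintro _ _ ⟨U, hU, hy, Z, hZ, rfl, h⟩ ⟨U', hU', hy', Z', hZ', rfl, h'⟩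
    refine ⟨U ∩ U', hU.inter hU', ⟨hy, hy'⟩, Z + Z', ⟨?_, ?_⟩, rfl, ?_⟩
    · exact (hZ.1.mono Set.inter_subset_left).add (hZ'.1.mono Set.inter_subset_right)
    · exact fun z hz => (F z).add_mem (hZ.2 z hz.1) (hZ'.2 z hz.2)
    · intro V W hV hyV hW
      rw [cbracket_add_left (hU.inter hU') (hZ.1.mono Set.inter_subset_left)
        (hZ'.1.mono Set.inter_subset_right) W ⟨hy, hy'⟩]
      exact Submodule.add_mem _ (h V W hV hyV hW) (h' V W hV hyV hW)
  zero_mem' := ⟨Set.univ, isOpen_univ, trivial, 0,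
    ⟨CSmoothOn.zero _, fun z _ => (F z).zero_mem⟩, rfl, fun V W _ _ _ => by
      rw [cbracket_zero_left]; exact Submodule.zero_mem _⟩
  smul_mem' := by
    rintro c _ ⟨U, hU, hy, Z, hZ, rfl, h⟩
    refine ⟨U, hU, hy, c • Z, ⟨hZ.1.smul c, fun z hz => (F z).smul_mem c (hZ.2 z hz)⟩, rfl, ?_⟩
    intro V W hV hyV hW
    rw [cbracket_smul_left hU hZ.1 c W hy]
    exact Submodule.smul_mem _ c (h V W hV hyV hW)

end VectorFields

/-! ### CR hypersurfaces -/

section Hypersurface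

variable (n : ℕ) (M : Type*) [TopologicalSpace M]
  [ChartedSpace (EuclideanSpace ℝ (Fin (2 * n + 1))) M] [IsManifold (𝓡 (2 * n + 1)) ∞ M]

/-- An almost CR structure `(D, J)` of hypersurface type: a subbundle `D` of the tangent bundle of
corank one, with a field `J` of complex structures on `D`. -/
structure AlmostCRHypersurface where
  /-- the CR distribution -/
  D : ∀ y : M, Submodule ℝ (T (2 * n + 1) y)
  /-- the field of complex structures -/
  J : ∀ y : M, D y →ₗ[ℝ] D y
  finrank_D : ∀ y, Module.finrank ℝ (D y) = 2 * n
  J_J : ∀ y v, J y (J y v) = -v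
  smooth_D : IsSubbundle D
  smooth_J : ∀ (U : Set M) (X : ∀ y : M, D y), IsOpen U →
    SmoothOn U (fun y => (X y : T (2 * n + 1) y)) →
    SmoothOn U (fun y => (J y (X y) : T (2 * n + 1) y))

variable {n M}

/-- The holomorphic part `D₁₀ = {X - i J X}` of the complexified CR distribution. -/
def AlmostCRHypersurface.D10 (S : AlmostCRHypersurface n M) (y : M) :
    Submodule ℂ (CT (2 * n + 1) y) :=
  Submodule.span ℂ (Set.range fun v : S.D y =>
    (1 : ℂ) ⊗ₜ[ℝ] (v : T (2 * n + 1) y) - Complex.I ⊗ₜ[ℝ] (S.J y v : T (2 * n + 1) y))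

variable (n M)

/-- A CR hypersurface of CR dimension `n`: the distribution `D₁₀` is involutive. -/
structure CRHypersurface extends AlmostCRHypersurface n M where
  integrable : ∀ (U : Set M) (Z W : ∀ y : M, CT (2 * n + 1) y), IsOpen U →
    IsSectionOn U toAlmostCRHypersurface.D10 Z → IsSectionOn U toAlmostCRHypersurface.D10 W →
    ∀ y ∈ U, cbracket Z W y ∈ toAlmostCRHypersurface.D10 y

variable {n M}

namespace CRHypersurface

variable (S : CRHypersurface n M)

/-- The antiholomorphic part of the complexified CR distribution. -/
def D01 (y : M) : Submodule ℂ (CT (2 * n + 1) y) := conjSubmodule (S.D10 y)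

/-- The Freeman sequence. The family `S.freeman m` is the bundle `F₁₀` of index `m - 1`: the term of
index `-1` is `D₁₀`, and each further term is the left kernel of the higher order Levi form
`(Z, W) ↦ [Z, W]` mod `F₁₀ + D₀₁`, for `Z` in the preceding term `F₁₀` and `W` in `D₀₁`. -/
def freeman : ℕ → ∀ y : M, Submodule ℂ (CT (2 * n + 1) y)
  | 0 => S.D10
  | m + 1 => leftKernel (freeman m) S.D01

/-- All terms of the Freeman sequence are subbundles. -/
def IsRegular : Prop := ∀ m, IsCSubbundle (S.freeman m)

/-- `k`-nondegeneracy at `x`: the Freeman bundles of index `-1, ..., k - 2` do not vanish at `x`,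
that of index `k - 1` does. -/
def IsNondegenerateAt (k : ℕ) (x : M) : Prop :=
  (∀ m < k, S.freeman m x ≠ ⊥) ∧ S.freeman k x = ⊥

/-- The real subspace `Re (F₁₀ + F₀₁)` of `D` at `y`, for the Freeman term of index `0` (the Cauchy
characteristic space, the kernel of the Levi form). -/
def reF0 (y : M) : Submodule ℝ (T (2 * n + 1) y) :=
  ((S.freeman 1 y).restrictScalars ℝ).map cre

/-- The vector field `X` is an infinitesimal CR automorphism on `U`: it is smooth and its flow
preserves `D₁₀` (hence `D` and `J`), that is, `[X, D₁₀] ⊆ D₁₀`. -/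
def IsInfAut (U : Set M) (X : ∀ y : M, T (2 * n + 1) y) : Prop :=
  SmoothOn U X ∧ ∀ (V : Set M) (Z : ∀ y : M, CT (2 * n + 1) y), IsOpen V → V ⊆ U →
    IsSectionOn V S.D10 Z → ∀ y ∈ V, cbracket (ofReal X) Z y ∈ S.D10 y

variable {S}

theorem IsInfAut.mono {U V : Set M} {X : ∀ y : M, T (2 * n + 1) y} (h : S.IsInfAut U X)
    (hV : V ⊆ U) : S.IsInfAut V X :=
  ⟨h.1.mono hV, fun V' Z hV' hs hZ => h.2 V' Z hV' (hs.trans hV) hZ⟩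

theorem ofReal_add (X Y : ∀ y : M, T (2 * n + 1) y) : ofReal (X + Y) = ofReal X + ofReal Y := by
  funext y; simp [ofReal, TensorProduct.tmul_add]

theorem ofReal_smul (c : ℝ) (X : ∀ y : M, T (2 * n + 1) y) :
    ofReal (c • X) = (c : ℂ) • ofReal X := by
  funext y
  simp [ofReal, TensorProduct.smul_tmul', ← TensorProduct.smul_tmul (R := ℝ) c (1 : ℂ)]

theorem csmoothOn_ofReal {U : Set M} {X : ∀ y : M, T (2 * n + 1) y} (h : SmoothOn U X) :
    CSmoothOn U (ofReal X) := by
  refine ⟨by rw [cre_ofReal]; exact h, by rw [cim_ofReal]; exact SmoothOn.zero U⟩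

theorem IsInfAut.add {U : Set M} (hU : IsOpen U) {X Y : ∀ y : M, T (2 * n + 1) y}
    (hX : S.IsInfAut U X) (hY : S.IsInfAut U Y) : S.IsInfAut U (X + Y) := by
  refine ⟨hX.1.add hY.1, fun V Z hV hs hZ y hy => ?_⟩
  rw [ofReal_add, cbracket_add_left hU (csmoothOn_ofReal hX.1) (csmoothOn_ofReal hY.1) Z (hs hy)]
  exact add_mem (hX.2 V Z hV hs hZ y hy) (hY.2 V Z hV hs hZ y hy)

theorem IsInfAut.smul {U : Set M} (hU : IsOpen U) {X : ∀ y : M, T (2 * n + 1) y} (c : ℝ)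
    (hX : S.IsInfAut U X) : S.IsInfAut U (c • X) := by
  refine ⟨hX.1.smul c, fun V Z hV hs hZ y hy => ?_⟩
  rw [ofReal_smul, cbracket_smul_left hU (csmoothOn_ofReal hX.1) _ Z (hs hy)]
  exact Submodule.smul_mem _ _ (hX.2 V Z hV hs hZ y hy)

theorem IsInfAut.zero (U : Set M) : S.IsInfAut U 0 := by
  refine ⟨SmoothOn.zero U, fun V Z hV hs hZ y hy => ?_⟩
  have : ofReal (0 : ∀ y : M, T (2 * n + 1) y) = 0 := by funext y; simp [ofReal]
  rw [this, cbracket_zero_left]; exact Submodule.zero_mem _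

theorem IsInfAut.section {U V : Set M} {X : ∀ y : M, T (2 * n + 1) y} (hX : S.IsInfAut U X)
    {Z : ∀ y : M, CT (2 * n + 1) y} (hV : IsOpen V) (hs : V ⊆ U) (hZ : IsSectionOn V S.D10 Z) :
    IsSectionOn V S.D10 (cbracket (ofReal X) Z) := by
  refine ⟨⟨?_, ?_⟩, hX.2 V Z hV hs hZ⟩
  · rw [cre_cbracket_ofReal]; exact (hX.1.mono hs).bracket hV hZ.1.1
  · rw [cim_cbracket_ofReal]; exact (hX.1.mono hs).bracket hV hZ.1.2

theorem IsInfAut.bracket {U : Set M} (hU : IsOpen U) {X Y : ∀ y : M, T (2 * n + 1) y}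
    (hX : S.IsInfAut U X) (hY : S.IsInfAut U Y) : S.IsInfAut U (CR.bracket X Y) := by
  refine ⟨hX.1.bracket hU hY.1, fun V Z hV hs hZ y hy => ?_⟩
  have key : cbracket (ofReal (CR.bracket X Y)) Z y =
      cbracket (ofReal X) (cbracket (ofReal Y) Z) y
        - cbracket (ofReal Y) (cbracket (ofReal X) Z) y := by
    rw [cbracket_ofReal (CR.bracket X Y), cbracket_ofReal X, cbracket_ofReal Y]
    simp only [cre_cbracket_ofReal, cim_cbracket_ofReal]
    rw [bracket_jacobi hV (hX.1.mono hs) (hY.1.mono hs) hZ.1.1 hy,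
      bracket_jacobi hV (hX.1.mono hs) (hY.1.mono hs) hZ.1.2 hy]
    simp only [TensorProduct.tmul_add]
    abel
  rw [key]
  exact sub_mem (hX.2 V _ hV hs (hY.section hV hs hZ) y hy)
    (hY.2 V _ hV hs (hX.section hV hs hZ) y hy)

variable (S)

/-- The vector fields that are infinitesimal CR automorphisms near `x`. -/
def preInf (x : M) : Submodule ℝ (∀ y : M, T (2 * n + 1) y) where
  carrier := {X | ∃ U : Set M, IsOpen U ∧ x ∈ U ∧ S.IsInfAut U X}
  add_mem' := by
    rintro X Y ⟨U, hU, hx, hX⟩ ⟨V, hV, hx', hY⟩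
    exact ⟨U ∩ V, hU.inter hV, ⟨hx, hx'⟩, (hX.mono Set.inter_subset_left).add (hU.inter hV)
      (hY.mono Set.inter_subset_right)⟩
  zero_mem' := ⟨Set.univ, isOpen_univ, trivial, IsInfAut.zero _⟩
  smul_mem' := by
    rintro c X ⟨U, hU, hx, hX⟩
    exact ⟨U, hU, hx, hX.smul hU c⟩

/-- Those that vanish near `x`. -/
def nullInf (x : M) : Submodule ℝ (S.preInf x) where
  carrier := {X | ∀ᶠ y in 𝓝 x, X.1 y = 0}
  add_mem' := by
    intro X Y hX hY
    filter_upwards [hX, hY] with y h1 h2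
    simp [h1, h2]
  zero_mem' := by simp
  smul_mem' := by
    intro c X hX
    filter_upwards [hX] with y h1
    simp [h1]

/-- The Lie algebra `inf(M, D, J; x)` of germs at `x` of infinitesimal CR automorphisms. -/
def Inf (x : M) : Type _ := S.preInf x ⧸ S.nullInf x

instance (x : M) : AddCommGroup (S.Inf x) := inferInstanceAs (AddCommGroup (_ ⧸ S.nullInf x))

instance (x : M) : Module ℝ (S.Inf x) := inferInstanceAs (Module ℝ (_ ⧸ S.nullInf x))

variable {S}

/-- The germ at `x` of an infinitesimal CR automorphism. -/
def germ {x : M} : S.preInf x →ₗ[ℝ] S.Inf x := (S.nullInf x).mkQ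

theorem germ_surjective {x : M} : Function.Surjective (germ : S.preInf x → S.Inf x) :=
  (S.nullInf x).mkQ_surjective

theorem germ_eq_iff {x : M} {X Y : S.preInf x} :
    germ X = germ Y ↔ ∀ᶠ y in 𝓝 x, X.1 y = Y.1 y := by
  refine (Submodule.Quotient.eq (S.nullInf x)).trans ?_
  refine Filter.eventually_congr (Filter.Eventually.of_forall fun y => ?_)
  simp [sub_eq_zero]

/-- The bracket of representatives. -/
def preBracket {x : M} (X Y : S.preInf x) : S.preInf x :=
  ⟨CR.bracket X.1 Y.1, by
    obtain ⟨U, hU, hx, hX⟩ := X.2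
    obtain ⟨V, hV, hx', hY⟩ := Y.2
    exact ⟨U ∩ V, hU.inter hV, ⟨hx, hx'⟩, (hX.mono Set.inter_subset_left).bracket (hU.inter hV)
      (hY.mono Set.inter_subset_right)⟩⟩

instance (x : M) : Bracket (S.Inf x) (S.Inf x) where
  bracket := Quotient.map₂ preBracket (by
    intro X X' hX Y Y' hY
    have hX' : ∀ᶠ y in 𝓝 x, X.1 y = X'.1 y := germ_eq_iff.1 (Quotient.sound hX)
    have hY' : ∀ᶠ y in 𝓝 x, Y.1 y = Y'.1 y := germ_eq_iff.1 (Quotient.sound hY)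
    refine Quotient.exact (germ_eq_iff.2 ?_)
    filter_upwards [hX'.eventually_nhds, hY'.eventually_nhds] with y h1 h2
    exact bracket_congr h1 h2)

theorem lie_germ {x : M} (X Y : S.preInf x) : ⁅germ X, germ Y⁆ = germ (preBracket X Y) := rfl

theorem add_lie_germ {x : M} (X Y Z : S.Inf x) : ⁅X + Y, Z⁆ = ⁅X, Z⁆ + ⁅Y, Z⁆ := by
  obtain ⟨X, rfl⟩ := germ_surjective X
  obtain ⟨Y, rfl⟩ := germ_surjective Y
  obtain ⟨Z, rfl⟩ := germ_surjective Z
  rw [← map_add, lie_germ, lie_germ, lie_germ, ← map_add, germ_eq_iff]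
  obtain ⟨U, hU, hx, hX⟩ := X.2
  obtain ⟨V, hV, hx', hY⟩ := Y.2
  filter_upwards [(hU.inter hV).mem_nhds ⟨hx, hx'⟩] with y hy
  exact bracket_add_left (hU.inter hV) (hX.1.mono Set.inter_subset_left)
    (hY.1.mono Set.inter_subset_right) Z.1 hy

theorem smul_lie_germ {x : M} (c : ℝ) (X Z : S.Inf x) : ⁅c • X, Z⁆ = c • ⁅X, Z⁆ := by
  obtain ⟨X, rfl⟩ := germ_surjective X
  obtain ⟨Z, rfl⟩ := germ_surjective Z
  rw [← map_smul, lie_germ, lie_germ, ← map_smul, germ_eq_iff]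
  obtain ⟨U, hU, hx, hX⟩ := X.2
  filter_upwards [hU.mem_nhds hx] with y hy
  exact bracket_smul_left hU hX.1 c Z.1 hy

theorem lie_germ_swap {x : M} (X Y : S.Inf x) : ⁅X, Y⁆ = -⁅Y, X⁆ := by
  obtain ⟨X, rfl⟩ := germ_surjective X
  obtain ⟨Y, rfl⟩ := germ_surjective Y
  rw [lie_germ, lie_germ, ← map_neg, germ_eq_iff]
  exact Filter.Eventually.of_forall fun y => bracket_swap X.1 Y.1 y

instance (x : M) : LieRing (S.Inf x) where
  add_lie := add_lie_germ
  lie_add X Y Z := by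
    rw [lie_germ_swap, add_lie_germ, lie_germ_swap Y, lie_germ_swap Z]; abel
  lie_self X := by
    have h := lie_germ_swap X X
    have h2 : (2 : ℝ) • ⁅X, X⁆ = 0 := by
      rw [two_smul]; nth_rewrite 1 [h]; exact neg_add_cancel _
    exact (smul_eq_zero.1 h2).resolve_left two_ne_zero
  leibniz_lie X Y Z := by
    obtain ⟨X, rfl⟩ := germ_surjective X
    obtain ⟨Y, rfl⟩ := germ_surjective Y
    obtain ⟨Z, rfl⟩ := germ_surjective Z
    simp only [lie_germ]
    rw [← map_add, germ_eq_iff]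
    obtain ⟨U, hU, hx, hX⟩ := X.2
    obtain ⟨V, hV, hx', hY⟩ := Y.2
    obtain ⟨W, hW, hx'', hZ⟩ := Z.2
    filter_upwards [((hU.inter hV).inter hW).mem_nhds ⟨⟨hx, hx'⟩, hx''⟩] with y hy
    exact bracket_jacobi ((hU.inter hV).inter hW) (hX.1.mono fun z hz => hz.1.1)
      (hY.1.mono fun z hz => hz.1.2) (hZ.1.mono fun z hz => hz.2) hy

instance (x : M) : LieAlgebra ℝ (S.Inf x) where
  lie_smul c X Y := by
    rw [lie_germ_swap, smul_lie_germ, lie_germ_swap Y, smul_neg, neg_neg]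

/-- The evaluation at `x` of germs at `x`. -/
def ev {x : M} : S.Inf x →ₗ[ℝ] T (2 * n + 1) x :=
  (S.nullInf x).liftQ ((LinearMap.proj x).comp (S.preInf x).subtype) fun X hX =>
    Filter.Eventually.self_of_nhds (p := fun y => X.1 y = 0) hX

@[simp] theorem ev_germ {x : M} (X : S.preInf x) : ev (germ X) = X.1 x := rfl

variable {x : M} (g : LieSubalgebra ℝ (S.Inf x))

/-- The evaluation at `x` on a Lie algebra `g` of germs of infinitesimal CR automorphisms. -/
def evOn : g →ₗ[ℝ] T (2 * n + 1) x := ev ∘ₗ g.toSubmodule.subtype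

/-- The Lie algebra `g` acts transitively at `x`. -/
def IsTransitive : Prop := Function.Surjective (evOn g)

/-- The complex subspace `q = {ξ | ev ξ ∈ D₁₀}` of the complexification of `g`. The pair `(g, q)` is
the CR algebra of the germ `(M, D, J; x)` with respect to `g`. -/
def q : Submodule ℂ (ℂ ⊗[ℝ] g) := (S.D10 x).comap ((evOn g).baseChange ℂ)

/-- The subspace `g^{-1} = {ξ | ev ξ ∈ D}`. -/
def filtNegOne : Submodule ℝ g := (S.D x).comap (evOn g)

end CRHypersurface

end Hypersurface

/-! ### The contact filtration and trivial filtered deformations -/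

section Filtration

variable {g : Type*} [LieRing g] [LieAlgebra ℝ g]

/-- The terms `g^{-1}, g^0, g^1, ...`, starting from `g1 = g^{-1}`, where
`g^p = {ξ ∈ g^{p-1} | [ξ, g^{-1}] ⊆ g^{p-1}}` for `p ≥ 0`. -/
def upperFiltration (g1 : Submodule ℝ g) : ℕ → Submodule ℝ g
  | 0 => g1
  | m + 1 =>
    { carrier := {ξ | ξ ∈ upperFiltration g1 m ∧ ∀ η ∈ g1, ⁅ξ, η⁆ ∈ upperFiltration g1 m}
      add_mem' := fun ha hb => ⟨add_mem ha.1 hb.1, fun η hη => by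
        rw [add_lie]; exact add_mem (ha.2 η hη) (hb.2 η hη)⟩
      zero_mem' := ⟨zero_mem _, fun η _ => by rw [zero_lie]; exact zero_mem _⟩
      smul_mem' := fun c _ ha => ⟨Submodule.smul_mem _ c ha.1, fun η hη => by
        rw [smul_lie]; exact Submodule.smul_mem _ c (ha.2 η hη)⟩ }

/-- The terms `g^{-1}, g^{-2}, g^{-3}, ...`, starting from `g1 = g^{-1}`, where
`g^q = g^{q+1} + [g^{-1}, g^{q+1}]` for `q ≤ -2`. -/
def lowerFiltration (g1 : Submodule ℝ g) : ℕ → Submodule ℝ g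
  | 0 => g1
  | m + 1 => lowerFiltration g1 m ⊔
      Submodule.span ℝ {ζ | ∃ η ∈ g1, ∃ ξ ∈ lowerFiltration g1 m, ζ = ⁅η, ξ⁆}

/-- The contact filtration `p ↦ g^p` determined by `g1 = g^{-1}`. -/
def contactFiltration (g1 : Submodule ℝ g) (p : ℤ) : Submodule ℝ g :=
  if -1 ≤ p then upperFiltration g1 (p + 1).toNat else lowerFiltration g1 (-1 - p).toNat

/-- The grading `G` of the Lie algebra `g` splits the decreasing filtration `F`. Such a `G` is the
same as an isomorphism of filtered Lie algebras of `g` with its associated graded Lie algebra (with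
`G p` corresponding to `F p / F (p + 1)`) that induces the identity on associated graded Lie
algebras; it exists if and only if `g` is a trivial filtered deformation. -/
structure IsSplitting (F : ℤ → Submodule ℝ g) (G : ℤ → Submodule ℝ g) : Prop where
  isInternal : DirectSum.IsInternal G
  lie_mem : ∀ i j, ∀ a ∈ G i, ∀ b ∈ G j, ⁅a, b⁆ ∈ G (i + j)
  filtration : ∀ p, F p = ⨆ j, ⨆ (_ : p ≤ j), G j

end Filtration

/-! ### The contact algebra and the universal CR algebra -/

section Contact

variable (r : ℕ)

/-- The polynomials on `ℝ^{2r+1}` with coordinates `q₁, ..., q_r`, `p₁, ..., p_r`, `t`. -/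
abbrev Poly : Type := MvPolynomial (Fin r ⊕ Fin r ⊕ Unit) ℝ

variable {r}

/-- The coordinate `q_i`. -/
def qvar (i : Fin r) : Poly r := MvPolynomial.X (Sum.inl i)

/-- The coordinate `p_i`. -/
def pvar (i : Fin r) : Poly r := MvPolynomial.X (Sum.inr (Sum.inl i))

/-- The coordinate `t`. -/
def tvar : Poly r := MvPolynomial.X (Sum.inr (Sum.inr ()))

/-- The contact form `dt - ∑ p_i dq_i`, evaluated on a polynomial vector field. -/
def contactForm (X : Derivation ℝ (Poly r) (Poly r)) : Poly r :=
  X tvar - ∑ i, pvar i * X (qvar i)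

variable (r)

/-- The contact algebra `c`: the polynomial vector fields on `ℝ^{2r+1}` that preserve the contact
distribution `dt = ∑ p_i dq_i`. With the grading below, for which `q_i`, `p_i` have weight `1` and `t`
has weight `2`, it is the maximal transitive prolongation of its negative part
`c_{-2} + c_{-1}`, which is the Heisenberg algebra of dimension `2r + 1`. -/
def contactAlgebra : LieSubalgebra ℝ (Derivation ℝ (Poly r) (Poly r)) where
  carrier := {X | ∀ Y : Derivation ℝ (Poly r) (Poly r), contactForm Y = 0 → contactForm ⁅X, Y⁆ = 0}
  add_mem' := by
    intro X X' hX hX' Y hY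
    have h : ∀ A B : Derivation ℝ (Poly r) (Poly r),
        contactForm (A + B) = contactForm A + contactForm B := fun A B => by
      simp only [contactForm, Derivation.add_apply, mul_add, Finset.sum_add_distrib]; ring
    rw [show ⁅X + X', Y⁆ = ⁅X, Y⁆ + ⁅X', Y⁆ from add_lie X X' Y, h, hX Y hY, hX' Y hY, add_zero]
  zero_mem' := by
    intro Y _
    rw [show ⁅(0 : Derivation ℝ (Poly r) (Poly r)), Y⁆ = 0 from zero_lie Y]
    simp [contactForm]
  smul_mem' := by
    intro c X hX Y hY
    have h : ∀ A : Derivation ℝ (Poly r) (Poly r),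
        contactForm (c • A) = c • contactForm A := fun A => by
      simp only [contactForm, Derivation.smul_apply, mul_smul_comm, smul_sub, Finset.smul_sum]
    rw [show ⁅c • X, Y⁆ = c • ⁅X, Y⁆ from smul_lie c X Y, h, hX Y hY, smul_zero]
  lie_mem' := by
    intro X X' hX hX' Y hY
    have h : ∀ A B : Derivation ℝ (Poly r) (Poly r),
        contactForm (A - B) = contactForm A - contactForm B := fun A B => by
      simp only [contactForm, Derivation.sub_apply, mul_sub, Finset.sum_sub_distrib]; ring
    rw [show ⁅⁅X, X'⁆, Y⁆ = ⁅X, ⁅X', Y⁆⁆ - ⁅X', ⁅X, Y⁆⁆ from lie_lie X X' Y, h,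
      hX _ (hX' Y hY), hX' _ (hX Y hY), sub_zero]

/-- The weighted Euler field `∑ (q_i ∂/∂q_i + p_i ∂/∂p_i) + 2 t ∂/∂t`. -/
def euler : Derivation ℝ (Poly r) (Poly r) :=
  MvPolynomial.mkDerivation ℝ (Sum.elim (fun i => qvar i)
    (Sum.elim (fun i => pvar i) fun _ => 2 * tvar))

theorem euler_mem : euler r ∈ contactAlgebra r := by
  intro Y hY
  have hq (i : Fin r) : euler r (qvar i) = qvar i := by
    simp [euler, qvar, MvPolynomial.mkDerivation_X]
  have hp (i : Fin r) : euler r (pvar i) = pvar i := by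
    simp [euler, pvar, MvPolynomial.mkDerivation_X]
  have ht : euler r tvar = tvar + tvar := by
    simp [← two_mul, euler, tvar, MvPolynomial.mkDerivation_X]
  have key : contactForm ⁅euler r, Y⁆ = euler r (contactForm Y) - 2 * contactForm Y := by
    simp only [contactForm, Derivation.commutator_apply, map_sub, map_add, map_sum, Derivation.leibniz, hq,
      hp, ht, smul_eq_mul, mul_sub, Finset.sum_sub_distrib, Finset.sum_add_distrib,
      Finset.mul_sum, two_mul]
    have : ∀ i, Y (qvar i) * pvar i = pvar i * Y (qvar i) := fun i => mul_comm _ _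
    simp only [this]
    ring
  rw [key, hY]; simp

/-- The grading element `E` of the contact algebra. -/
def gradingElement : contactAlgebra r := ⟨euler r, euler_mem r⟩

variable {r}

/-- The component `c_p` of the contact algebra: the elements `X` with `[E, X] = p X`. -/
def grade (p : ℤ) : Submodule ℝ (contactAlgebra r) :=
  Module.End.eigenspace (LieAlgebra.ad ℝ (contactAlgebra r) (gradingElement r)) (p : ℝ)

/-- The complexification of `c_p`. -/
def cgrade (p : ℤ) : Submodule ℂ (ℂ ⊗[ℝ] contactAlgebra r) := (grade p).baseChange ℂ

/-- The element `𝔍` of `c_0` acts trivially on `c_{-2}` and as a complex structure on `c_{-1}`. -/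
structure IsComplexStructure (𝔍 : contactAlgebra r) : Prop where
  mem_grade : 𝔍 ∈ grade 0
  lie_neg_two : ∀ z ∈ grade (r := r) (-2), ⁅𝔍, z⁆ = 0
  lie_lie_neg_one : ∀ v ∈ grade (r := r) (-1), ⁅𝔍, ⁅𝔍, v⁆⁆ = -v

/-- The eigenspace of `ad 𝔍` of eigenvalue `μ` in the complexification of `c_p`. -/
def adEigenspace (𝔍 : contactAlgebra r) (p : ℤ) (μ : ℂ) : Submodule ℂ (ℂ ⊗[ℝ] contactAlgebra r) :=
  cgrade p ⊓ Module.End.eigenspace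
    (LieAlgebra.ad ℂ (ℂ ⊗[ℝ] contactAlgebra r) ((1 : ℂ) ⊗ₜ[ℝ] 𝔍)) μ

/-- The sum of all eigenspaces of `ad 𝔍` in the complexification of `c_p`, except that of eigenvalue
`μ`. (The complexification of `c_p` is the direct sum of the eigenspaces, of eigenvalues `i ℓ` with
`ℓ = p + 2, p, ..., -p, -p - 2`.) -/
def exceptEigenspace (𝔍 : contactAlgebra r) (p : ℤ) (μ : ℂ) :
    Submodule ℂ (ℂ ⊗[ℝ] contactAlgebra r) :=
  ⨆ ν : ℂ, ⨆ (_ : ν ≠ μ), adEigenspace 𝔍 p ν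

/-- The component `u_p` of the universal CR algebra: the sum of all eigenspaces of `ad 𝔍` in the
complexification of `c_p`, except that of minimal eigenvalue `-i (p + 2)`. -/
def uComponent (𝔍 : contactAlgebra r) (p : ℤ) : Submodule ℂ (ℂ ⊗[ℝ] contactAlgebra r) :=
  exceptEigenspace 𝔍 p (-(((p : ℂ) + 2) * Complex.I))

/-- The subspace `u`, the sum of the `u_p` with `p ≥ -1`. The pair `(c, u)` is the universal CR
algebra. -/
def universalCR (𝔍 : contactAlgebra r) : Submodule ℂ (ℂ ⊗[ℝ] contactAlgebra r) :=
  ⨆ p : ℤ, ⨆ (_ : -1 ≤ p), uComponent 𝔍 p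

/-- The pair `(s, h)` is a graded CR subalgebra of the universal CR algebra `(c, u)`: `s` is a graded
subalgebra of `c`, and `h` is a graded complex subalgebra of the complexification of `s`, equal to its
intersection with `u`. -/
structure IsGradedCRSubalgebra (𝔍 : contactAlgebra r) (s : LieSubalgebra ℝ (contactAlgebra r))
    (h : Submodule ℂ (ℂ ⊗[ℝ] contactAlgebra r)) : Prop where
  graded_real : s.toSubmodule = ⨆ p : ℤ, s.toSubmodule ⊓ grade p
  lie_mem : ∀ a ∈ h, ∀ b ∈ h, ⁅a, b⁆ ∈ h
  graded : h = ⨆ p : ℤ, h ⊓ cgrade p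
  eq_inter : h = s.toSubmodule.baseChange ℂ ⊓ universalCR 𝔍

/-- The complexification of the component `a_p = a ∩ c_p` of a graded subalgebra `a` of `c`. -/
def ccomponent (a : LieSubalgebra ℝ (contactAlgebra r)) (p : ℤ) :
    Submodule ℂ (ℂ ⊗[ℝ] contactAlgebra r) :=
  (a.toSubmodule ⊓ grade p).baseChange ℂ

/-- The subalgebra `a` of the contact algebra is a `k`-nondegenerate model. -/
structure IsModel (k : ℕ) (𝔍 : contactAlgebra r) (a : LieSubalgebra ℝ (contactAlgebra r)) :
    Prop where
  graded : a.toSubmodule = ⨆ p : ℤ, a.toSubmodule ⊓ grade p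
  neg : ∀ p < 0, grade p ≤ a.toSubmodule
  grading_mem : gradingElement r ∈ a
  sum : ∀ p : ℤ, 0 ≤ p → ccomponent a p =
    (ccomponent a p ⊓ uComponent 𝔍 p) ⊔ (ccomponent a p ⊓ conjSubmodule (uComponent 𝔍 p))
  /-- Nontrivial projection to the eigenspace of maximal eigenvalue, along the other eigenspaces. -/
  proj_ne : ∀ p : ℤ, -2 ≤ p → p ≤ (k : ℤ) - 2 →
    ¬ ccomponent a p ≤ exceptEigenspace 𝔍 p (((p : ℂ) + 2) * Complex.I)
  /-- Trivial projection to the eigenspace of maximal eigenvalue, along the other eigenspaces. -/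
  proj_eq : ∀ p : ℤ, (k : ℤ) - 1 ≤ p →
    ccomponent a p ≤ exceptEigenspace 𝔍 p (((p : ℂ) + 2) * Complex.I)

end Contact

/-! ### Identifications of a graded symmetry algebra with a subalgebra of the contact algebra -/

namespace CRHypersurface

variable {n : ℕ} {M : Type*} [TopologicalSpace M]
  [ChartedSpace (EuclideanSpace ℝ (Fin (2 * n + 1))) M] [IsManifold (𝓡 (2 * n + 1)) ∞ M]
  {S : CRHypersurface n M} {x : M} (g : LieSubalgebra ℝ (S.Inf x))

/-- The contact filtration of the Lie algebra `g`. -/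
def filtration (p : ℤ) : Submodule ℝ g := contactFiltration (filtNegOne g) p

variable {g} {r : ℕ}

/-- The graded Lie algebra `g`, with grading `G`, is realized by `φ` as a graded subalgebra of the
contact algebra with the same negative part, and `𝔍` is induced by the complex structure
`J` at `x` through `g_{-1} ≅ D / Re F` (with `F` the Freeman bundle of index `0`). -/
structure IsRealization (G : ℤ → Submodule ℝ g) (φ : g →ₗ⁅ℝ⁆ contactAlgebra r)
    (𝔍 : contactAlgebra r) : Prop where
  injective : Function.Injective φ
  map_le : ∀ p, (G p).map (φ : g →ₗ[ℝ] contactAlgebra r) ≤ grade p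
  map_neg : ∀ p < 0, (G p).map (φ : g →ₗ[ℝ] contactAlgebra r) = grade p
  isComplexStructure : IsComplexStructure 𝔍
  induced : ∀ v ∈ G (-1), ∀ w ∈ G (-1), φ w = ⁅𝔍, φ v⁆ → ∃ hv : evOn g v ∈ S.D x,
    (S.J x ⟨evOn g v, hv⟩ : T (2 * n + 1) x) - evOn g w ∈ S.reF0 x

/-- The image of `q` in the complexified contact algebra. -/
def qImage (φ : g →ₗ⁅ℝ⁆ contactAlgebra r) : Submodule ℂ (ℂ ⊗[ℝ] contactAlgebra r) :=
  (q g).map ((φ : g →ₗ[ℝ] contactAlgebra r).baseChange ℂ)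

/-- The realization is aligned: `u_{-1} ⊆ q`. -/
def IsAligned (φ : g →ₗ⁅ℝ⁆ contactAlgebra r) (𝔍 : contactAlgebra r) : Prop :=
  uComponent 𝔍 (-1) ≤ qImage φ

end CRHypersurface

end CR

end

/-!
The theorem separates into a statement about vector fields, which is only needed to transport the
hypotheses to the Lie algebra `g`, and a statement about subalgebras of the contact algebra.

*From the manifold to the Lie algebra.* An infinitesimal CR automorphism preserves every Freeman
bundle (`IsInfAut.cbracket_mem_freeman`), because the higher Levi forms are defined by brackets and are
tensorial (`cbracket_mem_of_eq_zero`, which rests on the smoothness of coefficients with respect to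
frames). If `ξ`, `η` are infinitesimal automorphisms and `Z`, `W` are sections with the same values at
`x`, then `[Z, W]` and `-[ξ, η]` agree at `x` up to brackets `[ξ, W]` and `[η, Z]`, which stay in the
bundles of `W` and `Z`. By transitivity every vector at `x` is the value of an element of `g`, so the
Freeman sequence at `x` can be computed in the pair `(g, q)` by left kernels of Lie brackets
(`mem_qFreeman_succ_iff`). In particular the Levi form does not vanish, the values of `g^0` are the
Cauchy characteristics (`evOn_mem_reF0_iff`), and `g_{-1} ⊕ g_{-2}` is a Heisenberg algebra with a
complex structure on `g_{-1}`.

*Existence of the homomorphism.* Polynomial contact fields are described by generating functions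
(`genFunEquiv`), and the brackets with the negative part are left-invariant derivatives of generating
functions. The generating function of an element of `g` is obtained by induction on the degree: its
derivatives are prescribed, they satisfy the integrability conditions by the Jacobi identity, and a
weighted Poincaré lemma (`primitive_spec`) integrates them. This gives the universal property of the
contact algebra (`HeisenbergFrame.exists_lieHom`). The definition of the contact filtration makes `g`
transitive, whence the homomorphism is injective. The complex structure is induced by a quadratic contact
field `𝔍`, whose generating function is found with the same Poincaré lemma (`exists_realization`).

*The universal CR algebra.* By transitivity of the contact algebra and induction on the degree, `ad 𝔍`
is diagonalizable in degree `p` with eigenvalues among `i (p + 2), i p, ..., -i (p + 2)`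
(`aeval_stringPoly_eq_zero`). Bracketing with an element of `u_{-1}`, whose eigenvalues are `i`, shifts
eigenvalues upwards, so `u_p` consists of the elements that `u_{-1}` carries to `u_{p-1}`
(`mem_uComponent_iff`), since no element of degree `≥ -1` other than `0` commutes with degree `-1`.

*The equality of `q` with the intersection.* If `u_{-1} ⊂ q`, brackets of an element of `q` with
elements of `u_{-1}` stay in `q`, which has no component of degree `-2`; hence the homogeneous
components of elements of `q` lie in `u` (`component_mem_uComponent`). Conversely, `q` contains every
element which `u_{-1}` carries into `q`: such an element belongs to all terms of the conjugate Freeman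
sequence modulo `q`, and the sequence ends in the isotropy (`mem_zero_of_lie_mem`). Induction on the
degree gives that the homogeneous elements of `u` in the complexification of `g` are in `q`.

*The model.* Since `q` and its conjugate span the elements with value in the complexified distribution,
taking components gives condition (iii) of a model. A homogeneous element of `q` of degree `p ≥ m - 1`
belongs to the `m`-th Freeman term (`zero_inf_level_le`), so it is isotropic for `p ≥ k - 1`, which means
that the eigenvalue `i (p + 2)` does not occur in these degrees. Conversely, an element of the `m`-th
Freeman term has isotropic components in the degrees below `m - 1` (`component_mem_conj_of_mem`), so if
the eigenvalue `i (p + 2)` were absent from a degree `p ≤ k - 2`, the sequence would end too early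
(`le_conj_of_ccomponent_le`). The grading element has degree `0` and eigenvalue `0`, so adjoining it
affects neither conclusion.
-/

noncomputable section

namespace CR

/-! ### Generating functions of contact vector fields -/

section Contact

variable {r : ℕ}

/-- The partial derivative `∂/∂q_i`. -/
def dq (i : Fin r) : Derivation ℝ (Poly r) (Poly r) := MvPolynomial.pderiv (Sum.inl i)

/-- The partial derivative `∂/∂p_i`. -/
def dp (i : Fin r) : Derivation ℝ (Poly r) (Poly r) := MvPolynomial.pderiv (Sum.inr (Sum.inl i))

/-- The partial derivative `∂/∂t`. -/
def dt : Derivation ℝ (Poly r) (Poly r) := MvPolynomial.pderiv (Sum.inr (Sum.inr ()))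

@[simp] theorem dq_qvar (i j : Fin r) : dq i (qvar j) = if j = i then 1 else 0 := by
  simp [dq, qvar, MvPolynomial.pderiv_X, Pi.single_apply]
@[simp] theorem dq_pvar (i j : Fin r) : dq i (pvar j) = 0 := by
  simp [dq, pvar, MvPolynomial.pderiv_X]
@[simp] theorem dq_tvar (i : Fin r) : dq i tvar = 0 := by
  simp [dq, tvar, MvPolynomial.pderiv_X]
@[simp] theorem dp_qvar (i j : Fin r) : dp i (qvar j) = 0 := by
  simp [dp, qvar, MvPolynomial.pderiv_X]
@[simp] theorem dp_pvar (i j : Fin r) : dp i (pvar j) = if j = i then 1 else 0 := by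
  simp [dp, pvar, MvPolynomial.pderiv_X, Pi.single_apply]
@[simp] theorem dp_tvar (i : Fin r) : dp i tvar = 0 := by
  simp [dp, tvar, MvPolynomial.pderiv_X]
@[simp] theorem dt_qvar (j : Fin r) : dt (qvar j) = 0 := by
  simp [dt, qvar, MvPolynomial.pderiv_X]
@[simp] theorem dt_pvar (j : Fin r) : dt (pvar j) = 0 := by
  simp [dt, pvar, MvPolynomial.pderiv_X]
@[simp] theorem dt_tvar : dt (tvar : Poly r) = 1 := by
  simp [dt, tvar, MvPolynomial.pderiv_X]

theorem derivation_ext {X Y : Derivation ℝ (Poly r) (Poly r)} (hq : ∀ i, X (qvar i) = Y (qvar i))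
    (hp : ∀ i, X (pvar i) = Y (pvar i)) (ht : X tvar = Y tvar) : X = Y := by
  apply MvPolynomial.derivation_ext
  rintro (i | i | ⟨⟩)
  exacts [hq i, hp i, ht]

theorem derivation_sum_apply {ι : Type*} (s : Finset ι) (D : ι → Derivation ℝ (Poly r) (Poly r))
    (f : Poly r) : (∑ i ∈ s, D i) f = ∑ i ∈ s, D i f := by
  classical
  induction s using Finset.induction_on with
  | empty => simp
  | insert a s ha ih => simp [Finset.sum_insert ha, ih]

theorem derivation_apply (Y : Derivation ℝ (Poly r) (Poly r)) (f : Poly r) :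
    Y f = ∑ i, dq i f * Y (qvar i) + ∑ i, dp i f * Y (pvar i) + dt f * Y tvar := by
  have h : Y = ∑ i, Y (qvar i) • dq i + ∑ i, Y (pvar i) • dp i + Y tvar • dt := by
    apply derivation_ext <;> intros <;>
      simp [derivation_sum_apply]
  nth_rewrite 1 [h]
  simp [derivation_sum_apply, mul_comm]

theorem contactForm_add (X Y : Derivation ℝ (Poly r) (Poly r)) :
    contactForm (X + Y) = contactForm X + contactForm Y := by
  simp only [contactForm, Derivation.add_apply, mul_add, Finset.sum_add_distrib]; ring

theorem contactForm_smul (c : ℝ) (X : Derivation ℝ (Poly r) (Poly r)) :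
    contactForm (c • X) = c • contactForm X := by
  simp only [contactForm, Derivation.smul_apply, mul_smul_comm, smul_sub, Finset.smul_sum]

/-- The derivation underlying the contact field with generating function `f`. -/
def hamiltonianDerivation (f : Poly r) : Derivation ℝ (Poly r) (Poly r) :=
  MvPolynomial.mkDerivation ℝ (Sum.elim (fun i => -dp i f)
    (Sum.elim (fun i => dq i f + pvar i * dt f) fun _ => f - ∑ i, pvar i * dp i f))

@[simp] theorem hamiltonianDerivation_qvar (f : Poly r) (i : Fin r) :
    hamiltonianDerivation f (qvar i) = -dp i f := by
  simp [hamiltonianDerivation, qvar, MvPolynomial.mkDerivation_X]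

@[simp] theorem hamiltonianDerivation_pvar (f : Poly r) (i : Fin r) :
    hamiltonianDerivation f (pvar i) = dq i f + pvar i * dt f := by
  simp [hamiltonianDerivation, pvar, MvPolynomial.mkDerivation_X]

@[simp] theorem hamiltonianDerivation_tvar (f : Poly r) :
    hamiltonianDerivation f tvar = f - ∑ i, pvar i * dp i f := by
  simp [hamiltonianDerivation, tvar, MvPolynomial.mkDerivation_X]

theorem contactForm_hamiltonianDerivation (f : Poly r) :
    contactForm (hamiltonianDerivation f) = f := by
  simp [contactForm]

/-- Cartan's formula for the Lie derivative of the contact form, on the contact distribution. -/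
theorem contactForm_lie_of_contactForm_eq_zero (X Y : Derivation ℝ (Poly r) (Poly r))
    (hY : contactForm Y = 0) :
    contactForm ⁅X, Y⁆ = ∑ i, X (pvar i) * Y (qvar i) - ∑ i, Y (pvar i) * X (qvar i)
      - Y (contactForm X) := by
  have ht : Y tvar = ∑ i, pvar i * Y (qvar i) := by
    rw [contactForm, sub_eq_zero] at hY; exact hY
  simp only [contactForm, Derivation.commutator_apply, ht, map_sub, map_sum, Derivation.leibniz,
    smul_eq_mul, mul_sub, Finset.sum_sub_distrib, Finset.sum_add_distrib]
  have h1 : ∀ A B : Derivation ℝ (Poly r) (Poly r),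
      ∑ i, A (qvar i) * B (pvar i) = ∑ i, B (pvar i) * A (qvar i) := fun A B =>
    Finset.sum_congr rfl fun i _ => mul_comm _ _
  rw [h1 Y X, h1 X Y]
  ring

theorem hamiltonianDerivation_mem (f : Poly r) : hamiltonianDerivation f ∈ contactAlgebra r := by
  intro Y hY
  have ht : Y tvar = ∑ i, pvar i * Y (qvar i) := by
    rw [contactForm, sub_eq_zero] at hY; exact hY
  rw [contactForm_lie_of_contactForm_eq_zero _ _ hY, contactForm_hamiltonianDerivation,
    derivation_apply Y f, ht]
  simp only [hamiltonianDerivation_pvar, hamiltonianDerivation_qvar, add_mul, mul_neg,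
    Finset.sum_add_distrib, Finset.sum_neg_distrib, Finset.mul_sum]
  have h1 : ∑ i, pvar i * dt f * Y (qvar i) = ∑ i, dt f * (pvar i * Y (qvar i)) :=
    Finset.sum_congr rfl fun i _ => by ring
  have h2 : ∑ i, Y (pvar i) * dp i f = ∑ i, dp i f * Y (pvar i) :=
    Finset.sum_congr rfl fun i _ => by ring
  rw [h1, h2]
  ring

/-- The contact field with generating function `f`. -/
def hamiltonian (f : Poly r) : contactAlgebra r :=
  ⟨hamiltonianDerivation f, hamiltonianDerivation_mem f⟩

/-- The generating function of a contact field. -/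
def genFun : contactAlgebra r →ₗ[ℝ] Poly r where
  toFun X := contactForm X.1
  map_add' X Y := contactForm_add X.1 Y.1
  map_smul' c X := contactForm_smul c X.1

@[simp] theorem genFun_hamiltonian (f : Poly r) : genFun (hamiltonian f) = f :=
  contactForm_hamiltonianDerivation f

/-- A contact field is determined by its generating function: pairing the invariance of the contact
distribution with the fields `∂/∂p_j` and `∂/∂q_j + p_j ∂/∂t` recovers its coefficients. -/
@[simp] theorem hamiltonian_genFun (X : contactAlgebra r) : hamiltonian (genFun X) = X := by
  obtain ⟨X, hX⟩ := X
  apply Subtype.ext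
  have hq (j : Fin r) : X (qvar j) = - dp j (contactForm X) := by
    have h0 : contactForm (dp j : Derivation ℝ (Poly r) (Poly r)) = 0 := by simp [contactForm]
    have h := hX (dp j) h0
    rw [contactForm_lie_of_contactForm_eq_zero _ _ h0] at h
    simp only [dp_qvar, mul_zero, Finset.sum_const_zero, dp_pvar, ite_mul, one_mul, zero_mul,
      Finset.sum_ite_eq', Finset.mem_univ, if_true] at h
    linear_combination -h
  have hp (j : Fin r) : X (pvar j) = dq j (contactForm X) + pvar j * dt (contactForm X) := by
    have h0 : contactForm (dq j + pvar j • dt : Derivation ℝ (Poly r) (Poly r)) = 0 := by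
      simp [contactForm]
    have h := hX _ h0
    rw [contactForm_lie_of_contactForm_eq_zero _ _ h0] at h
    simp at h
    linear_combination h
  refine derivation_ext (fun i => ?_) (fun i => ?_) ?_
  · simp [hamiltonian, genFun, hq]
  · simp [hamiltonian, genFun, hp]
  · simp only [hamiltonian, genFun, LinearMap.coe_mk, AddHom.coe_mk, hamiltonianDerivation_tvar]
    simp only [← neg_eq_iff_eq_neg.2 (hq _)]
    simp [contactForm]

variable (r) in
/-- Contact fields and their generating functions. -/
def genFunEquiv : contactAlgebra r ≃ₗ[ℝ] Poly r :=
  { genFun with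
    invFun := hamiltonian
    left_inv := hamiltonian_genFun
    right_inv := genFun_hamiltonian }

theorem genFun_injective : Function.Injective (genFun (r := r)) := (genFunEquiv r).injective

@[simp] theorem euler_qvar (i : Fin r) : euler r (qvar i) = qvar i := by
  simp [euler, qvar, MvPolynomial.mkDerivation_X]
@[simp] theorem euler_pvar (i : Fin r) : euler r (pvar i) = pvar i := by
  simp [euler, pvar, MvPolynomial.mkDerivation_X]
@[simp] theorem euler_tvar : euler r tvar = 2 * tvar := by
  simp [euler, tvar, MvPolynomial.mkDerivation_X]

theorem genFun_lie_gradingElement (X : contactAlgebra r) :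
    genFun ⁅gradingElement r, X⁆ = euler r (genFun X) - 2 * genFun X := by
  change contactForm ⁅euler r, X.1⁆ = euler r (contactForm X.1) - 2 * contactForm X.1
  have h2 : euler r (2 * tvar) = 2 * euler r tvar := by
    rw [two_mul, map_add, two_mul]
  have h3 : ∀ Y : Derivation ℝ (Poly r) (Poly r), Y (2 * tvar) = 2 * Y tvar := fun Y => by
    rw [two_mul, map_add, two_mul]
  simp only [contactForm, Derivation.commutator_apply, map_sub, map_sum, Derivation.leibniz,
    euler_qvar, euler_pvar, euler_tvar, h3, smul_eq_mul, mul_sub, Finset.sum_sub_distrib,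
    Finset.sum_add_distrib, Finset.mul_sum]
  have : ∀ i, X.1 (qvar i) * pvar i = pvar i * X.1 (qvar i) := fun i => mul_comm _ _
  simp only [this, two_mul, Finset.sum_add_distrib]
  ring

theorem mem_grade_iff {X : contactAlgebra r} {p : ℤ} :
    X ∈ grade p ↔ euler r (genFun X) = ((p : ℝ) + 2) • genFun X := by
  rw [grade, Module.End.mem_eigenspace_iff, LieAlgebra.ad_apply, ← genFun_injective.eq_iff,
    genFun_lie_gradingElement, map_smul, sub_eq_iff_eq_add, add_smul]
  rw [show (2 : Poly r) * genFun X = (2 : ℝ) • genFun X by rw [two_mul, two_smul]]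

/-- The weight of a monomial: `q_i` and `p_i` have weight `1` and `t` has weight `2`. -/
def weight (s : (Fin r ⊕ Fin r ⊕ Unit) →₀ ℕ) : ℕ :=
  ∑ i, s (Sum.inl i) + ∑ i, s (Sum.inr (Sum.inl i)) + 2 * s (Sum.inr (Sum.inr ()))

theorem coeff_euler (s : (Fin r ⊕ Fin r ⊕ Unit) →₀ ℕ) (f : Poly r) :
    MvPolynomial.coeff s (euler r f) = (weight s : ℝ) * MvPolynomial.coeff s f := by
  classical
  have hmon (u : (Fin r ⊕ Fin r ⊕ Unit) →₀ ℕ) (a : ℝ) :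
      euler r (MvPolynomial.monomial u a) = (weight u : ℝ) • MvPolynomial.monomial u a := by
    have key (i : Fin r ⊕ Fin r ⊕ Unit) : MvPolynomial.X (R := ℝ) i *
        MvPolynomial.monomial (u - Finsupp.single i 1) (a * u i) =
        (u i : ℝ) • MvPolynomial.monomial u a := by
      rw [MvPolynomial.X, MvPolynomial.monomial_mul]
      by_cases h : u i = 0
      · simp [h]
      · rw [add_tsub_cancel_of_le
          (by simpa [Finsupp.single_le_iff] using Nat.one_le_iff_ne_zero.2 h)]
        simp [MvPolynomial.smul_monomial, mul_comm]
    rw [derivation_apply]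
    simp only [dq, dp, dt, MvPolynomial.pderiv_monomial, euler_qvar, euler_pvar, euler_tvar]
    simp only [qvar, pvar, tvar]
    rw [show ∀ A : Poly r, A * (2 * MvPolynomial.X (Sum.inr (Sum.inr ()))) =
      2 * (MvPolynomial.X (Sum.inr (Sum.inr ())) * A) from fun A => by ring, key]
    simp only [mul_comm _ (MvPolynomial.X _), key, weight]
    rw [two_mul, ← Finset.sum_smul, ← Finset.sum_smul, ← add_smul, ← add_smul, ← add_smul]
    push_cast
    congr 1
    ring
  induction f using MvPolynomial.induction_on' with
  | monomial u a =>
    rw [hmon, MvPolynomial.coeff_smul, MvPolynomial.coeff_monomial]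
    split_ifs with h
    · rw [h, smul_eq_mul]
    · simp
  | add f g hf hg => simp only [map_add, MvPolynomial.coeff_add, hf, hg, mul_add]

/-- Homogeneous components are supported on monomials of the right weight. -/
theorem weight_eq_of_mem_support {f : Poly r} {c : ℝ} (hf : euler r f = c • f)
    {s : (Fin r ⊕ Fin r ⊕ Unit) →₀ ℕ} (hs : MvPolynomial.coeff s f ≠ 0) : (weight s : ℝ) = c := by
  have h := coeff_euler s f
  rw [hf, MvPolynomial.coeff_smul, smul_eq_mul] at h
  exact (mul_right_cancel₀ hs h).symm

theorem eq_zero_of_euler_neg {f : Poly r} {c : ℝ} (hc : c < 0) (hf : euler r f = c • f) : f = 0 := by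
  ext s
  by_contra h
  have := weight_eq_of_mem_support hf h
  have : (0 : ℝ) ≤ weight s := Nat.cast_nonneg _
  linarith

theorem eq_C_of_euler_zero {f : Poly r} (hf : euler r f = 0) :
    f = MvPolynomial.C (MvPolynomial.coeff 0 f) := by
  ext s
  rw [MvPolynomial.coeff_C]
  split_ifs with h
  · rw [h]
  · by_contra h2
    have h3 := weight_eq_of_mem_support (c := 0) (by rw [hf, zero_smul]) h2
    apply h
    have h3 : weight s = 0 := by exact_mod_cast h3
    simp only [weight, add_eq_zero, Finset.sum_eq_zero_iff, Finset.mem_univ, true_implies] at h3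
    ext (i | i | ⟨⟩)
    · simp [h3.1.1 i]
    · simp [h3.1.2 i]
    · have h4 : s (Sum.inr (Sum.inr ())) = 0 := by have := h3.2; omega
      exact h4.symm

theorem exists_eq_of_euler_one {f : Poly r} (hf : euler r f = f) :
    ∃ a b : Fin r → ℝ, f = ∑ i, a i • qvar i + ∑ i, b i • pvar i := by
  -- Euler's formula expresses `f` by its derivatives, which have lower weight
  have h0 : dt f = 0 := by
    apply eq_zero_of_euler_neg (c := -1) (by norm_num)
    have : ⁅euler r, (dt : Derivation ℝ (Poly r) (Poly r))⁆ = (-2 : ℝ) • dt := by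
      apply derivation_ext <;> intros <;> simp [Derivation.commutator_apply, two_mul, neg_smul, two_smul]
    have h := congrArg (fun D => D f) this
    simp only [Derivation.commutator_apply, hf, Derivation.smul_apply] at h
    rw [sub_eq_iff_eq_add] at h; rw [h]; module
  have hq (i) : ∃ c : ℝ, dq i f = MvPolynomial.C c := by
    refine ⟨_, eq_C_of_euler_zero ?_⟩
    have : ⁅euler r, dq i⁆ = (-1 : ℝ) • dq i := by
      apply derivation_ext <;> intros <;> simp [Derivation.commutator_apply, apply_ite (euler r), two_mul, neg_ite]
    have h := congrArg (fun D => D f) this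
    simp only [Derivation.commutator_apply, hf, Derivation.smul_apply] at h
    rw [sub_eq_iff_eq_add] at h; rw [h]; module
  have hp (i) : ∃ c : ℝ, dp i f = MvPolynomial.C c := by
    refine ⟨_, eq_C_of_euler_zero ?_⟩
    have : ⁅euler r, dp i⁆ = (-1 : ℝ) • dp i := by
      apply derivation_ext <;> intros <;> simp [Derivation.commutator_apply, two_mul, apply_ite (euler r), neg_ite]
    have h := congrArg (fun D => D f) this
    simp only [Derivation.commutator_apply, hf, Derivation.smul_apply] at h
    rw [sub_eq_iff_eq_add] at h; rw [h]; module
  choose a ha using hq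
  choose b hb using hp
  refine ⟨a, b, ?_⟩
  nth_rewrite 1 [← hf]
  rw [derivation_apply]
  simp [ha, hb, h0, MvPolynomial.smul_eq_C_mul]

end Contact

/-! ### The negative part of the contact algebra -/

section Contact

variable {r : ℕ}

/-- The derivation `∂/∂p_i + q_i ∂/∂t`. -/
def dpt (i : Fin r) : Derivation ℝ (Poly r) (Poly r) := dp i + qvar i • dt

theorem dpt_apply (i : Fin r) (f : Poly r) : dpt i f = dp i f + qvar i * dt f := by
  simp [dpt]

/-- The contact field `∂/∂q_i`. -/
def yq (i : Fin r) : contactAlgebra r := hamiltonian (-pvar i)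

/-- The contact field `∂/∂p_i + q_i ∂/∂t`. -/
def yp (i : Fin r) : contactAlgebra r := hamiltonian (qvar i)

variable (r) in
/-- The contact field `∂/∂t`. -/
def yt : contactAlgebra r := hamiltonian 1

theorem coe_yq (i : Fin r) : (yq i : Derivation ℝ (Poly r) (Poly r)) = dq i := by
  apply derivation_ext <;> intros <;> simp [yq, hamiltonian, eq_comm]

theorem coe_yp (i : Fin r) : (yp i : Derivation ℝ (Poly r) (Poly r)) = dpt i := by
  apply derivation_ext <;> intros <;> simp [yp, hamiltonian, dpt_apply, eq_comm]

theorem coe_yt : (yt r : Derivation ℝ (Poly r) (Poly r)) = dt := by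
  apply derivation_ext <;> intros <;> simp [yt, hamiltonian]

/-- The contact fields that preserve the contact form, and not only its kernel, act on generating
functions as on functions. -/
theorem genFun_lie_of_strict {Y : contactAlgebra r}
    (hY : ∀ X : Derivation ℝ (Poly r) (Poly r),
      X (Y.1 tvar) - ∑ i, (Y.1 (pvar i) * X (qvar i) + pvar i * X (Y.1 (qvar i))) = 0)
    (X : contactAlgebra r) : genFun ⁅Y, X⁆ = Y.1 (genFun X) := by
  change contactForm ⁅Y.1, X.1⁆ = Y.1 (contactForm X.1)
  have h := hY X.1
  simp only [contactForm, Derivation.commutator_apply, map_sub, map_sum, Derivation.leibniz,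
    smul_eq_mul, mul_sub, Finset.sum_sub_distrib, Finset.sum_add_distrib] at h ⊢
  have h1 : ∑ i, X.1 (qvar i) * Y.1 (pvar i) = ∑ i, Y.1 (pvar i) * X.1 (qvar i) :=
    Finset.sum_congr rfl fun i _ => mul_comm _ _
  rw [h1]
  linear_combination -h

theorem genFun_lie_yq (i : Fin r) (X : contactAlgebra r) :
    genFun ⁅yq i, X⁆ = dq i (genFun X) := by
  rw [genFun_lie_of_strict, coe_yq]
  intro X
  simp [coe_yq, apply_ite X]

theorem genFun_lie_yp (i : Fin r) (X : contactAlgebra r) :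
    genFun ⁅yp i, X⁆ = dpt i (genFun X) := by
  rw [genFun_lie_of_strict, coe_yp]
  intro X
  simp [coe_yp, dpt_apply]

theorem genFun_lie_yt (X : contactAlgebra r) : genFun ⁅yt r, X⁆ = dt (genFun X) := by
  rw [genFun_lie_of_strict, coe_yt]
  intro X
  simp [coe_yt]

theorem yq_mem (i : Fin r) : yq i ∈ grade (r := r) (-1) := by
  rw [mem_grade_iff]; simp [yq]; norm_num

theorem yp_mem (i : Fin r) : yp i ∈ grade (r := r) (-1) := by
  rw [mem_grade_iff]; simp [yp]; norm_num

theorem yt_mem : yt r ∈ grade (r := r) (-2) := by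
  rw [mem_grade_iff]; simp [yt]

theorem lie_yp_yq (i j : Fin r) : ⁅yp i, yq j⁆ = if i = j then -yt r else 0 := by
  apply genFun_injective
  rw [genFun_lie_yp, apply_ite genFun]
  simp [yq, yt, dpt_apply, eq_comm, neg_ite]

theorem grade_eq_bot {p : ℤ} (hp : p < -2) : grade (r := r) p = ⊥ := by
  rw [eq_bot_iff]
  intro X hX
  rw [mem_grade_iff] at hX
  have hc : (p : ℝ) + 2 < 0 := by
    have : (p : ℝ) < -2 := by exact_mod_cast hp
    linarith
  rw [Submodule.mem_bot]
  exact genFun_injective ((eq_zero_of_euler_neg hc hX).trans (map_zero _).symm)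

theorem exists_eq_of_mem_grade_neg_two {X : contactAlgebra r} (hX : X ∈ grade (-2)) :
    ∃ c : ℝ, X = c • yt r := by
  rw [mem_grade_iff] at hX
  refine ⟨MvPolynomial.coeff 0 (genFun X),
    genFun_injective ((eq_C_of_euler_zero (by simpa using hX)).trans ?_)⟩
  rw [map_smul, yt, genFun_hamiltonian, MvPolynomial.smul_eq_C_mul, mul_one]

theorem exists_eq_of_mem_grade_neg_one {X : contactAlgebra r} (hX : X ∈ grade (-1)) :
    ∃ a b : Fin r → ℝ, X = ∑ i, a i • yq i + ∑ i, b i • yp i := by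
  rw [mem_grade_iff] at hX
  obtain ⟨a, b, h⟩ := exists_eq_of_euler_one (f := genFun X) (by rw [hX]; norm_num)
  refine ⟨fun i => - b i, a, genFun_injective ?_⟩
  rw [h]
  simp [yq, yp]
  ring

theorem lie_mem_grade {p q : ℤ} {X Y : contactAlgebra r} (hX : X ∈ grade p) (hY : Y ∈ grade q) :
    ⁅X, Y⁆ ∈ grade (p + q) := by
  rw [grade, Module.End.mem_eigenspace_iff, LieAlgebra.ad_apply] at *
  rw [leibniz_lie, hX, hY, smul_lie, lie_smul, ← add_smul]
  push_cast; rfl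

theorem gradingElement_mem_grade : gradingElement r ∈ grade (r := r) 0 := by
  rw [grade, Module.End.mem_eigenspace_iff, LieAlgebra.ad_apply, lie_self]; simp

/-- A contact field that commutes with the negative part has constant generating function. -/
theorem eq_zero_of_forall_lie_eq_zero {p : ℤ} (hp : p ≠ -2) {X : contactAlgebra r}
    (hX : X ∈ grade p) (hq : ∀ i : Fin r, ⁅yq i, X⁆ = 0)
    (hp' : ∀ i : Fin r, ⁅yp i, X⁆ = 0)
    (ht : ⁅yt r, X⁆ = 0) : X = 0 := by
  apply genFun_injective
  rw [mem_grade_iff] at hX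
  have h1 : ∀ i, dq i (genFun X) = 0 := fun i => by rw [← genFun_lie_yq, hq, map_zero]
  have h3 : dt (genFun X) = 0 := by rw [← genFun_lie_yt, ht, map_zero]
  have h2 : ∀ i, dp i (genFun X) = 0 := fun i => by
    have : dpt i (genFun X) = 0 := by rw [← genFun_lie_yp, hp', map_zero]
    rwa [dpt_apply, h3, mul_zero, add_zero] at this
  rw [derivation_apply] at hX
  simp only [h1, h2, h3, zero_mul, Finset.sum_const_zero, add_zero] at hX
  rw [map_zero]
  refine (smul_eq_zero.1 hX.symm).resolve_left ?_
  intro h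
  apply hp
  have : (p : ℝ) = -2 := by linarith
  exact_mod_cast this

/-- The contact algebra is transitive. -/
theorem eq_zero_of_lie_grade_neg_one_eq_zero (hr : 0 < r) {p : ℤ} (hp : p ≠ -2)
    {X : contactAlgebra r} (hX : X ∈ grade p) (h : ∀ Y ∈ grade (r := r) (-1), ⁅Y, X⁆ = 0) :
    X = 0 := by
  refine eq_zero_of_forall_lie_eq_zero hp hX (fun i => h _ (yq_mem i)) (fun i => h _ (yp_mem i)) ?_
  have h1 : yt r = -⁅yp ⟨0, hr⟩, yq ⟨0, hr⟩⁆ := by rw [lie_yp_yq]; simp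
  rw [h1, neg_lie, lie_lie, h _ (yq_mem _), h _ (yp_mem _)]
  simp

theorem yt_ne_zero : yt r ≠ 0 := by
  intro h
  have := congrArg genFun h
  simp [yt] at this

theorem euler_eq (f : Poly r) : euler r f = ∑ i, qvar i * dq i f + ∑ i, pvar i * dpt i f
    + (2 * tvar - ∑ i, pvar i * qvar i) * dt f := by
  rw [derivation_apply]
  simp only [euler_qvar, euler_pvar, euler_tvar, dpt_apply, mul_add, Finset.sum_add_distrib,
    sub_mul, Finset.sum_mul]
  have h1 : ∑ i, dq i f * qvar i = ∑ i, qvar i * dq i f :=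
    Finset.sum_congr rfl fun i _ => mul_comm _ _
  have h2 : ∑ i, dp i f * pvar i = ∑ i, pvar i * dp i f :=
    Finset.sum_congr rfl fun i _ => mul_comm _ _
  have h3 : ∑ i, pvar i * (qvar i * dt f) = ∑ i, pvar i * qvar i * dt f :=
    Finset.sum_congr rfl fun i _ => by ring
  rw [h1, h2, h3]
  ring

end Contact

/-! ### Universality of the contact algebra -/

section Contact

variable {r : ℕ}

/-- The weighted radial homotopy: a primitive of a closed system along the negative part. -/
def primitive (m : ℝ) (δq δp : Fin r → Poly r) (δt : Poly r) : Poly r :=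
  m⁻¹ • (∑ i, qvar i * δq i + ∑ i, pvar i * δp i + (2 * tvar - ∑ i, pvar i * qvar i) * δt)

/-- The Poincaré lemma for the negative part acting on polynomials: a homogeneous cocycle of nonzero
weight `m` is the coboundary of its primitive. -/
theorem primitive_spec {m : ℝ} (hm : m ≠ 0) {δq δp : Fin r → Poly r} {δt : Poly r}
    (hqq : ∀ i j, dq i (δq j) = dq j (δq i)) (hpp : ∀ i j, dpt i (δp j) = dpt j (δp i))
    (hqp : ∀ i j, dq i (δp j) = dpt j (δq i) + if i = j then δt else 0)
    (hqt : ∀ i, dq i δt = dt (δq i)) (hpt : ∀ i, dpt i δt = dt (δp i))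
    (heq : ∀ i, euler r (δq i) = (m - 1) • δq i) (hep : ∀ i, euler r (δp i) = (m - 1) • δp i)
    (het : euler r δt = (m - 2) • δt) :
    (∀ i, dq i (primitive m δq δp δt) = δq i) ∧ (∀ i, dpt i (primitive m δq δp δt) = δp i) ∧
      dt (primitive m δq δp δt) = δt ∧
      euler r (primitive m δq δp δt) = m • primitive m δq δp δt := by
  have h1 : ∀ i, dq i (primitive m δq δp δt) = δq i := by
    intro j
    rw [primitive, Derivation.map_smul, inv_smul_eq_iff₀ hm]
    have h := heq j
    rw [euler_eq] at h
    have e1 : ∑ i, qvar i * dq j (δq i) = ∑ i, qvar i * dq i (δq j) :=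
      Finset.sum_congr rfl fun i _ => by rw [hqq]
    have e2 : ∑ i, pvar i * dq j (δp i) = ∑ i, pvar i * dpt i (δq j) + pvar j * δt := by
      simp [hqp, mul_add, Finset.sum_add_distrib]
    have e3 : dq j (2 * tvar - ∑ i, pvar i * qvar i) = - pvar j := by
      simp [two_mul]
    simp only [map_add, map_sum, Derivation.leibniz, smul_eq_mul, Finset.sum_add_distrib, e1, e2, e3,
      hqt, dq_qvar, dq_pvar, mul_ite, mul_one, mul_zero, Finset.sum_ite_eq', Finset.mem_univ, if_true,
      Finset.sum_const_zero]
    rw [sub_smul, one_smul] at h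
    linear_combination h
  have h2 : ∀ i, dpt i (primitive m δq δp δt) = δp i := by
    intro j
    rw [primitive, Derivation.map_smul, inv_smul_eq_iff₀ hm]
    have h := hep j
    rw [euler_eq] at h
    have e1 : ∑ i, pvar i * dpt j (δp i) = ∑ i, pvar i * dpt i (δp j) :=
      Finset.sum_congr rfl fun i _ => by rw [hpp]
    have e2 : ∑ i, qvar i * dpt j (δq i) = ∑ i, qvar i * dq i (δp j) - qvar j * δt := by
      simp [hqp, mul_add, Finset.sum_add_distrib]
    have e3 : dpt j (2 * tvar - ∑ i, pvar i * qvar i) = qvar j := by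
      simp [two_mul, dpt_apply]
      ring
    have e4 : ∀ i, dpt j (qvar i) = 0 := fun i => by simp [dpt_apply]
    have e5 : ∀ i, dpt j (pvar i) = if i = j then 1 else 0 := fun i => by simp [dpt_apply]
    simp only [map_add, map_sum, Derivation.leibniz, smul_eq_mul, Finset.sum_add_distrib, e1, e2, e3,
      hpt, e4, e5, mul_ite, mul_one, mul_zero, Finset.sum_ite_eq', Finset.mem_univ, if_true,
      Finset.sum_const_zero]
    rw [sub_smul, one_smul] at h
    linear_combination h
  have h3 : dt (primitive m δq δp δt) = δt := by
    rw [primitive, Derivation.map_smul, inv_smul_eq_iff₀ hm]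
    have h := het
    rw [euler_eq] at h
    have e3 : dt (2 * tvar - ∑ i, pvar i * qvar i : Poly r) = 2 := by
      simp [two_mul, one_add_one_eq_two]
    simp only [map_add, map_sum, Derivation.leibniz, smul_eq_mul, Finset.sum_add_distrib, e3,
      ← hqt, ← hpt, dt_qvar, dt_pvar, mul_zero, Finset.sum_const_zero]
    rw [sub_smul, show (2 : ℝ) • δt = 2 * δt by rw [two_smul, two_mul]] at h
    linear_combination h
  refine ⟨h1, h2, h3, ?_⟩
  rw [euler_eq]
  simp only [h1, h2, h3]
  rw [primitive, smul_inv_smul₀ hm]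

variable {g : Type*} [LieRing g] [LieAlgebra ℝ g]

/-- A frame of the negative part of a graded Lie algebra of depth two that exhibits it as the
Heisenberg algebra. -/
structure HeisenbergFrame (G : ℤ → Submodule ℝ g) (r : ℕ) where
  /-- the vectors corresponding to the `∂/∂q_i` -/
  eq : Fin r → g
  /-- the vectors corresponding to the `∂/∂p_i + q_i ∂/∂t` -/
  ep : Fin r → g
  /-- the vector corresponding to `∂/∂t` -/
  et : g
  eq_mem : ∀ i, eq i ∈ G (-1)
  ep_mem : ∀ i, ep i ∈ G (-1)
  et_mem : et ∈ G (-2)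
  et_ne : et ≠ 0
  lie_eq_eq : ∀ i j, ⁅eq i, eq j⁆ = 0
  lie_ep_ep : ∀ i j, ⁅ep i, ep j⁆ = 0
  lie_ep_eq : ∀ i j, ⁅ep i, eq j⁆ = if i = j then -et else 0
  span_neg_one : ∀ v ∈ G (-1), ∃ a b : Fin r → ℝ, v = ∑ i, a i • eq i + ∑ i, b i • ep i
  span_neg_two : ∀ v ∈ G (-2), ∃ c : ℝ, v = c • et

theorem exists_linearMap_of_isInternal {V W : Type*} [AddCommGroup V] [Module ℝ V]
    [AddCommGroup W] [Module ℝ W] {G : ℤ → Submodule ℝ V} (hG : DirectSum.IsInternal G)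
    (F : ℤ → V →ₗ[ℝ] W) : ∃ f : V →ₗ[ℝ] W, ∀ j, ∀ x ∈ G j, f x = F j x := by
  classical
  let e := LinearEquiv.ofBijective (DirectSum.coeLinearMap G) hG
  refine ⟨DirectSum.toModule ℝ ℤ W (fun j => (F j).domRestrict (G j)) ∘ₗ e.symm.toLinearMap,
    fun j x hx => ?_⟩
  have : e.symm x = DirectSum.lof ℝ ℤ (fun j => G j) j ⟨x, hx⟩ := by
    rw [LinearEquiv.symm_apply_eq]
    exact (DirectSum.coeLinearMap_lof (A := G) j ⟨x, hx⟩).symm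
  simp [this]

theorem forall_of_isInternal {V : Type*} [AddCommGroup V] [Module ℝ V] {G : ℤ → Submodule ℝ V}
    (hG : DirectSum.IsInternal G) {P : V → Prop} (h : ∀ j, ∀ x ∈ G j, P x) (h0 : P 0)
    (hadd : ∀ x y, P x → P y → P (x + y)) (x : V) : P x :=
  Submodule.iSup_induction G (motive := P)
    (hG.submodule_iSup_eq_top ▸ Submodule.mem_top : x ∈ iSup G) h h0 hadd

namespace HeisenbergFrame

variable {G : ℤ → Submodule ℝ g} (e : HeisenbergFrame G r)

/-- The generating function of the contact field attached to an element of degree `m - 3`, obtained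
by integrating the generating functions of its brackets with the negative part; the recursion starts
from a linear functional `π` that reads off the component along `et`. -/
def coinduced (π : g →ₗ[ℝ] ℝ) : ℕ → g →ₗ[ℝ] Poly r
  | 0 => 0
  | 1 => Algebra.linearMap ℝ (Poly r) ∘ₗ π
  | m + 2 => ((m : ℝ) + 1)⁻¹ •
      (∑ i, LinearMap.mulLeft ℝ (qvar i) ∘ₗ coinduced π (m + 1) ∘ₗ LieAlgebra.ad ℝ g (e.eq i) +
       ∑ i, LinearMap.mulLeft ℝ (pvar i) ∘ₗ coinduced π (m + 1) ∘ₗ LieAlgebra.ad ℝ g (e.ep i) +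
       LinearMap.mulLeft ℝ (2 * tvar - ∑ i, pvar i * qvar i) ∘ₗ coinduced π m ∘ₗ
        LieAlgebra.ad ℝ g e.et)

theorem coinduced_add_two (π : g →ₗ[ℝ] ℝ) (m : ℕ) (ξ : g) : e.coinduced π (m + 2) ξ =
    primitive (m + 1) (fun i => e.coinduced π (m + 1) ⁅e.eq i, ξ⁆)
      (fun i => e.coinduced π (m + 1) ⁅e.ep i, ξ⁆) (e.coinduced π m ⁅e.et, ξ⁆) := by
  simp [coinduced, primitive]

variable (hlie : ∀ i j, ∀ a ∈ G i, ∀ b ∈ G j, ⁅a, b⁆ ∈ G (i + j)) (hlow : ∀ j < -2, G j = ⊥)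
include hlie hlow

theorem lie_eq_et (i : Fin r) : ⁅e.eq i, e.et⁆ = 0 := by
  have := hlie _ _ _ (e.eq_mem i) _ e.et_mem
  rwa [hlow _ (by norm_num), Submodule.mem_bot] at this

theorem lie_ep_et (i : Fin r) : ⁅e.ep i, e.et⁆ = 0 := by
  have := hlie _ _ _ (e.ep_mem i) _ e.et_mem
  rwa [hlow _ (by norm_num), Submodule.mem_bot] at this

/-- The derivatives of the generating function of `ξ` are the generating functions of the brackets of
`ξ` with the negative part. The Jacobi identity for these brackets is what makes the prescribed
derivatives integrable. -/
theorem coinduced_spec (π : g →ₗ[ℝ] ℝ) (m : ℕ) : ∀ ξ ∈ G (m - 2),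
    (∀ i, dq i (e.coinduced π (m + 1) ξ) = e.coinduced π m ⁅e.eq i, ξ⁆) ∧
    (∀ i, dpt i (e.coinduced π (m + 1) ξ) = e.coinduced π m ⁅e.ep i, ξ⁆) ∧
    dt (e.coinduced π (m + 1) ξ) = e.coinduced π (m - 1) ⁅e.et, ξ⁆ ∧
    euler r (e.coinduced π (m + 1) ξ) = (m : ℝ) • e.coinduced π (m + 1) ξ := by
  induction m using Nat.strong_induction_on with
  | _ m ih =>
  intro ξ hξ
  match m, ih, hξ with
  | 0, _, _ => simp [coinduced, MvPolynomial.algebraMap_eq, dq, dt]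
  | m + 1, ih, hξ =>
    have hξ' : ξ ∈ G (m - 1) := by
      convert hξ using 2; push_cast; ring
    have hq (i) : ⁅e.eq i, ξ⁆ ∈ G (m - 2) := by
      convert hlie _ _ _ (e.eq_mem i) _ hξ' using 2; ring
    have hp (i) : ⁅e.ep i, ξ⁆ ∈ G (m - 2) := by
      convert hlie _ _ _ (e.ep_mem i) _ hξ' using 2; ring
    have ht : ⁅e.et, ξ⁆ ∈ G (m - 3) := by
      convert hlie _ _ _ e.et_mem _ hξ' using 2; ring
    have cqq (i j) : ⁅e.eq i, ⁅e.eq j, ξ⁆⁆ = ⁅e.eq j, ⁅e.eq i, ξ⁆⁆ := by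
      rw [leibniz_lie, e.lie_eq_eq, zero_lie, zero_add]
    have cpp (i j) : ⁅e.ep i, ⁅e.ep j, ξ⁆⁆ = ⁅e.ep j, ⁅e.ep i, ξ⁆⁆ := by
      rw [leibniz_lie, e.lie_ep_ep, zero_lie, zero_add]
    have cqp (i j) : ⁅e.eq i, ⁅e.ep j, ξ⁆⁆ = ⁅e.ep j, ⁅e.eq i, ξ⁆⁆ + if i = j then ⁅e.et, ξ⁆ else 0 := by
      rw [leibniz_lie, ← lie_skew (e.eq i) (e.ep j), e.lie_ep_eq, add_comm]
      congr 1
      simp only [eq_comm (a := j)]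
      split_ifs <;> simp
    have cqt (i) : ⁅e.eq i, ⁅e.et, ξ⁆⁆ = ⁅e.et, ⁅e.eq i, ξ⁆⁆ := by
      rw [leibniz_lie, e.lie_eq_et hlie hlow, zero_lie, zero_add]
    have cpt (i) : ⁅e.ep i, ⁅e.et, ξ⁆⁆ = ⁅e.et, ⁅e.ep i, ξ⁆⁆ := by
      rw [leibniz_lie, e.lie_ep_et hlie hlow, zero_lie, zero_add]
    have I (η) (hη : η ∈ G (m - 2)) := ih m (Nat.lt_succ_self m) η hη
    have hm : (m : ℝ) + 1 ≠ 0 := by positivity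
    -- the derivatives of the term in degree `m - 3`
    have T : (∀ i, dq i (e.coinduced π m ⁅e.et, ξ⁆) = e.coinduced π (m - 1) ⁅e.eq i, ⁅e.et, ξ⁆⁆) ∧
        (∀ i, dpt i (e.coinduced π m ⁅e.et, ξ⁆) = e.coinduced π (m - 1) ⁅e.ep i, ⁅e.et, ξ⁆⁆) ∧
        euler r (e.coinduced π m ⁅e.et, ξ⁆) = ((m : ℝ) + 1 - 2) • e.coinduced π m ⁅e.et, ξ⁆ := by
      match m, ih, ht with
      | 0, _, _ => simp [coinduced]
      | m + 1, ih, ht =>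
        have := ih m (by omega) ⁅e.et, ξ⁆ (by convert ht using 2; push_cast; ring)
        refine ⟨this.1, this.2.1, ?_⟩
        rw [this.2.2.2]
        congr 1
        push_cast; ring
    have P := primitive_spec hm (δq := fun i => e.coinduced π (m + 1) ⁅e.eq i, ξ⁆)
      (δp := fun i => e.coinduced π (m + 1) ⁅e.ep i, ξ⁆) (δt := e.coinduced π m ⁅e.et, ξ⁆)
      (fun i j => by rw [(I _ (hq j)).1, (I _ (hq i)).1, cqq])
      (fun i j => by rw [(I _ (hp j)).2.1, (I _ (hp i)).2.1, cpp])
      (fun i j => by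
        rw [(I _ (hp j)).1, (I _ (hq i)).2.1, cqp, map_add, apply_ite (e.coinduced π m), map_zero])
      (fun i => by rw [T.1, (I _ (hq i)).2.2.1, cqt])
      (fun i => by rw [T.2.1, (I _ (hp i)).2.2.1, cpt])
      (fun i => by rw [(I _ (hq i)).2.2.2, add_sub_cancel_right])
      (fun i => by rw [(I _ (hp i)).2.2.2, add_sub_cancel_right]) T.2.2
    rw [coinduced_add_two]
    exact ⟨P.1, P.2.1, P.2.2.1, by rw [P.2.2.2]; push_cast; rfl⟩

variable (hG : DirectSum.IsInternal G)
include hG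

/-- A linear equivariant map to generating functions, which is homogeneous and takes the value `1` on
the vector `et`. -/
theorem exists_equivariant : ∃ f : g →ₗ[ℝ] Poly r,
    (∀ ξ i, dq i (f ξ) = f ⁅e.eq i, ξ⁆) ∧ (∀ ξ i, dpt i (f ξ) = f ⁅e.ep i, ξ⁆) ∧
    (∀ ξ, dt (f ξ) = f ⁅e.et, ξ⁆) ∧ (∀ j : ℤ, ∀ ξ ∈ G j, euler r (f ξ) = ((j : ℝ) + 2) • f ξ) ∧
    f e.et = 1 := by
  obtain ⟨π₀, hπ₀⟩ : ∃ π : Module.Dual ℝ g, π e.et ≠ 0 := by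
    by_contra! h
    exact e.et_ne ((Module.forall_dual_apply_eq_zero_iff ℝ e.et).1 h)
  let π : g →ₗ[ℝ] ℝ := (π₀ e.et)⁻¹ • π₀
  have hπ : π e.et = 1 := by simp [π, hπ₀]
  obtain ⟨f, hf⟩ := exists_linearMap_of_isInternal hG fun j => e.coinduced π (j + 3).toNat
  have key (j : ℤ) (ξ : g) (hξ : ξ ∈ G j) :
      (∀ i, dq i (f ξ) = f ⁅e.eq i, ξ⁆) ∧ (∀ i, dpt i (f ξ) = f ⁅e.ep i, ξ⁆) ∧
      dt (f ξ) = f ⁅e.et, ξ⁆ ∧ euler r (f ξ) = ((j : ℝ) + 2) • f ξ := by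
    rcases lt_or_ge j (-2) with hj | hj
    · rw [hlow j hj, Submodule.mem_bot] at hξ
      simp [hξ]
    · obtain ⟨m, rfl⟩ : ∃ m : ℕ, j = m - 2 := ⟨(j + 2).toNat, by omega⟩
      have h := e.coinduced_spec hlie hlow π m ξ hξ
      rw [hf _ _ hξ]
      have h1 : ((m : ℤ) - 2 + 3).toNat = m + 1 := by omega
      rw [h1]
      refine ⟨fun i => ?_, fun i => ?_, ?_, ?_⟩
      · rw [h.1, hf _ _ (hlie _ _ _ (e.eq_mem i) _ hξ)]
        congr 2; omega
      · rw [h.2.1, hf _ _ (hlie _ _ _ (e.ep_mem i) _ hξ)]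
        congr 2; omega
      · rw [h.2.2.1, hf _ _ (hlie _ _ _ e.et_mem _ hξ)]
        congr 2; omega
      · rw [h.2.2.2]; congr 1; push_cast; ring
  refine ⟨f, fun ξ i => ?_, fun ξ i => ?_, fun ξ => ?_, fun j ξ hξ => (key j ξ hξ).2.2.2, ?_⟩
  · exact forall_of_isInternal hG (P := fun ξ => dq i (f ξ) = f ⁅e.eq i, ξ⁆)
      (fun j ξ hξ => (key j ξ hξ).1 i) (by simp) (fun x y hx hy => by simp [hx, hy]) ξ
  · exact forall_of_isInternal hG (P := fun ξ => dpt i (f ξ) = f ⁅e.ep i, ξ⁆)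
      (fun j ξ hξ => (key j ξ hξ).2.1 i) (by simp) (fun x y hx hy => by simp [hx, hy]) ξ
  · exact forall_of_isInternal hG (P := fun ξ => dt (f ξ) = f ⁅e.et, ξ⁆)
      (fun j ξ hξ => (key j ξ hξ).2.2.1) (by simp) (fun x y hx hy => by simp [hx, hy]) ξ
  · rw [hf _ _ e.et_mem]
    simp [coinduced, hπ]

/-- The contact algebra is the universal transitive prolongation of the Heisenberg algebra. -/
theorem exists_lieHom : ∃ φ : g →ₗ⁅ℝ⁆ contactAlgebra r,
    (∀ j, (G j).map (φ : g →ₗ[ℝ] contactAlgebra r) ≤ grade j) ∧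
    (∀ i, φ (e.eq i) = yq i) ∧ (∀ i, φ (e.ep i) = yp i) ∧ φ e.et = yt r := by
  obtain ⟨f, hfq, hfp, hft, hfE, hf1⟩ := e.exists_equivariant hlie hlow hG
  let φ : g →ₗ[ℝ] contactAlgebra r := (genFunEquiv r).symm.toLinearMap ∘ₗ f
  have hφ (ξ) : genFun (φ ξ) = f ξ := (genFunEquiv r).apply_symm_apply (f ξ)
  have hq (i ξ) : φ ⁅e.eq i, ξ⁆ = ⁅yq i, φ ξ⁆ := by
    apply genFun_injective; rw [hφ, genFun_lie_yq, hφ, hfq]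
  have hp (i ξ) : φ ⁅e.ep i, ξ⁆ = ⁅yp i, φ ξ⁆ := by
    apply genFun_injective; rw [hφ, genFun_lie_yp, hφ, hfp]
  have ht (ξ) : φ ⁅e.et, ξ⁆ = ⁅yt r, φ ξ⁆ := by
    apply genFun_injective; rw [hφ, genFun_lie_yt, hφ, hft]
  have hgr (j) (ξ) (hξ : ξ ∈ G j) : φ ξ ∈ grade j := by
    rw [mem_grade_iff, hφ]; exact hfE j ξ hξ
  have et : φ e.et = yt r := by
    apply genFun_injective; rw [hφ, hf1]; simp [yt]
  -- in degree `-1`, Euler's formula recovers the generating function from its derivatives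
  have eq (i) : φ (e.eq i) = yq i := by
    apply genFun_injective
    have h := hfE _ _ (e.eq_mem i)
    rw [euler_eq] at h
    simp only [hfq, hfp, hft, e.lie_eq_eq, e.lie_ep_eq, ← lie_skew e.et, e.lie_eq_et hlie hlow] at h
    simp only [map_zero, mul_zero, Finset.sum_const_zero, neg_zero, add_zero, zero_add, apply_ite f,
      map_neg, hf1, mul_ite, Finset.sum_ite_eq', Finset.mem_univ, if_true] at h
    rw [hφ]
    have h2 : ((-1 : ℤ) : ℝ) + 2 = 1 := by norm_num
    rw [h2, one_smul] at h
    rw [← h]; simp [yq]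
  have ep (i) : φ (e.ep i) = yp i := by
    apply genFun_injective
    have h := hfE _ _ (e.ep_mem i)
    rw [euler_eq] at h
    have hsk (j) : ⁅e.eq j, e.ep i⁆ = if i = j then e.et else 0 := by
      rw [← lie_skew, e.lie_ep_eq]; split_ifs <;> simp
    simp only [hfq, hfp, hft, e.lie_ep_ep, hsk, ← lie_skew e.et, e.lie_ep_et hlie hlow] at h
    simp only [map_zero, mul_zero, Finset.sum_const_zero, neg_zero, add_zero, apply_ite f,
      hf1, mul_ite, Finset.sum_ite_eq, Finset.mem_univ, if_true] at h
    rw [hφ]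
    have h2 : ((-1 : ℤ) : ℝ) + 2 = 1 := by norm_num
    rw [h2, one_smul] at h
    rw [← h]; simp [yp]
  have hneg1 (v) (hv : v ∈ G (-1)) (ξ) : φ ⁅v, ξ⁆ = ⁅φ v, φ ξ⁆ := by
    obtain ⟨a, b, rfl⟩ := e.span_neg_one v hv
    simp only [add_lie, map_add, map_sum, map_smul, sum_lie, smul_lie, hq, hp, eq, ep]
  have hneg2 (v) (hv : v ∈ G (-2)) (ξ) : φ ⁅v, ξ⁆ = ⁅φ v, φ ξ⁆ := by
    obtain ⟨c, rfl⟩ := e.span_neg_two v hv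
    rw [smul_lie, map_smul, map_smul, smul_lie, ht, et]
  have hneg (j) (hj : j < 0) (v) (hv : v ∈ G j) (ξ) : φ ⁅v, ξ⁆ = ⁅φ v, φ ξ⁆ := by
    rcases lt_or_ge j (-2) with h | h
    · rw [hlow j h, Submodule.mem_bot] at hv; simp [hv]
    · obtain rfl | rfl : j = -1 ∨ j = -2 := by omega
      exacts [hneg1 v hv ξ, hneg2 v hv ξ]
  -- in nonnegative degrees, transitivity reduces to brackets of lower degree
  have hpos (m : ℕ) : ∀ i j : ℤ, 0 ≤ i → 0 ≤ j → i + j < m → ∀ ξ ∈ G i, ∀ η ∈ G j,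
      φ ⁅ξ, η⁆ = ⁅φ ξ, φ η⁆ := by
    induction m with
    | zero => intro i j hi hj hij; push_cast at hij; omega
    | succ m ih =>
      intro i j hi hj hij ξ hξ η hη
      have step (k : ℤ) (hk : k < 0) (v : g) (hv : v ∈ G k) :
          ⁅φ v, φ ⁅ξ, η⁆ - ⁅φ ξ, φ η⁆⁆ = 0 := by
        have h1 := hlie _ _ _ hv _ hξ
        have h2 := hlie _ _ _ hv _ hη
        have e1 : φ ⁅⁅v, ξ⁆, η⁆ = ⁅φ ⁅v, ξ⁆, φ η⁆ := by
          by_cases h : k + i < 0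
          · exact hneg _ h _ h1 _
          · exact ih (k + i) j (by omega) hj (by push_cast at hij; omega) _ h1 _ hη
        have e2 : φ ⁅ξ, ⁅v, η⁆⁆ = ⁅φ ξ, φ ⁅v, η⁆⁆ := by
          by_cases h : k + j < 0
          · rw [← lie_skew, map_neg, hneg _ h _ h2, lie_skew]
          · exact ih i (k + j) hi (by omega) (by push_cast at hij; omega) _ hξ _ h2
        rw [lie_sub, ← hneg k hk v hv, leibniz_lie v, leibniz_lie (φ v), map_add,
          ← hneg k hk v hv, ← hneg k hk v hv, e1, e2, sub_self]
      have hc : φ ⁅ξ, η⁆ - ⁅φ ξ, φ η⁆ ∈ grade (i + j) :=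
        sub_mem (hgr _ _ (hlie _ _ _ hξ _ hη)) (lie_mem_grade (hgr _ _ hξ) (hgr _ _ hη))
      refine sub_eq_zero.1 (eq_zero_of_forall_lie_eq_zero (by omega) hc (fun i => ?_)
        (fun i => ?_) ?_)
      · rw [← eq]; exact step _ (by norm_num) _ (e.eq_mem i)
      · rw [← ep]; exact step _ (by norm_num) _ (e.ep_mem i)
      · rw [← et]; exact step _ (by norm_num) _ e.et_mem
  have hall (ξ η : g) : φ ⁅ξ, η⁆ = ⁅φ ξ, φ η⁆ := by
    refine forall_of_isInternal hG (P := fun ξ => φ ⁅ξ, η⁆ = ⁅φ ξ, φ η⁆) (fun i ξ hξ => ?_)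
      (by simp) (fun x y hx hy => by simp [hx, hy]) ξ
    refine forall_of_isInternal hG (P := fun η => φ ⁅ξ, η⁆ = ⁅φ ξ, φ η⁆) (fun j η hη => ?_)
      (by simp) (fun x y hx hy => by simp [hx, hy]) η
    by_cases hi : i < 0
    · exact hneg i hi ξ hξ η
    · by_cases hj : j < 0
      · rw [← lie_skew, map_neg, hneg j hj η hη, lie_skew]
      · exact hpos ((i + j).toNat + 1) i j (by omega) (by omega) (by push_cast; omega) ξ hξ η hη
  refine ⟨{ φ with map_lie' := fun {ξ η} => hall ξ η }, fun j => ?_, eq, ep, et⟩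
  rintro _ ⟨ξ, hξ, rfl⟩
  exact hgr j ξ hξ

end HeisenbergFrame

end Contact

/-! ### Components with respect to independent subspaces -/

/-- The maps `pr i` are projections onto the members of the independent family `N`. -/
structure IsComponents {K V ι : Type*} [Field K] [AddCommGroup V] [Module K V]
    (N : ι → Submodule K V) (pr : ι → V →ₗ[K] V) : Prop where
  mem : ∀ i x, pr i x ∈ N i
  self : ∀ i, ∀ x ∈ N i, pr i x = x
  other : ∀ i j, i ≠ j → ∀ x ∈ N j, pr i x = 0

theorem exists_isComponents {K V ι : Type*} [Field K] [AddCommGroup V] [Module K V]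
    {N : ι → Submodule K V} (hN : iSupIndep N) : ∃ pr : ι → V →ₗ[K] V, IsComponents N pr := by
  have h (i) : ∃ p : V →ₗ[K] V, (∀ x, p x ∈ N i) ∧ (∀ x ∈ N i, p x = x) ∧
      ∀ j, i ≠ j → ∀ x ∈ N j, p x = 0 := by
    obtain ⟨q, hq, hc⟩ := (hN i).symm.exists_isCompl
    replace hc := hc.symm
    refine ⟨(N i).projection q hc, fun x => Submodule.projection_apply_mem hc x,
      fun x hx => Submodule.projection_apply_of_mem_left hc hx, fun j hj x hx => ?_⟩
    refine Submodule.projection_apply_of_mem_right hc (hq ?_)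
    exact Submodule.mem_iSup_of_mem j (Submodule.mem_iSup_of_mem hj.symm hx)
  choose pr h1 h2 h3 using h
  exact ⟨pr, h1, h2, h3⟩

namespace IsComponents

variable {K V ι : Type*} [Field K] [AddCommGroup V] [Module K V] {N : ι → Submodule K V}
  {pr : ι → V →ₗ[K] V} (h : IsComponents N pr)
include h

theorem mem_of_forall {x : V} (hx : x ∈ iSup N) {P : Submodule K V} (hP : ∀ i, pr i x ∈ P) :
    x ∈ P := by
  classical
  obtain ⟨f, hf, rfl⟩ := (Submodule.mem_iSup_iff_exists_finsupp N x).1 hx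
  rw [Finsupp.sum]
  refine Submodule.sum_mem _ fun i hi => ?_
  have := hP i
  rw [Finsupp.sum, map_sum, Finset.sum_eq_single i (fun j _ hj => h.other i j hj.symm _ (hf j))
    (fun hi' => absurd hi hi'), h.self i _ (hf i)] at this
  exact this

theorem eq_zero_of_forall {x : V} (hx : x ∈ iSup N) (h0 : ∀ i, pr i x = 0) : x = 0 :=
  (Submodule.mem_bot K).1 (h.mem_of_forall hx fun i => by rw [h0]; exact zero_mem _)

/-- The components of a member of a sum of subspaces of the `N i` stay in these subspaces. -/
theorem mem_of_mem_iSup {P : ι → Submodule K V} (hP : ∀ i, P i ≤ N i) {x : V} (hx : x ∈ iSup P)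
    (i : ι) : pr i x ∈ P i := by
  refine Submodule.iSup_induction P (motive := fun x => pr i x ∈ P i) hx (fun j y hy => ?_)
    (by simp) (fun y z hy hz => by rw [map_add]; exact add_mem hy hz)
  by_cases hij : i = j
  · subst hij; rwa [h.self i y (hP i hy)]
  · rw [h.other i j hij y (hP j hy)]; exact zero_mem _

end IsComponents

/-! ### Symplectic bases -/

/-- A nondegenerate alternating form on a finite-dimensional space has a symplectic basis. -/
theorem exists_symplectic_basis {V : Type*} [AddCommGroup V] [Module ℝ V]
    (B : V →ₗ[ℝ] V →ₗ[ℝ] ℝ) (hB : ∀ v, B v v = 0) (W : Submodule ℝ V) [FiniteDimensional ℝ W]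
    (hW : ∀ v ∈ W, (∀ u ∈ W, B v u = 0) → v = 0) :
    ∃ (r : ℕ) (a b : Fin r → V), (∀ i, a i ∈ W) ∧ (∀ i, b i ∈ W) ∧ (∀ i j, B (a i) (a j) = 0) ∧
      (∀ i j, B (b i) (b j) = 0) ∧ (∀ i j, B (b i) (a j) = if i = j then -1 else 0) ∧
      ∀ v ∈ W, ∃ c d : Fin r → ℝ, v = ∑ i, c i • a i + ∑ i, d i • b i := by
  have hskew (u v) : B u v = - B v u := by
    have := hB (u + v)
    simp only [map_add, LinearMap.add_apply, hB, zero_add, add_zero] at this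
    linarith
  induction hn : Module.finrank ℝ W using Nat.strong_induction_on generalizing W with
  | _ n ih =>
  by_cases h0 : W = ⊥
  · refine ⟨0, Fin.elim0, Fin.elim0, fun i => i.elim0, fun i => i.elim0, fun i => i.elim0,
      fun i => i.elim0, fun i => i.elim0, fun v hv => ⟨Fin.elim0, Fin.elim0, ?_⟩⟩
    rw [h0, Submodule.mem_bot] at hv
    simp [hv]
  obtain ⟨v, hv, hv0⟩ := W.ne_bot_iff.1 h0
  obtain ⟨u, hu, huv⟩ : ∃ u ∈ W, B v u ≠ 0 := by
    by_contra! h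
    exact hv0 (hW v hv h)
  obtain ⟨w, hw, hvw⟩ : ∃ w ∈ W, B v w = 1 :=
    ⟨(B v u)⁻¹ • u, W.smul_mem _ hu, by simp [huv]⟩
  have hwv : B w v = -1 := by rw [hskew, hvw]
  let W' : Submodule ℝ V := W ⊓ (LinearMap.ker (B v) ⊓ LinearMap.ker (B w))
  have hle : W' ≤ W := inf_le_left
  have hmem (u) : u ∈ W' ↔ u ∈ W ∧ B v u = 0 ∧ B w u = 0 := by simp [W']
  have hfd : FiniteDimensional ℝ W' := Submodule.finiteDimensional_of_le hle
  have hlt : W' < W := by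
    refine lt_of_le_of_ne hle fun h => ?_
    have := ((hmem v).1 (h ▸ hv)).2.2
    rw [hwv] at this
    norm_num at this
  -- the splitting of `W` into the hyperbolic plane and its orthogonal complement
  have hsplit (u) (hu : u ∈ W) : u - (-(B w u)) • v - (B v u) • w ∈ W' := by
    rw [hmem]
    refine ⟨W.sub_mem (W.sub_mem hu (W.smul_mem _ hv)) (W.smul_mem _ hw), ?_, ?_⟩
    · simp [hB, hvw]
    · simp [hB, hwv]
  obtain ⟨r, a, b, ha, hb, haa, hbb, hba, hspan⟩ := ih _
    (hn ▸ Submodule.finrank_lt_finrank_of_lt hlt) W' (fun x hx hx' => by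
      refine hW x (hle hx) fun u hu => ?_
      have h := hx' _ (hsplit u hu)
      obtain ⟨-, h1, h2⟩ := (hmem x).1 hx
      rw [map_sub, map_sub, map_smul, map_smul, hskew x v, hskew x w, h1, h2] at h
      simpa using h) rfl
  have ha' := fun i => (hmem _).1 (ha i)
  have hb' := fun i => (hmem _).1 (hb i)
  refine ⟨r + 1, Fin.cons v a, Fin.cons w b, ?_, ?_, ?_, ?_, ?_, ?_⟩
  · exact Fin.cases hv fun i => (ha' i).1
  · exact Fin.cases hw fun i => (hb' i).1
  · refine Fin.cases (Fin.cases ?_ fun j => ?_) fun i => Fin.cases ?_ fun j => ?_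
    · simp [hB]
    · simp [(ha' j).2.1]
    · simp [hskew (a i) v, (ha' i).2.1]
    · simp [haa]
  · refine Fin.cases (Fin.cases ?_ fun j => ?_) fun i => Fin.cases ?_ fun j => ?_
    · simp [hB]
    · simp [(hb' j).2.2]
    · simp [hskew (b i) w, (hb' i).2.2]
    · simp [hbb]
  · refine Fin.cases (Fin.cases ?_ fun j => ?_) fun i => Fin.cases ?_ fun j => ?_
    · simp [hwv]
    · simp [(ha' j).2.2, (Fin.succ_ne_zero j).symm]
    · simp [hskew (b i) v, (hb' i).2.1]
    · simp [hba]
  · intro u hu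
    obtain ⟨c, d, hcd⟩ := hspan _ (hsplit u hu)
    refine ⟨Fin.cons (-(B w u)) c, Fin.cons (B v u) d, ?_⟩
    simp only [Fin.sum_univ_succ, Fin.cons_zero, Fin.cons_succ]
    rw [sub_sub, sub_eq_iff_eq_add] at hcd
    nth_rewrite 1 [hcd]
    abel

/-! ### Realizing graded Lie algebras in the contact algebra -/

section Realization

variable {g : Type*} [LieRing g] [LieAlgebra ℝ g] {G : ℤ → Submodule ℝ g}

/-- A graded Lie algebra whose negative part is a Heisenberg algebra and which is transitive embeds
into the contact algebra; complex structures on the component of degree `-1` that are compatible with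
the bracket are induced by elements of degree zero of the contact algebra. -/
theorem exists_realization (hG : DirectSum.IsInternal G)
    (hlie : ∀ i j, ∀ a ∈ G i, ∀ b ∈ G j, ⁅a, b⁆ ∈ G (i + j)) (hlow : ∀ j < -2, G j = ⊥)
    {et : g} (het : et ∈ G (-2)) (het0 : et ≠ 0) (hspan : ∀ v ∈ G (-2), ∃ c : ℝ, v = c • et)
    [FiniteDimensional ℝ (G (-1))]
    (hnd : ∀ v ∈ G (-1), (∀ u ∈ G (-1), ⁅v, u⁆ = 0) → v = 0) (hne : G (-1) ≠ ⊥)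
    (htrans : ∀ p ≥ 0, ∀ ξ ∈ G p, (∀ u ∈ G (-1), ⁅u, ξ⁆ = 0) → ξ = 0)
    (J : G (-1) →ₗ[ℝ] G (-1)) (hJ : ∀ v, J (J v) = -v)
    (hJlie : ∀ v w : G (-1), ⁅(J v : g), (w : g)⁆ + ⁅(v : g), (J w : g)⁆ = 0) :
    ∃ (r : ℕ) (φ : g →ₗ⁅ℝ⁆ contactAlgebra r) (𝔍 : contactAlgebra r), Function.Injective φ ∧
      (∀ p, (G p).map (φ : g →ₗ[ℝ] contactAlgebra r) ≤ grade p) ∧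
      (∀ p < 0, (G p).map (φ : g →ₗ[ℝ] contactAlgebra r) = grade p) ∧
      IsComplexStructure 𝔍 ∧ ∀ v : G (-1), φ (J v) = ⁅𝔍, φ v⁆ := by
  obtain ⟨π₀, hπ₀⟩ : ∃ π : Module.Dual ℝ g, π et ≠ 0 := by
    by_contra! h
    exact het0 ((Module.forall_dual_apply_eq_zero_iff ℝ et).1 h)
  let π : g →ₗ[ℝ] ℝ := (π₀ et)⁻¹ • π₀
  have hπ : π et = 1 := by simp [π, hπ₀]
  have hπ' (v) (hv : v ∈ G (-2)) : v = π v • et := by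
    obtain ⟨c, rfl⟩ := hspan v hv
    simp [hπ]
  let B : g →ₗ[ℝ] g →ₗ[ℝ] ℝ := LinearMap.compr₂ (LieModule.toEnd ℝ g g : g →ₗ[ℝ] g →ₗ[ℝ] g) π
  have hB (v w) : B v w = π ⁅v, w⁆ := rfl
  have hBlie (v) (hv : v ∈ G (-1)) (w) (hw : w ∈ G (-1)) : ⁅v, w⁆ = B v w • et :=
    hπ' _ (by simpa using hlie _ _ v hv w hw)
  obtain ⟨r, a, b, ha, hb, haa, hbb, hba, hab⟩ := exists_symplectic_basis B
    (fun v => by rw [hB, lie_self, map_zero]) (G (-1)) (fun v hv h => hnd v hv fun u hu => by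
      rw [hBlie v hv u hu, h u hu, zero_smul])
  let e : HeisenbergFrame G r :=
    { eq := a, ep := b, et := et, eq_mem := ha, ep_mem := hb, et_mem := het, et_ne := het0
      lie_eq_eq := fun i j => by rw [hBlie _ (ha i) _ (ha j), haa, zero_smul]
      lie_ep_ep := fun i j => by rw [hBlie _ (hb i) _ (hb j), hbb, zero_smul]
      lie_ep_eq := fun i j => by rw [hBlie _ (hb i) _ (ha j), hba]; split_ifs <;> simp
      span_neg_one := hab
      span_neg_two := hspan }
  obtain ⟨φ, hφ, hφa, hφb, hφt⟩ := e.exists_lieHom hlie hlow hG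
  have hφ' (p) (ξ) (hξ : ξ ∈ G p) : φ ξ ∈ grade p := hφ p ⟨ξ, hξ, rfl⟩
  have hr : 0 < r := by
    rcases Nat.eq_zero_or_pos r with rfl | h
    · refine absurd ((Submodule.eq_bot_iff _).2 fun v hv => ?_) hne
      obtain ⟨c, d, rfl⟩ := hab v hv
      simp
    · exact h
  have hneg (p : ℤ) (hp : p < 0) : (G p).map (φ : g →ₗ[ℝ] contactAlgebra r) = grade p := by
    refine le_antisymm (hφ p) fun X hX => ?_
    rcases lt_or_ge p (-2) with h | h
    · rw [grade_eq_bot h, Submodule.mem_bot] at hX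
      rw [hX]; exact zero_mem _
    obtain rfl | rfl : p = -1 ∨ p = -2 := by omega
    · obtain ⟨c, d, rfl⟩ := exists_eq_of_mem_grade_neg_one hX
      refine ⟨∑ i, c i • a i + ∑ i, d i • b i, add_mem (sum_mem fun i _ =>
        Submodule.smul_mem _ _ (ha i)) (sum_mem fun i _ => Submodule.smul_mem _ _ (hb i)), ?_⟩
      simp [← hφa, ← hφb, e]
    · obtain ⟨c, rfl⟩ := exists_eq_of_mem_grade_neg_two hX
      exact ⟨c • et, Submodule.smul_mem _ _ het, by simp [← hφt, e]⟩
  -- injectivity on homogeneous elements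
  have hinj2 (ξ) (hξ : ξ ∈ G (-2)) (h : φ ξ = 0) : ξ = 0 := by
    obtain ⟨c, rfl⟩ := hspan ξ hξ
    rw [map_smul, show φ et = yt r from hφt] at h
    rw [(smul_eq_zero.1 h).resolve_right yt_ne_zero, zero_smul]
  have hinj1 (m : ℕ) : ∀ ξ ∈ G (m - 1 : ℤ), φ ξ = 0 → ξ = 0 := by
    induction m with
    | zero =>
      intro ξ hξ h
      refine hnd ξ (by simpa using hξ) fun u hu => hinj2 _ ?_ ?_
      · simpa using hlie _ _ ξ hξ u hu
      · rw [LieHom.map_lie, h, zero_lie]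
    | succ m ih =>
      intro ξ hξ h
      refine htrans _ (by push_cast; omega) ξ hξ fun u hu => ih _ ?_ ?_
      · convert hlie _ _ u hu ξ hξ using 2; push_cast; ring
      · rw [LieHom.map_lie, h, lie_zero]
  have hinj0 (p : ℤ) (ξ) (hξ : ξ ∈ G p) (h : φ ξ = 0) : ξ = 0 := by
    rcases lt_or_ge p (-2) with hp | hp
    · rwa [hlow p hp, Submodule.mem_bot] at hξ
    rcases hp.eq_or_lt with rfl | hp
    · exact hinj2 ξ hξ h
    · exact hinj1 (p + 1).toNat ξ (by convert hξ using 2; omega) h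
  have hinj : Function.Injective φ := by
    rw [injective_iff_map_eq_zero]
    intro ξ hξ
    obtain ⟨pr, hpr⟩ := exists_isComponents hG.submodule_iSupIndep
    have hind : iSupIndep (grade (r := r)) :=
      (Module.End.eigenspaces_iSupIndep _).comp Int.cast_injective
    obtain ⟨pr', hpr'⟩ := exists_isComponents hind
    have hcomm (i) (ξ) : φ (pr i ξ) = pr' i (φ ξ) := by
      refine forall_of_isInternal hG (P := fun ξ => φ (pr i ξ) = pr' i (φ ξ)) (fun j ξ hξ => ?_)
        (by simp) (fun x y hx hy => by simp [hx, hy]) ξ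
      by_cases hij : i = j
      · subst hij; rw [hpr.self i ξ hξ, hpr'.self i _ (hφ' i ξ hξ)]
      · rw [hpr.other i j hij ξ hξ, hpr'.other i j hij _ (hφ' j ξ hξ), map_zero]
    refine hpr.eq_zero_of_forall (by rw [hG.submodule_iSup_eq_top]; trivial) fun i => ?_
    exact hinj0 i _ (hpr.mem i ξ) (by rw [hcomm, hξ, map_zero])
  -- the complex structure is a cocycle of weight two
  let Ja (i) := J ⟨a i, ha i⟩
  let Jb (i) := J ⟨b i, hb i⟩
  have hlieq (i) (v) : φ ⁅a i, v⁆ = ⁅yq i, φ v⁆ := by rw [LieHom.map_lie, ← hφa]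
  have hliep (i) (v) : φ ⁅b i, v⁆ = ⁅yp i, φ v⁆ := by rw [LieHom.map_lie, ← hφb]
  have hJl (v w : G (-1)) : ⁅(v : g), (J w : g)⁆ = ⁅(w : g), (J v : g)⁆ := by
    rw [← lie_skew (w : g), eq_neg_iff_add_eq_zero, add_comm]; exact hJlie v w
  have hJE (v : g) (hv : v ∈ G (-1)) : euler r (genFun (φ v)) = ((2 : ℝ) - 1) • genFun (φ v) := by
    have := mem_grade_iff.1 (hφ' _ v hv)
    rw [this]; norm_num
  have hyt (v : g) (hv : v ∈ G (-1)) : dt (genFun (φ v)) = 0 := by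
    rw [← genFun_lie_yt, ← hφt, ← LieHom.map_lie,
      show ⁅e.et, v⁆ = 0 by
        have := hlie _ _ et het v hv
        rwa [hlow _ (by norm_num), Submodule.mem_bot] at this, map_zero, map_zero]
  obtain ⟨hfq, hfp, hft, hfE⟩ := primitive_spec (m := 2) two_ne_zero
    (δq := fun i => -genFun (φ (Ja i))) (δp := fun i => -genFun (φ (Jb i))) (δt := 0)
    (fun i j => by
      simp only [map_neg, ← genFun_lie_yq, ← hlieq]
      rw [show ⁅a i, (Ja j : g)⁆ = ⁅a j, (Ja i : g)⁆ from hJl ⟨a i, ha i⟩ ⟨a j, ha j⟩])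
    (fun i j => by
      simp only [map_neg, ← genFun_lie_yp, ← hliep]
      rw [show ⁅b i, (Jb j : g)⁆ = ⁅b j, (Jb i : g)⁆ from hJl ⟨b i, hb i⟩ ⟨b j, hb j⟩])
    (fun i j => by
      simp only [map_neg, ← genFun_lie_yp, ← genFun_lie_yq, ← hliep, ← hlieq, ite_self, add_zero]
      rw [show ⁅a i, (Jb j : g)⁆ = ⁅b j, (Ja i : g)⁆ from hJl ⟨a i, ha i⟩ ⟨b j, hb j⟩])
    (fun i => by rw [map_zero, map_neg, hyt _ (Ja i).2, neg_zero])
    (fun i => by rw [map_zero, map_neg, hyt _ (Jb i).2, neg_zero])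
    (fun i => by rw [map_neg, hJE _ (Ja i).2, smul_neg])
    (fun i => by rw [map_neg, hJE _ (Jb i).2, smul_neg])
    (by simp)
  set f := primitive (2 : ℝ) (fun i => -genFun (φ (Ja i))) (fun i => -genFun (φ (Jb i))) 0
  have hJq (i) : ⁅hamiltonian f, φ (a i)⁆ = φ (Ja i) := by
    rw [← lie_skew, show φ (a i) = yq i from hφa i]
    apply genFun_injective
    rw [map_neg, genFun_lie_yq, genFun_hamiltonian, hfq, neg_neg]
  have hJp (i) : ⁅hamiltonian f, φ (b i)⁆ = φ (Jb i) := by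
    rw [← lie_skew, show φ (b i) = yp i from hφb i]
    apply genFun_injective
    rw [map_neg, genFun_lie_yp, genFun_hamiltonian, hfp, neg_neg]
  have hJv (v : G (-1)) : φ (J v) = ⁅hamiltonian f, φ v⁆ := by
    obtain ⟨v, hv⟩ := v
    obtain ⟨c, d, h⟩ := hab v hv
    have h2 : (⟨v, hv⟩ : G (-1)) = ∑ i, c i • (⟨a i, ha i⟩ : G (-1)) +
        ∑ i, d i • (⟨b i, hb i⟩ : G (-1)) := by
      apply Subtype.ext
      simpa using h
    rw [h2]
    simp only [map_add, map_sum, map_smul, Submodule.coe_add, Submodule.coe_sum,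
      Submodule.coe_smul, lie_add, lie_sum, lie_smul, hJq, hJp]
    rfl
  refine ⟨r, φ, hamiltonian f, hinj, hφ, hneg, ⟨?_, fun z hz => ?_, fun v hv => ?_⟩, hJv⟩
  · rw [mem_grade_iff, genFun_hamiltonian, hfE]; norm_num
  · obtain ⟨c, rfl⟩ := exists_eq_of_mem_grade_neg_two hz
    rw [lie_smul, ← lie_skew]
    have : ⁅yt r, hamiltonian f⁆ = 0 := by
      apply genFun_injective
      rw [genFun_lie_yt, genFun_hamiltonian, hft, map_zero]
    rw [this, neg_zero, smul_zero]
  · rw [← hneg (-1) (by norm_num)] at hv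
    obtain ⟨w, hw, rfl⟩ := hv
    have h1 := hJv ⟨w, hw⟩
    have h2 := hJv (J ⟨w, hw⟩)
    rw [hJ, h1] at h2
    simpa using h2.symm

end Realization

/-! ### Real structure of a complexification -/

section Complexification

variable {V : Type*} [AddCommGroup V] [Module ℝ V]

theorem tmul_cre_add_tmul_cim (w : ℂ ⊗[ℝ] V) :
    (1 : ℂ) ⊗ₜ[ℝ] cre w + Complex.I ⊗ₜ[ℝ] cim w = w := by
  induction w using TensorProduct.induction_on with
  | zero => simp
  | tmul z v =>
    rw [cre_tmul, cim_tmul, ← TensorProduct.smul_tmul, ← TensorProduct.smul_tmul,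
      ← TensorProduct.add_tmul]
    congr 1
    apply Complex.ext <;> simp
  | add a b ha hb =>
    nth_rewrite 3 [← ha, ← hb]
    simp only [map_add, TensorProduct.tmul_add]
    abel

theorem complexification_ext {w w' : ℂ ⊗[ℝ] V} (h1 : cre w = cre w') (h2 : cim w = cim w') :
    w = w' := by
  rw [← tmul_cre_add_tmul_cim w, ← tmul_cre_add_tmul_cim w', h1, h2]

@[simp] theorem conj_tmul (z : ℂ) (v : V) : conj (z ⊗ₜ[ℝ] v) = (starRingEnd ℂ z) ⊗ₜ[ℝ] v := rfl

theorem cre_conj (w : ℂ ⊗[ℝ] V) : cre (conj w) = cre w := by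
  induction w using TensorProduct.induction_on with
  | zero => simp
  | tmul z v => simp
  | add a b ha hb => simp only [map_add, ha, hb]

theorem cim_conj (w : ℂ ⊗[ℝ] V) : cim (conj w) = - cim w := by
  induction w using TensorProduct.induction_on with
  | zero => simp
  | tmul z v => simp
  | add a b ha hb => simp only [map_add, ha, hb]; abel

@[simp] theorem conj_conj (w : ℂ ⊗[ℝ] V) : conj (conj w) = w :=
  complexification_ext (by rw [cre_conj, cre_conj]) (by rw [cim_conj, cim_conj, neg_neg])

theorem mem_conjSubmodule {W : Submodule ℂ (ℂ ⊗[ℝ] V)} {x : ℂ ⊗[ℝ] V} :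
    x ∈ conjSubmodule W ↔ conj x ∈ W := by
  constructor
  · rintro ⟨y, hy, rfl⟩
    rwa [conj_conj]
  · intro h
    exact ⟨conj x, h, conj_conj x⟩

theorem conj_mem_conjSubmodule {W : Submodule ℂ (ℂ ⊗[ℝ] V)} {x : ℂ ⊗[ℝ] V} :
    conj x ∈ conjSubmodule W ↔ x ∈ W := by
  rw [mem_conjSubmodule, conj_conj]

theorem conjSubmodule_conjSubmodule (W : Submodule ℂ (ℂ ⊗[ℝ] V)) :
    conjSubmodule (conjSubmodule W) = W := by
  ext x; rw [mem_conjSubmodule, conj_mem_conjSubmodule]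

theorem conjSubmodule_sup (W W' : Submodule ℂ (ℂ ⊗[ℝ] V)) :
    conjSubmodule (W ⊔ W') = conjSubmodule W ⊔ conjSubmodule W' := Submodule.map_sup _ _ _

theorem conjSubmodule_mono {W W' : Submodule ℂ (ℂ ⊗[ℝ] V)} (h : W ≤ W') :
    conjSubmodule W ≤ conjSubmodule W' := Submodule.map_mono h

theorem mem_baseChange {P : Submodule ℝ V} {x : ℂ ⊗[ℝ] V} :
    x ∈ P.baseChange ℂ ↔ cre x ∈ P ∧ cim x ∈ P := by
  constructor
  · intro h
    rw [Submodule.baseChange_eq_span] at h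
    induction h using Submodule.span_induction with
    | mem y hy =>
      obtain ⟨v, hv, rfl⟩ := hy
      simpa using hv
    | zero => simp
    | add y z _ _ hy hz => simpa using ⟨add_mem hy.1 hz.1, add_mem hy.2 hz.2⟩
    | smul c y _ hy =>
      rw [cre_smul, cim_smul]
      exact ⟨sub_mem (P.smul_mem _ hy.1) (P.smul_mem _ hy.2),
        add_mem (P.smul_mem _ hy.2) (P.smul_mem _ hy.1)⟩
  · rintro ⟨h1, h2⟩
    rw [← tmul_cre_add_tmul_cim x]
    exact add_mem (Submodule.tmul_mem_baseChange_of_mem _ h1)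
      (Submodule.tmul_mem_baseChange_of_mem _ h2)

theorem conj_mem_baseChange {P : Submodule ℝ V} {x : ℂ ⊗[ℝ] V} :
    conj x ∈ P.baseChange ℂ ↔ x ∈ P.baseChange ℂ := by
  simp only [mem_baseChange, cre_conj, cim_conj, neg_mem_iff]

variable {W : Type*} [AddCommGroup W] [Module ℝ W]

theorem cre_baseChange (f : V →ₗ[ℝ] W) (x : ℂ ⊗[ℝ] V) : cre (f.baseChange ℂ x) = f (cre x) := by
  induction x using TensorProduct.induction_on with
  | zero => simp
  | tmul z v => simp
  | add a b ha hb => simp only [map_add, ha, hb]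

theorem cim_baseChange (f : V →ₗ[ℝ] W) (x : ℂ ⊗[ℝ] V) : cim (f.baseChange ℂ x) = f (cim x) := by
  induction x using TensorProduct.induction_on with
  | zero => simp
  | tmul z v => simp
  | add a b ha hb => simp only [map_add, ha, hb]

theorem conj_baseChange (f : V →ₗ[ℝ] W) (x : ℂ ⊗[ℝ] V) :
    conj (f.baseChange ℂ x) = f.baseChange ℂ (conj x) :=
  complexification_ext (by rw [cre_conj, cre_baseChange, cre_baseChange, cre_conj])
    (by rw [cim_conj, cim_baseChange, cim_baseChange, cim_conj, map_neg])

theorem conjSubmodule_map_baseChange (f : V →ₗ[ℝ] W) (P : Submodule ℂ (ℂ ⊗[ℝ] V)) :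
    conjSubmodule (P.map (f.baseChange ℂ)) = (conjSubmodule P).map (f.baseChange ℂ) := by
  ext x
  constructor
  · rintro ⟨_, ⟨y, hy, rfl⟩, rfl⟩
    exact ⟨conj y, conj_mem_conjSubmodule.2 hy, (conj_baseChange f y).symm⟩
  · rintro ⟨_, ⟨y, hy, rfl⟩, rfl⟩
    exact ⟨_, ⟨y, hy, rfl⟩, conj_baseChange f y⟩

theorem baseChange_injective {f : V →ₗ[ℝ] W} (hf : Function.Injective f) :
    Function.Injective (f.baseChange ℂ) := by
  intro x y h
  refine complexification_ext (hf ?_) (hf ?_)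
  · rw [← cre_baseChange, h, cre_baseChange]
  · rw [← cim_baseChange, h, cim_baseChange]

end Complexification

section ComplexifiedLie

variable {g : Type*} [LieRing g] [LieAlgebra ℝ g]

/-! The bracket of `ℂ ⊗ g` is found by unification in a form to which the general lemmas on Lie
rings do not apply syntactically; the following are these lemmas in that form. -/

theorem cadd_lie (x y z : ℂ ⊗[ℝ] g) : ⁅x + y, z⁆ = ⁅x, z⁆ + ⁅y, z⁆ := add_lie x y z
theorem clie_add (x y z : ℂ ⊗[ℝ] g) : ⁅x, y + z⁆ = ⁅x, y⁆ + ⁅x, z⁆ := lie_add x y z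
theorem csub_lie (x y z : ℂ ⊗[ℝ] g) : ⁅x - y, z⁆ = ⁅x, z⁆ - ⁅y, z⁆ := sub_lie x y z
theorem csmul_lie (a : ℂ) (x y : ℂ ⊗[ℝ] g) : ⁅a • x, y⁆ = a • ⁅x, y⁆ := smul_lie a x y
theorem clie_smul (a : ℂ) (x y : ℂ ⊗[ℝ] g) : ⁅x, a • y⁆ = a • ⁅x, y⁆ := lie_smul a x y
theorem czero_lie (x : ℂ ⊗[ℝ] g) : ⁅(0 : ℂ ⊗[ℝ] g), x⁆ = 0 := zero_lie x
theorem clie_zero (x : ℂ ⊗[ℝ] g) : ⁅x, (0 : ℂ ⊗[ℝ] g)⁆ = 0 := lie_zero x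
theorem clie_skew (x y : ℂ ⊗[ℝ] g) : -⁅y, x⁆ = ⁅x, y⁆ := lie_skew x y
theorem cleibniz_lie (x y z : ℂ ⊗[ℝ] g) : ⁅x, ⁅y, z⁆⁆ = ⁅⁅x, y⁆, z⁆ + ⁅y, ⁅x, z⁆⁆ :=
  leibniz_lie x y z
theorem cad_apply (x y : ℂ ⊗[ℝ] g) : LieAlgebra.ad ℂ (ℂ ⊗[ℝ] g) x y = ⁅x, y⁆ := rfl

theorem cre_lie (x y : ℂ ⊗[ℝ] g) : cre ⁅x, y⁆ = ⁅cre x, cre y⁆ - ⁅cim x, cim y⁆ := by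
  nth_rewrite 1 [← tmul_cre_add_tmul_cim x, ← tmul_cre_add_tmul_cim y]
  simp [add_lie, lie_add, sub_eq_add_neg]

theorem cim_lie (x y : ℂ ⊗[ℝ] g) : cim ⁅x, y⁆ = ⁅cre x, cim y⁆ + ⁅cim x, cre y⁆ := by
  nth_rewrite 1 [← tmul_cre_add_tmul_cim x, ← tmul_cre_add_tmul_cim y]
  simp [add_lie, lie_add, add_comm]

theorem conj_lie (x y : ℂ ⊗[ℝ] g) : conj ⁅x, y⁆ = ⁅conj x, conj y⁆ := by
  apply complexification_ext
  · simp [cre_conj, cim_conj, cre_lie]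
  · simp [cre_conj, cim_conj, cim_lie]; abel

theorem baseChange_lie {h : Type*} [LieRing h] [LieAlgebra ℝ h] (φ : g →ₗ⁅ℝ⁆ h)
    (x y : ℂ ⊗[ℝ] g) : (φ : g →ₗ[ℝ] h).baseChange ℂ ⁅x, y⁆ =
      ⁅(φ : g →ₗ[ℝ] h).baseChange ℂ x, (φ : g →ₗ[ℝ] h).baseChange ℂ y⁆ := by
  apply complexification_ext
  · simp [cre_baseChange, cim_baseChange, cre_lie]
  · simp [cre_baseChange, cim_baseChange, cim_lie]

end ComplexifiedLie

/-! ### The action of the complex structure on the contact algebra -/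

section Contact

variable {r : ℕ}

theorem mem_cgrade_iff {p : ℤ} {x : ℂ ⊗[ℝ] contactAlgebra r} :
    x ∈ cgrade p ↔ ⁅(1 : ℂ) ⊗ₜ[ℝ] gradingElement r, x⁆ = (p : ℂ) • x := by
  rw [cgrade, mem_baseChange, grade, Module.End.mem_eigenspace_iff, Module.End.mem_eigenspace_iff]
  constructor
  · rintro ⟨h1, h2⟩
    apply complexification_ext
    · rw [cre_lie, cre_smul]; simpa using h1
    · rw [cim_lie, cim_smul]; simpa using h2
  · intro h
    have h1 := congrArg cre h
    have h2 := congrArg cim h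
    rw [cre_lie, cre_smul] at h1
    rw [cim_lie, cim_smul] at h2
    exact ⟨by simpa using h1, by simpa using h2⟩

theorem iSupIndep_cgrade : iSupIndep (cgrade (r := r)) := by
  have : (cgrade (r := r)) = fun p : ℤ => Module.End.eigenspace (LieAlgebra.ad ℂ
      (ℂ ⊗[ℝ] contactAlgebra r) ((1 : ℂ) ⊗ₜ[ℝ] gradingElement r)) (p : ℂ) := by
    ext p x
    rw [mem_cgrade_iff, Module.End.mem_eigenspace_iff, LieAlgebra.ad_apply]
  rw [this]
  exact (Module.End.eigenspaces_iSupIndep _).comp Int.cast_injective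

theorem conj_mem_cgrade {p : ℤ} {x : ℂ ⊗[ℝ] contactAlgebra r} :
    conj x ∈ cgrade p ↔ x ∈ cgrade p := conj_mem_baseChange

theorem lie_mem_cgrade {p q : ℤ} {x y : ℂ ⊗[ℝ] contactAlgebra r} (hx : x ∈ cgrade p)
    (hy : y ∈ cgrade q) : ⁅x, y⁆ ∈ cgrade (p + q) := by
  rw [cgrade, mem_baseChange] at *
  rw [cre_lie, cim_lie]
  exact ⟨sub_mem (lie_mem_grade hx.1 hy.1) (lie_mem_grade hx.2 hy.2),
    add_mem (lie_mem_grade hx.1 hy.2) (lie_mem_grade hx.2 hy.1)⟩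

theorem eq_zero_of_lie_cgrade_neg_one_eq_zero (hr : 0 < r) {p : ℤ} (hp : p ≠ -2)
    {x : ℂ ⊗[ℝ] contactAlgebra r} (hx : x ∈ cgrade p)
    (h : ∀ y ∈ cgrade (r := r) (-1), ⁅y, x⁆ = 0) : x = 0 := by
  have hY (Y) (hY : Y ∈ grade (r := r) (-1)) : ⁅Y, cre x⁆ = 0 ∧ ⁅Y, cim x⁆ = 0 := by
    have := h ((1 : ℂ) ⊗ₜ[ℝ] Y) (Submodule.tmul_mem_baseChange_of_mem _ hY)
    have h1 := congrArg cre this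
    have h2 := congrArg cim this
    rw [cre_lie] at h1
    rw [cim_lie] at h2
    exact ⟨by simpa using h1, by simpa using h2⟩
  rw [cgrade, mem_baseChange] at hx
  refine complexification_ext ?_ ?_
  · rw [map_zero]
    exact eq_zero_of_lie_grade_neg_one_eq_zero hr hp hx.1 fun Y h => (hY Y h).1
  · rw [map_zero]
    exact eq_zero_of_lie_grade_neg_one_eq_zero hr hp hx.2 fun Y h => (hY Y h).2

variable {𝔍 : contactAlgebra r}

/-- The operator `ad 𝔍` on the complexified contact algebra. -/
abbrev adJ (𝔍 : contactAlgebra r) : Module.End ℂ (ℂ ⊗[ℝ] contactAlgebra r) :=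
  LieAlgebra.ad ℂ (ℂ ⊗[ℝ] contactAlgebra r) ((1 : ℂ) ⊗ₜ[ℝ] 𝔍)

theorem mem_adEigenspace {p : ℤ} {μ : ℂ} {x : ℂ ⊗[ℝ] contactAlgebra r} :
    x ∈ adEigenspace 𝔍 p μ ↔ x ∈ cgrade p ∧ adJ 𝔍 x = μ • x := by
  rw [adEigenspace, Submodule.mem_inf, Module.End.mem_eigenspace_iff]

theorem lie_mem_adEigenspace {p q : ℤ} {μ ν : ℂ} {x y : ℂ ⊗[ℝ] contactAlgebra r}
    (hx : x ∈ adEigenspace 𝔍 p μ) (hy : y ∈ adEigenspace 𝔍 q ν) :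
    ⁅x, y⁆ ∈ adEigenspace 𝔍 (p + q) (μ + ν) := by
  rw [mem_adEigenspace] at *
  refine ⟨lie_mem_cgrade hx.1 hy.1, ?_⟩
  have h1 := hx.2
  have h2 := hy.2
  rw [cad_apply] at *
  rw [cleibniz_lie, h1, h2, csmul_lie, clie_smul, add_smul]

theorem conj_mem_adEigenspace {p : ℤ} {μ : ℂ} {x : ℂ ⊗[ℝ] contactAlgebra r}
    (hx : x ∈ adEigenspace 𝔍 p μ) : conj x ∈ adEigenspace 𝔍 p (starRingEnd ℂ μ) := by
  rw [mem_adEigenspace] at *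
  refine ⟨conj_mem_cgrade.2 hx.1, ?_⟩
  have h := congrArg conj hx.2
  rw [LieAlgebra.ad_apply, conj_lie, LinearMap.map_smulₛₗ] at h
  rw [LieAlgebra.ad_apply]
  simpa using h

theorem exists_eigenspace_components : ∃ pr : ℂ → Module.End ℂ (ℂ ⊗[ℝ] contactAlgebra r),
    IsComponents (Module.End.eigenspace (adJ 𝔍)) pr :=
  exists_isComponents (Module.End.eigenspaces_iSupIndep _)

/-- An operator that is annihilated on an invariant subspace by a polynomial with simple roots is
diagonalizable there. -/
theorem mem_iSup_eigenspace_of_aeval_eq_zero {V : Type*} [AddCommGroup V] [Module ℂ V]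
    (A : Module.End ℂ V) (W : Submodule ℂ V) (hW : ∀ x ∈ W, A x ∈ W) (s : Finset ℂ) :
    ∀ x ∈ W, Polynomial.aeval A (∏ a ∈ s, (Polynomial.X - Polynomial.C a)) x = 0 →
      x ∈ ⨆ a ∈ s, W ⊓ Module.End.eigenspace A a := by
  induction s using Finset.induction_on with
  | empty =>
    intro x _ hx
    simp only [Finset.prod_empty, map_one, Module.End.one_apply] at hx
    rw [hx]; exact zero_mem _
  | insert a s ha ih =>
    intro x hxW hx
    rw [Finset.prod_insert ha, mul_comm, map_mul, Module.End.mul_apply] at hx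
    have hAx : Polynomial.aeval A (Polynomial.X - Polynomial.C a) x = A x - a • x := by simp
    rw [hAx] at hx
    have hy := ih _ (sub_mem (hW x hxW) (W.smul_mem a hxW)) hx
    have hle : (⨆ b ∈ s, W ⊓ Module.End.eigenspace A b) ≤
        (⨆ b ∈ s, W ⊓ Module.End.eigenspace A b).map (A - a • 1) := by
      refine iSup₂_le fun b hb y hy => ?_
      have hba : b - a ≠ 0 := sub_ne_zero.2 fun h => ha (h ▸ hb)
      refine ⟨(b - a)⁻¹ • y, Submodule.smul_mem _ _
        (Submodule.mem_iSup_of_mem b (Submodule.mem_iSup_of_mem hb hy)), ?_⟩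
      have := Module.End.mem_eigenspace_iff.1 hy.2
      rw [map_smul, LinearMap.sub_apply, this, LinearMap.smul_apply, Module.End.one_apply,
        ← sub_smul, inv_smul_smul₀ hba]
    obtain ⟨x', hx', hxx⟩ := hle hy
    have hxx' : A x' - a • x' = A x - a • x := hxx
    have hx'W : x' ∈ W :=
      (iSup₂_le fun b _ => inf_le_left : (⨆ b ∈ s, W ⊓ Module.End.eigenspace A b) ≤ W) hx'
    have hmem : x - x' ∈ W ⊓ Module.End.eigenspace A a := by
      refine ⟨sub_mem hxW hx'W, ?_⟩
      rw [SetLike.mem_coe, Module.End.mem_eigenspace_iff, map_sub, smul_sub, sub_eq_sub_iff_sub_eq_sub]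
      exact hxx'.symm
    rw [← sub_add_cancel x x']
    refine add_mem (Submodule.mem_iSup_of_mem a
      (Submodule.mem_iSup_of_mem (Finset.mem_insert_self a s) hmem)) ?_
    exact (iSup₂_le fun b hb => le_iSup₂_of_le b (Finset.mem_insert_of_mem hb) le_rfl :
      (⨆ b ∈ s, W ⊓ Module.End.eigenspace A b) ≤ _) hx'

/-- The polynomial with simple roots `i N, i (N - 2), ..., - i N`. -/
def stringPoly (N : ℕ) : Polynomial ℂ :=
  ∏ m ∈ Finset.range (N + 1), (Polynomial.X - Polynomial.C (((N : ℂ) - 2 * m) * Complex.I))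

theorem eval_stringPoly_ne_zero {N : ℕ} {c : ℤ} (hc : ∀ m : ℕ, m ≤ N → c ≠ N - 2 * m) :
    (stringPoly N).eval ((c : ℂ) * Complex.I) ≠ 0 := by
  rw [stringPoly, Polynomial.eval_prod, Finset.prod_ne_zero_iff]
  intro m hm
  simp only [Polynomial.eval_sub, Polynomial.eval_X, Polynomial.eval_C]
  rw [← sub_mul]
  refine mul_ne_zero (fun h => hc m (Nat.lt_succ_iff.1 (Finset.mem_range.1 hm)) ?_) Complex.I_ne_zero
  rw [sub_eq_zero] at h
  exact_mod_cast h

theorem stringPoly_eq_prod (N : ℕ) : ∃ s : Finset ℂ,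
    stringPoly N = ∏ a ∈ s, (Polynomial.X - Polynomial.C a) := by
  classical
  refine ⟨(Finset.range (N + 1)).image fun m : ℕ => ((N : ℂ) - 2 * m) * Complex.I, ?_⟩
  rw [Finset.prod_image, stringPoly]
  intro a _ b _ h
  have := mul_right_cancel₀ Complex.I_ne_zero h
  have h2 : (a : ℂ) = b := by linear_combination (-1 / 2 : ℂ) * this
  exact_mod_cast h2

theorem lie_aeval_adJ {w : ℂ ⊗[ℝ] contactAlgebra r} {μ : ℂ} (hw : adJ 𝔍 w = μ • w)
    (P : Polynomial ℂ) : ∀ x, ⁅w, Polynomial.aeval (adJ 𝔍) P x⁆ =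
      Polynomial.aeval (adJ 𝔍) (P.comp (Polynomial.X - Polynomial.C μ)) ⁅w, x⁆ := by
  have h1 (x) : ⁅w, adJ 𝔍 x⁆ = adJ 𝔍 ⁅w, x⁆ - μ • ⁅w, x⁆ := by
    rw [cad_apply] at *
    rw [cad_apply, cleibniz_lie ((1 : ℂ) ⊗ₜ[ℝ] 𝔍), hw, csmul_lie]
    abel
  induction P using Polynomial.induction_on with
  | C a => intro x; simp [Module.algebraMap_end_apply, clie_smul]
  | add p q hp hq => intro x; simp [hp, hq, clie_add]
  | monomial n a ih =>
    intro x
    rw [pow_succ, ← mul_assoc, map_mul, Module.End.mul_apply, Polynomial.aeval_X, ih, h1,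
      Polynomial.mul_comp (_ * _), map_mul, Module.End.mul_apply]
    simp

/-- The eigenvalues of `ad 𝔍` in degree `N - 2` are among `i N, ..., - i N`, and they are simple
roots of the minimal polynomial: bracketing with the eigenvectors in degree `-1` shifts the eigenvalues
by `± i`, and transitivity allows induction. -/
theorem aeval_stringPoly_eq_zero (hr : 0 < r) (hJ : IsComplexStructure 𝔍) (N : ℕ) :
    ∀ x ∈ cgrade (r := r) ((N : ℤ) - 2), Polynomial.aeval (adJ 𝔍) (stringPoly N) x = 0 := by
  have hgr (p : ℤ) (x) (hx : x ∈ cgrade p) : adJ 𝔍 x ∈ cgrade p := by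
    have h0 : (1 : ℂ) ⊗ₜ[ℝ] 𝔍 ∈ cgrade (r := r) 0 :=
      Submodule.tmul_mem_baseChange_of_mem _ hJ.mem_grade
    simpa using lie_mem_cgrade h0 hx
  have hgr' (p : ℤ) (P : Polynomial ℂ) : ∀ x ∈ cgrade p, Polynomial.aeval (adJ 𝔍) P x ∈ cgrade p := by
    induction P using Polynomial.induction_on with
    | C a => intro x hx; simpa [Module.algebraMap_end_apply] using Submodule.smul_mem _ a hx
    | add P Q hP hQ => intro x hx; simpa using add_mem (hP x hx) (hQ x hx)
    | monomial n a ih =>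
      intro x hx
      rw [pow_succ, ← mul_assoc, map_mul, Module.End.mul_apply, Polynomial.aeval_X]
      exact ih _ (hgr p x hx)
  -- the component of degree `-1` is spanned by eigenvectors
  have hJJ (y) (hy : y ∈ cgrade (r := r) (-1)) : adJ 𝔍 (adJ 𝔍 y) = -y := by
    rw [cgrade, mem_baseChange] at hy
    apply complexification_ext
    · simp [LieAlgebra.ad_apply, cre_lie, cim_lie, hJ.lie_lie_neg_one _ hy.1]
    · simp [LieAlgebra.ad_apply, cre_lie, cim_lie, hJ.lie_lie_neg_one _ hy.2]
  have hsplit (y) (hy : y ∈ cgrade (r := r) (-1)) : ∃ y₁ y₂, adJ 𝔍 y₁ = Complex.I • y₁ ∧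
      adJ 𝔍 y₂ = (-Complex.I) • y₂ ∧ y₁ ∈ cgrade (r := r) (-1) ∧ y₂ ∈ cgrade (r := r) (-1) ∧
      y = y₁ + y₂ := by
    refine ⟨(2⁻¹ : ℂ) • (y - Complex.I • adJ 𝔍 y), (2⁻¹ : ℂ) • (y + Complex.I • adJ 𝔍 y),
      ?_, ?_, Submodule.smul_mem _ _ (sub_mem hy (Submodule.smul_mem _ _ (hgr _ _ hy))),
      Submodule.smul_mem _ _ (add_mem hy (Submodule.smul_mem _ _ (hgr _ _ hy))), ?_⟩
    · rw [map_smul, map_sub, map_smul, hJJ y hy, smul_comm Complex.I, smul_sub Complex.I,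
        smul_smul Complex.I, Complex.I_mul_I]
      congr 1; module
    · rw [map_smul, map_add, map_smul, hJJ y hy, smul_comm (-Complex.I), smul_add (-Complex.I),
        smul_smul (-Complex.I), neg_mul, Complex.I_mul_I]
      congr 1; module
    · module
  induction N with
  | zero =>
    intro x hx
    have hx' : x ∈ cgrade (-2) := by simpa using hx
    rw [cgrade, mem_baseChange] at hx'
    simp only [stringPoly, zero_add, Finset.range_one, Finset.prod_singleton, Nat.cast_zero,
      mul_zero, sub_zero, zero_mul, map_zero, Polynomial.aeval_X, LieAlgebra.ad_apply]
    apply complexification_ext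
    · simp [cre_lie, hJ.lie_neg_two _ hx'.1]
    · simp [cim_lie, hJ.lie_neg_two _ hx'.2]
  | succ N ih =>
    intro x hx
    refine eq_zero_of_lie_cgrade_neg_one_eq_zero hr (p := ((N + 1 : ℕ) : ℤ) - 2)
      (by push_cast; omega) (hgr' _ _ x hx) fun y hy => ?_
    obtain ⟨y₁, y₂, h1, h2, hy1, hy2, rfl⟩ := hsplit y hy
    have hlow (w) (hw : w ∈ cgrade (r := r) (-1)) : ⁅w, x⁆ ∈ cgrade ((N : ℤ) - 2) := by
      convert lie_mem_cgrade hw hx using 2; push_cast; ring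
    have e1 : (stringPoly (N + 1)).comp (Polynomial.X - Polynomial.C Complex.I) =
        (Polynomial.X - Polynomial.C (((N : ℂ) + 2) * Complex.I)) * stringPoly N := by
      rw [stringPoly, Finset.prod_range_succ', stringPoly, mul_comm, Polynomial.mul_comp,
        Polynomial.prod_comp]
      congr 1
      · simp only [Polynomial.sub_comp, Polynomial.X_comp, Polynomial.C_comp]
        rw [sub_sub, ← map_add]; congr 2; push_cast; ring
      · refine Finset.prod_congr rfl fun m _ => ?_
        simp only [Polynomial.sub_comp, Polynomial.X_comp, Polynomial.C_comp]
        rw [sub_sub, ← map_add]; congr 2; push_cast; ring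
    have e2 : (stringPoly (N + 1)).comp (Polynomial.X - Polynomial.C (-Complex.I)) =
        (Polynomial.X - Polynomial.C (-((N : ℂ) + 2) * Complex.I)) * stringPoly N := by
      rw [stringPoly, Finset.prod_range_succ, stringPoly, mul_comm, Polynomial.mul_comp,
        Polynomial.prod_comp]
      congr 1
      · simp only [Polynomial.sub_comp, Polynomial.X_comp, Polynomial.C_comp]
        rw [sub_sub, ← map_add]; congr 2; push_cast; ring
      · refine Finset.prod_congr rfl fun m _ => ?_
        simp only [Polynomial.sub_comp, Polynomial.X_comp, Polynomial.C_comp]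
        rw [sub_sub, ← map_add]; congr 2; push_cast; ring
    rw [cadd_lie, lie_aeval_adJ h1, lie_aeval_adJ h2, e1, e2, map_mul (Polynomial.aeval _),
      map_mul (Polynomial.aeval _), Module.End.mul_apply, Module.End.mul_apply, ih _ (hlow _ hy1),
      ih _ (hlow _ hy2), map_zero, map_zero, add_zero]

variable (hr : 0 < r) (hJ : IsComplexStructure 𝔍)
include hr hJ

theorem cgrade_le_iSup_adEigenspace {p : ℤ} (hp : -2 ≤ p) :
    cgrade (r := r) p ≤ ⨆ ν, adEigenspace 𝔍 p ν := by
  obtain ⟨N, rfl⟩ : ∃ N : ℕ, p = N - 2 := ⟨(p + 2).toNat, by omega⟩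
  obtain ⟨s, hs⟩ := stringPoly_eq_prod N
  intro x hx
  have h := aeval_stringPoly_eq_zero hr hJ N x hx
  rw [hs] at h
  have h0 : (1 : ℂ) ⊗ₜ[ℝ] 𝔍 ∈ cgrade (r := r) 0 :=
    Submodule.tmul_mem_baseChange_of_mem _ hJ.mem_grade
  have := mem_iSup_eigenspace_of_aeval_eq_zero (adJ 𝔍) (cgrade ((N : ℤ) - 2))
    (fun x hx => by simpa using lie_mem_cgrade h0 hx) s x hx h
  exact (iSup₂_le fun a _ => le_iSup (adEigenspace 𝔍 ((N : ℤ) - 2)) a) this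

theorem adEigenspace_eq_bot {p c : ℤ} (hp : -2 ≤ p) (hc : p + 2 < c ∨ c < -p - 2) :
    adEigenspace 𝔍 p ((c : ℂ) * Complex.I) = ⊥ := by
  obtain ⟨N, rfl⟩ : ∃ N : ℕ, p = N - 2 := ⟨(p + 2).toNat, by omega⟩
  rw [Submodule.eq_bot_iff]
  intro x hx
  rw [mem_adEigenspace] at hx
  have h := aeval_stringPoly_eq_zero hr hJ N x hx.1
  rw [Module.End.aeval_apply_of_mem_apply_eq_smul hx.2] at h
  refine (smul_eq_zero.1 h).resolve_left (eval_stringPoly_ne_zero fun m hm => ?_)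
  omega

omit hr hJ in
theorem exceptEigenspace_le (p : ℤ) (μ : ℂ) : exceptEigenspace 𝔍 p μ ≤ cgrade p :=
  iSup₂_le fun _ _ => inf_le_left

omit hr hJ in
theorem mem_exceptEigenspace_of_ne {p : ℤ} {μ ν : ℂ} (h : ν ≠ μ) {x : ℂ ⊗[ℝ] contactAlgebra r}
    (hx : x ∈ adEigenspace 𝔍 p ν) : x ∈ exceptEigenspace 𝔍 p μ :=
  Submodule.mem_iSup_of_mem ν (Submodule.mem_iSup_of_mem h hx)

/-- Membership in the sum of the other eigenspaces is the vanishing of the component. -/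
theorem mem_exceptEigenspace_iff {pr : ℂ → Module.End ℂ (ℂ ⊗[ℝ] contactAlgebra r)}
    (hpr : IsComponents (Module.End.eigenspace (adJ 𝔍)) pr) {p : ℤ} (hp : -2 ≤ p) {μ : ℂ}
    {x : ℂ ⊗[ℝ] contactAlgebra r} (hx : x ∈ cgrade p) :
    x ∈ exceptEigenspace 𝔍 p μ ↔ pr μ x = 0 := by
  have hle : ∀ ν, adEigenspace 𝔍 p ν ≤ Module.End.eigenspace (adJ 𝔍) ν := fun ν => inf_le_right
  have hx' := cgrade_le_iSup_adEigenspace hr hJ hp hx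
  constructor
  · intro h
    have : exceptEigenspace 𝔍 p μ ≤ LinearMap.ker (pr μ) :=
      iSup₂_le fun ν hν y hy => hpr.other μ ν hν.symm y (hle ν hy)
    exact this h
  · intro h
    refine hpr.mem_of_forall (iSup_mono hle hx') fun ν => ?_
    by_cases hν : ν = μ
    · rw [hν, h]; exact zero_mem _
    · exact mem_exceptEigenspace_of_ne hν (hpr.mem_of_mem_iSup hle hx' ν)

omit hr in
theorem exceptEigenspace_neg_two : exceptEigenspace 𝔍 (-2) 0 = ⊥ := by
  rw [eq_bot_iff]
  refine iSup₂_le fun ν hν x hx => ?_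
  rw [mem_adEigenspace, cgrade, mem_baseChange] at hx
  have h0 : adJ 𝔍 x = 0 := by
    rw [cad_apply]
    apply complexification_ext
    · simp [cre_lie, hJ.lie_neg_two _ hx.1.1]
    · simp [cim_lie, hJ.lie_neg_two _ hx.1.2]
  rw [h0] at hx
  exact (smul_eq_zero.1 hx.2.symm).resolve_left hν

omit hr hJ in
theorem conjSubmodule_exceptEigenspace (p : ℤ) (μ : ℂ) :
    conjSubmodule (exceptEigenspace 𝔍 p μ) = exceptEigenspace 𝔍 p (starRingEnd ℂ μ) := by
  have h (μ : ℂ) :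
      conjSubmodule (exceptEigenspace 𝔍 p μ) ≤ exceptEigenspace 𝔍 p (starRingEnd ℂ μ) := by
    rw [exceptEigenspace, conjSubmodule, Submodule.map_iSup]
    refine iSup_le fun ν => ?_
    rw [Submodule.map_iSup]
    refine iSup_le fun hν => ?_
    rintro _ ⟨y, hy, rfl⟩
    refine mem_exceptEigenspace_of_ne (fun h => hν ?_) (conj_mem_adEigenspace hy)
    exact (starRingEnd ℂ).injective h
  refine le_antisymm (h μ) ?_
  have h2 := conjSubmodule_mono (h (starRingEnd ℂ μ))
  rwa [conjSubmodule_conjSubmodule, Complex.conj_conj] at h2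

omit hr hJ in
theorem conjSubmodule_uComponent (p : ℤ) : conjSubmodule (uComponent 𝔍 p) =
    exceptEigenspace 𝔍 p (((p : ℂ) + 2) * Complex.I) := by
  rw [uComponent, conjSubmodule_exceptEigenspace]
  congr 1
  simp [map_ofNat]

/-- The component of degree `-1` of the universal CR algebra is the eigenspace of eigenvalue `i`. -/
theorem uComponent_neg_one : uComponent 𝔍 (-1) = adEigenspace 𝔍 (-1) Complex.I := by
  apply le_antisymm
  · rw [uComponent]
    refine iSup₂_le fun ν hν x hx => ?_
    by_cases h : ν = Complex.I
    · rwa [h] at hx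
    · have hx' := mem_adEigenspace.1 hx
      have h1 := aeval_stringPoly_eq_zero hr hJ 1 x (by simpa using hx'.1)
      rw [Module.End.aeval_apply_of_mem_apply_eq_smul hx'.2, smul_eq_zero] at h1
      rcases h1 with h1 | rfl
      · simp only [stringPoly, Finset.prod_range_succ, Finset.prod_range_zero,
          Polynomial.eval_mul, Polynomial.eval_sub, Polynomial.eval_X, Polynomial.eval_C] at h1
        norm_num [sub_eq_zero] at h1
        rcases h1 with h1 | h1
        · exact absurd h1 h
        · refine absurd ?_ hν
          rw [eq_neg_of_add_eq_zero_left h1]; push_cast; ring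
      · exact zero_mem _
  · intro x hx
    refine mem_exceptEigenspace_of_ne (fun h => ?_) hx
    have h2 := congrArg Complex.im h
    norm_num at h2

theorem cgrade_neg_one_le :
    cgrade (-1) ≤ uComponent 𝔍 (-1) ⊔ conjSubmodule (uComponent 𝔍 (-1)) := by
  refine (cgrade_le_iSup_adEigenspace hr hJ (by norm_num)).trans (iSup_le fun ν => ?_)
  by_cases h : ν = -(((-1 : ℤ) : ℂ) + 2) * Complex.I
  · refine le_sup_of_le_right ?_
    rw [conjSubmodule_uComponent]
    refine fun x hx => mem_exceptEigenspace_of_ne (fun h' => ?_) hx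
    rw [h] at h'
    have h2 := congrArg Complex.im h'
    norm_num at h2
  · refine le_sup_of_le_left fun x hx => mem_exceptEigenspace_of_ne (fun h' => h ?_) hx
    rw [h']; ring

/-- The universal CR algebra is the prolongation of its component of degree `-1`. -/
theorem mem_uComponent_iff {p : ℤ} (hp : -1 ≤ p) {x : ℂ ⊗[ℝ] contactAlgebra r}
    (hx : x ∈ cgrade p) :
    x ∈ uComponent 𝔍 p ↔ ∀ w ∈ uComponent 𝔍 (-1), ⁅w, x⁆ ∈ uComponent 𝔍 (p - 1) := by
  obtain ⟨pr, hpr⟩ := exists_eigenspace_components (𝔍 := 𝔍)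
  have hle : ∀ ν, adEigenspace 𝔍 p ν ≤ Module.End.eigenspace (adJ 𝔍) ν := fun ν => inf_le_right
  have hx' := cgrade_le_iSup_adEigenspace hr hJ (by omega) hx
  set μ : ℂ := -(((p : ℂ) + 2) * Complex.I) with hμ
  have hμ' : -((((p - 1 : ℤ) : ℂ) + 2) * Complex.I) = Complex.I + μ := by
    rw [hμ]; push_cast; ring
  have hw' (w) (hw : w ∈ uComponent 𝔍 (-1)) : w ∈ adEigenspace 𝔍 (-1) Complex.I := by
    rwa [uComponent_neg_one hr hJ] at hw
  have hwx (w) (hw : w ∈ uComponent 𝔍 (-1)) : ⁅w, x⁆ ∈ cgrade (p - 1) := by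
    convert lie_mem_cgrade (hw' w hw).1 hx using 2; ring
  -- bracketing with an eigenvector shifts the components
  have hshift (w) (hw : w ∈ uComponent 𝔍 (-1)) : pr (Complex.I + μ) ⁅w, x⁆ = ⁅w, pr μ x⁆ := by
    refine Submodule.iSup_induction (adEigenspace 𝔍 p)
      (motive := fun x => pr (Complex.I + μ) ⁅w, x⁆ = ⁅w, pr μ x⁆) hx' (fun ν y hy => ?_) ?_ ?_
    · have h := lie_mem_adEigenspace (hw' w hw) hy
      by_cases hν : ν = μ
      · rw [hν] at hy h
        rw [hpr.self μ y hy.2, hpr.self _ _ h.2]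
      · rw [hpr.other μ ν (Ne.symm hν) y hy.2, clie_zero]
        exact hpr.other _ _ (fun h => hν (add_left_cancel h).symm) _ h.2
    · rw [clie_zero, map_zero, map_zero, clie_zero]
    · intro y z hy hz
      rw [clie_add, map_add, map_add, clie_add, hy, hz]
  have hmem : pr μ x ∈ adEigenspace 𝔍 p μ := hpr.mem_of_mem_iSup hle hx' μ
  rw [uComponent, mem_exceptEigenspace_iff hr hJ hpr (by omega) hx, ← hμ]
  constructor
  · intro h w hw
    rw [uComponent, mem_exceptEigenspace_iff hr hJ hpr (by omega) (hwx w hw), hμ', hshift w hw, h,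
      clie_zero]
  · intro h
    refine eq_zero_of_lie_cgrade_neg_one_eq_zero hr (p := p) (by omega) hmem.1 fun y hy => ?_
    obtain ⟨w, hw, w', hw2, rfl⟩ := Submodule.mem_sup.1 (cgrade_neg_one_le hr hJ hy)
    rw [cadd_lie]
    have h1 : ⁅w, pr μ x⁆ = 0 := by
      rw [← hshift w hw, ← hμ', ← mem_exceptEigenspace_iff hr hJ hpr (by omega) (hwx w hw)]
      exact h w hw
    have h2 : ⁅w', pr μ x⁆ = 0 := by
      have h3 := lie_mem_adEigenspace (conj_mem_adEigenspace (hw' _ (mem_conjSubmodule.1 hw2))) hmem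
      have h4 : starRingEnd ℂ Complex.I + μ = ((-p - 3 : ℤ) : ℂ) * Complex.I := by
        rw [hμ, Complex.conj_I]; push_cast; ring
      rw [conj_conj, h4, adEigenspace_eq_bot hr hJ (by omega) (by omega), Submodule.mem_bot] at h3
      exact h3
    rw [h1, h2, add_zero]

end Contact

/-! ### Graded subalgebras with a compatible CR structure -/

section GradedCR

variable {r : ℕ}

/-- The complexification of the sum of the components of degree at least `i` of `s`. -/
def level (s : LieSubalgebra ℝ (contactAlgebra r)) (i : ℤ) :
    Submodule ℂ (ℂ ⊗[ℝ] contactAlgebra r) := ⨆ p : ℤ, ⨆ (_ : i ≤ p), ccomponent s p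

/-- A graded subalgebra `s` of the contact algebra with a complex subalgebra `Q 0` of its
complexification, of which `Q m` is the Freeman sequence: `Q (m + 1)` is the left kernel of the bracket
of `Q m` and the conjugate of `Q 0`, modulo their sum. The sequence stabilizes at the isotropy exactly
in step `k`. -/
structure IsFreemanSequence (𝔍 : contactAlgebra r) (s : LieSubalgebra ℝ (contactAlgebra r)) (k : ℕ)
    (Q : ℕ → Submodule ℂ (ℂ ⊗[ℝ] contactAlgebra r)) : Prop where
  graded : s.toSubmodule = ⨆ p : ℤ, s.toSubmodule ⊓ grade p
  neg : ∀ p < 0, grade p ≤ s.toSubmodule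
  lie_mem : ∀ a ∈ Q 0, ∀ b ∈ Q 0, ⁅a, b⁆ ∈ Q 0
  sup_conj : Q 0 ⊔ conjSubmodule (Q 0) = level s (-1)
  mem_succ : ∀ m x, x ∈ Q (m + 1) ↔
    x ∈ Q m ∧ ∀ y ∈ conjSubmodule (Q 0), ⁅x, y⁆ ∈ Q m ⊔ conjSubmodule (Q 0)
  le_conj : Q k ≤ conjSubmodule (Q 0)
  not_le_conj : ∀ m < k, ¬ Q m ≤ conjSubmodule (Q 0)
  aligned : uComponent 𝔍 (-1) ≤ Q 0

theorem mem_ccomponent {s : LieSubalgebra ℝ (contactAlgebra r)} {p : ℤ}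
    {x : ℂ ⊗[ℝ] contactAlgebra r} :
    x ∈ ccomponent s p ↔ x ∈ s.toSubmodule.baseChange ℂ ∧ x ∈ cgrade p := by
  simp only [ccomponent, cgrade, mem_baseChange, Submodule.mem_inf]
  tauto

theorem ccomponent_le_cgrade (s : LieSubalgebra ℝ (contactAlgebra r)) (p : ℤ) :
    ccomponent s p ≤ cgrade p := fun _ hx => (mem_ccomponent.1 hx).2

theorem conj_mem_ccomponent {s : LieSubalgebra ℝ (contactAlgebra r)} {p : ℤ}
    {x : ℂ ⊗[ℝ] contactAlgebra r} : conj x ∈ ccomponent s p ↔ x ∈ ccomponent s p :=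
  conj_mem_baseChange

theorem lie_mem_ccomponent {s : LieSubalgebra ℝ (contactAlgebra r)} {p q : ℤ}
    {x y : ℂ ⊗[ℝ] contactAlgebra r} (hx : x ∈ ccomponent s p) (hy : y ∈ ccomponent s q) :
    ⁅x, y⁆ ∈ ccomponent s (p + q) := by
  rw [mem_ccomponent] at *
  refine ⟨?_, lie_mem_cgrade hx.2 hy.2⟩
  have h1 := mem_baseChange.1 hx.1
  have h2 := mem_baseChange.1 hy.1
  rw [mem_baseChange, cre_lie, cim_lie]
  exact ⟨sub_mem (s.lie_mem h1.1 h2.1) (s.lie_mem h1.2 h2.2),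
    add_mem (s.lie_mem h1.1 h2.2) (s.lie_mem h1.2 h2.1)⟩

theorem ccomponent_le_level {s : LieSubalgebra ℝ (contactAlgebra r)} {i p : ℤ} (h : i ≤ p) :
    ccomponent s p ≤ level s i := le_iSup₂_of_le p h le_rfl

theorem level_mono {s : LieSubalgebra ℝ (contactAlgebra r)} {i j : ℤ} (h : i ≤ j) :
    level s j ≤ level s i := iSup₂_le fun _ hp => ccomponent_le_level (h.trans hp)

theorem level_le_iSup_cgrade (s : LieSubalgebra ℝ (contactAlgebra r)) (i : ℤ) :
    level s i ≤ iSup cgrade :=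
  iSup₂_le fun p _ => (ccomponent_le_cgrade s p).trans (le_iSup cgrade p)

theorem lie_mem_level {s : LieSubalgebra ℝ (contactAlgebra r)} {i j : ℤ}
    {x y : ℂ ⊗[ℝ] contactAlgebra r} (hx : x ∈ level s i) (hy : y ∈ level s j) :
    ⁅x, y⁆ ∈ level s (i + j) := by
  induction hx using Submodule.iSup_induction' with
  | mem p x hx =>
    induction hx using Submodule.iSup_induction' with
    | mem hp x hx =>
      induction hy using Submodule.iSup_induction' with
      | mem q y hy =>
        induction hy using Submodule.iSup_induction' with
        | mem hq y hy => exact ccomponent_le_level (by omega) (lie_mem_ccomponent hx hy)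
        | zero => rw [clie_zero]; exact zero_mem _
        | add y z _ _ hy hz => rw [clie_add]; exact add_mem hy hz
      | zero => rw [clie_zero]; exact zero_mem _
      | add y z _ _ hy hz => rw [clie_add]; exact add_mem hy hz
    | zero => rw [czero_lie]; exact zero_mem _
    | add y z _ _ hy hz => rw [cadd_lie]; exact add_mem hy hz
  | zero => rw [czero_lie]; exact zero_mem _
  | add y z _ _ hy hz => rw [cadd_lie]; exact add_mem hy hz

section Components

variable {pr : ℤ → Module.End ℂ (ℂ ⊗[ℝ] contactAlgebra r)} (hpr : IsComponents cgrade pr)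
include hpr

theorem component_conj (j : ℤ) {x : ℂ ⊗[ℝ] contactAlgebra r} (hx : x ∈ iSup (cgrade (r := r))) :
    pr j (conj x) = conj (pr j x) := by
  refine Submodule.iSup_induction cgrade (motive := fun x => pr j (conj x) = conj (pr j x)) hx
    (fun p y hy => ?_) (by simp) (fun y z hy hz => by simp only [map_add, hy, hz])
  by_cases h : j = p
  · subst h
    rw [hpr.self j y hy, hpr.self j _ (conj_mem_cgrade.2 hy)]
  · rw [hpr.other j p h y hy, hpr.other j p h _ (conj_mem_cgrade.2 hy), map_zero]

theorem component_lie {i : ℤ} {y : ℂ ⊗[ℝ] contactAlgebra r} (hy : y ∈ cgrade i) (j : ℤ)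
    {x : ℂ ⊗[ℝ] contactAlgebra r} (hx : x ∈ iSup (cgrade (r := r))) :
    pr (i + j) ⁅y, x⁆ = ⁅y, pr j x⁆ := by
  refine Submodule.iSup_induction cgrade (motive := fun x => pr (i + j) ⁅y, x⁆ = ⁅y, pr j x⁆) hx
    (fun p z hz => ?_) (by rw [clie_zero, map_zero, map_zero, clie_zero])
    (fun z w hz hw => by rw [clie_add, map_add, map_add, clie_add, hz, hw])
  have h := lie_mem_cgrade hy hz
  by_cases hj : j = p
  · subst hj
    rw [hpr.self j z hz, hpr.self _ _ h]
  · rw [hpr.other j p hj z hz, clie_zero]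
    exact hpr.other _ _ (fun h => hj (add_left_cancel h)) _ h

theorem component_mem_of_mem_level {s : LieSubalgebra ℝ (contactAlgebra r)} {i : ℤ}
    {x : ℂ ⊗[ℝ] contactAlgebra r} (hx : x ∈ level s i) (j : ℤ) : pr j x ∈ ccomponent s j := by
  have := hpr.mem_of_mem_iSup (P := fun p => ⨆ (_ : i ≤ p), ccomponent s p)
    (fun p => iSup_le fun _ => ccomponent_le_cgrade s p) hx j
  exact (iSup_le fun _ => le_rfl : (⨆ (_ : i ≤ j), ccomponent s j) ≤ _) this

theorem component_eq_zero_of_mem_level {s : LieSubalgebra ℝ (contactAlgebra r)} {i : ℤ}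
    {x : ℂ ⊗[ℝ] contactAlgebra r} (hx : x ∈ level s i) {j : ℤ} (hj : j < i) : pr j x = 0 := by
  have := hpr.mem_of_mem_iSup (P := fun p => ⨆ (_ : i ≤ p), ccomponent s p)
    (fun p => iSup_le fun _ => ccomponent_le_cgrade s p) hx j
  simpa [not_le.2 hj] using this

end Components

namespace IsFreemanSequence

variable {𝔍 : contactAlgebra r} {s : LieSubalgebra ℝ (contactAlgebra r)} {k : ℕ}
  {Q : ℕ → Submodule ℂ (ℂ ⊗[ℝ] contactAlgebra r)} (H : IsFreemanSequence 𝔍 s k Q)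
include H

theorem succ_le (m : ℕ) : Q (m + 1) ≤ Q m := fun x hx => ((H.mem_succ m x).1 hx).1

theorem antitone : Antitone Q := antitone_nat_of_succ_le H.succ_le

theorem zero_le_level : Q 0 ≤ level s (-1) := le_sup_left.trans H.sup_conj.le

theorem conj_zero_le_level : conjSubmodule (Q 0) ≤ level s (-1) := le_sup_right.trans H.sup_conj.le

theorem le_iSup_cgrade (m : ℕ) : Q m ≤ iSup cgrade :=
  (H.antitone (Nat.zero_le m)).trans (H.zero_le_level.trans (level_le_iSup_cgrade s _))

theorem conj_lie_mem_sup {m : ℕ} {y : ℂ ⊗[ℝ] contactAlgebra r} (hy : y ∈ conjSubmodule (Q (m + 1)))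
    {x : ℂ ⊗[ℝ] contactAlgebra r} (hx : x ∈ Q 0) : ⁅y, x⁆ ∈ conjSubmodule (Q m) ⊔ Q 0 := by
  have h := ((H.mem_succ m _).1 (mem_conjSubmodule.1 hy)).2 (conj x) (conj_mem_conjSubmodule.2 hx)
  rw [← conj_lie, ← mem_conjSubmodule, conjSubmodule_sup, conjSubmodule_conjSubmodule] at h
  exact h

theorem mem_conj_succ {m : ℕ} {y : ℂ ⊗[ℝ] contactAlgebra r} (hy : y ∈ conjSubmodule (Q m))
    (h : ∀ x ∈ Q 0, ⁅y, x⁆ ∈ conjSubmodule (Q m) ⊔ Q 0) : y ∈ conjSubmodule (Q (m + 1)) := by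
  rw [mem_conjSubmodule, H.mem_succ]
  refine ⟨mem_conjSubmodule.1 hy, fun x hx => ?_⟩
  have := h _ (mem_conjSubmodule.1 hx)
  rw [← conjSubmodule_conjSubmodule (Q 0), ← conjSubmodule_sup, mem_conjSubmodule, conj_lie,
    conj_conj] at this
  exact this

/-- The kernel `Q 1` of the Levi form preserves the conjugate Freeman sequence modulo `Q 0`. -/
theorem lie_one_conj_mem {a : ℂ ⊗[ℝ] contactAlgebra r} (ha : a ∈ Q 1) (m : ℕ) :
    ∀ b ∈ conjSubmodule (Q m), ⁅a, b⁆ ∈ conjSubmodule (Q m) ⊔ Q 0 := by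
  have ha0 : a ∈ Q 0 := H.succ_le 0 ha
  induction m with
  | zero =>
    intro b hb
    rw [sup_comm]
    exact ((H.mem_succ 0 a).1 ha).2 b hb
  | succ m ih =>
    intro b hb
    have hbm : b ∈ conjSubmodule (Q m) := conjSubmodule_mono (H.succ_le m) hb
    obtain ⟨c, hc, d, hd, hcd⟩ := Submodule.mem_sup.1 (ih b hbm)
    rw [← hcd]
    refine add_mem (Submodule.mem_sup_left ?_) (Submodule.mem_sup_right hd)
    refine H.mem_conj_succ hc fun x hx => ?_
    have e : ⁅c, x⁆ = ⁅a, ⁅b, x⁆⁆ - ⁅b, ⁅a, x⁆⁆ - ⁅d, x⁆ := by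
      rw [cleibniz_lie a b x, ← hcd, cadd_lie]; abel
    rw [e]
    refine sub_mem (sub_mem ?_ (H.conj_lie_mem_sup hb (H.lie_mem a ha0 x hx)))
      (Submodule.mem_sup_right (H.lie_mem d hd x hx))
    obtain ⟨u, hu, v, hv, huv⟩ := Submodule.mem_sup.1 (H.conj_lie_mem_sup hb hx)
    rw [← huv, clie_add]
    exact add_mem (ih u hu) (Submodule.mem_sup_right (H.lie_mem a ha0 v hv))

variable (hr : 0 < r) (hJ : IsComplexStructure 𝔍)
include hr hJ

section

variable {pr : ℤ → Module.End ℂ (ℂ ⊗[ℝ] contactAlgebra r)} (hpr : IsComponents cgrade pr)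
include hpr

/-- The components of an element of `Q 0` lie in the universal CR algebra, because iterated brackets
with elements of degree `-1` of `Q 0` never reach degree `-2`. -/
theorem component_mem_uComponent (n : ℕ) :
    ∀ x ∈ Q 0, pr ((n : ℤ) - 2) x ∈ uComponent 𝔍 ((n : ℤ) - 2) := by
  induction n with
  | zero =>
    intro x hx
    rw [component_eq_zero_of_mem_level hpr (H.zero_le_level hx) (by norm_num)]
    exact zero_mem _
  | succ n ih =>
    intro x hx
    rw [mem_uComponent_iff hr hJ (by push_cast; omega) (hpr.mem _ _)]
    intro w hw
    have h := ih _ (H.lie_mem w (H.aligned hw) x hx)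
    rw [show (n : ℤ) - 2 = -1 + ((n + 1 : ℕ) - 2) by push_cast; ring,
      component_lie hpr (exceptEigenspace_le _ _ hw) _ (H.le_iSup_cgrade 0 hx)] at h
    convert h using 2
    push_cast; ring

theorem component_mem_uComponent' {j : ℤ} (hj : -2 ≤ j) {x : ℂ ⊗[ℝ] contactAlgebra r}
    (hx : x ∈ Q 0) : pr j x ∈ uComponent 𝔍 j := by
  have := H.component_mem_uComponent hr hJ hpr (j + 2).toNat x hx
  rwa [show (((j + 2).toNat : ℕ) : ℤ) - 2 = j by omega] at this

theorem component_mem_conj_uComponent {j : ℤ} (hj : -2 ≤ j) {x : ℂ ⊗[ℝ] contactAlgebra r}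
    (hx : x ∈ conjSubmodule (Q 0)) : pr j x ∈ conjSubmodule (uComponent 𝔍 j) := by
  have := H.component_mem_uComponent' hr hJ hpr hj (mem_conjSubmodule.1 hx)
  rw [component_conj hpr j
    (level_le_iSup_cgrade s _ (H.conj_zero_le_level hx))] at this
  exact mem_conjSubmodule.2 this

/-- Finite nondegeneracy: an element of `level s (-1)` belongs to `Q 0` as soon as its brackets with
the elements of degree `-1` of `Q 0` do. -/
theorem mem_zero_of_lie_mem {x : ℂ ⊗[ℝ] contactAlgebra r} (hx : x ∈ level s (-1))
    (h : ∀ w ∈ uComponent 𝔍 (-1), ⁅w, x⁆ ∈ Q 0) : x ∈ Q 0 := by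
  -- `x` belongs to all terms of the conjugate Freeman sequence modulo `Q 0`
  have key (m : ℕ) : x ∈ conjSubmodule (Q m) ⊔ Q 0 := by
    induction m with
    | zero => rw [sup_comm, H.sup_conj]; exact hx
    | succ m ih =>
      obtain ⟨y, hy, z, hz, rfl⟩ := Submodule.mem_sup.1 ih
      refine add_mem (Submodule.mem_sup_left (H.mem_conj_succ hy fun η hη => ?_))
        (Submodule.mem_sup_right hz)
      have hη1 := H.component_mem_uComponent' hr hJ hpr (j := -1) (by norm_num) hη
      set η1 := pr (-1) η
      have hη0 : η - η1 ∈ Q 0 := sub_mem hη (H.aligned hη1)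
      have hlev : η - η1 ∈ level s 0 := by
        have h1 := H.zero_le_level hη0
        refine hpr.mem_of_forall (level_le_iSup_cgrade s _ h1) fun j => ?_
        rcases lt_trichotomy j (-1) with hj | rfl | hj
        · rw [component_eq_zero_of_mem_level hpr h1 hj]; exact zero_mem _
        · rw [map_sub, hpr.self (-1) η1 (hpr.mem _ _), sub_self]; exact zero_mem _
        · exact ccomponent_le_level (by omega) (component_mem_of_mem_level hpr h1 j)
      have hone : η - η1 ∈ Q 1 := by
        refine (H.mem_succ 0 _).2 ⟨hη0, fun b hb => ?_⟩
        rw [H.sup_conj]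
        simpa using lie_mem_level hlev (H.conj_zero_le_level hb)
      have e : ⁅y, η⁆ = -⁅η1, y + z⁆ + ⁅η1, z⁆ - ⁅η - η1, y⁆ := by
        rw [clie_add, csub_lie, ← clie_skew y η]; abel
      rw [e]
      refine sub_mem (add_mem (neg_mem ?_) ?_) (H.lie_one_conj_mem hone m y hy)
      · exact Submodule.mem_sup_right (h η1 hη1)
      · exact Submodule.mem_sup_right (H.lie_mem η1 (H.aligned hη1) z hz)
  have h1 := key k
  have h2 : conjSubmodule (Q k) ≤ Q 0 := by
    have := conjSubmodule_mono H.le_conj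
    rwa [conjSubmodule_conjSubmodule] at this
  exact (sup_le h2 le_rfl) h1

end

/-- The homogeneous elements of `s` in the universal CR algebra belong to `Q 0`. -/
theorem ccomponent_inf_uComponent_le {p : ℤ} (hp : -1 ≤ p) :
    ccomponent s p ⊓ uComponent 𝔍 p ≤ Q 0 := by
  obtain ⟨pr, hpr⟩ := exists_isComponents (iSupIndep_cgrade (r := r))
  obtain ⟨n, rfl⟩ : ∃ n : ℕ, p = n - 1 := ⟨(p + 1).toNat, by omega⟩
  induction n with
  | zero => exact fun x hx => H.aligned (by simpa using hx.2)
  | succ n ih =>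
    intro x hx'
    obtain ⟨hx, hxu⟩ := Submodule.mem_inf.1 hx'
    refine H.mem_zero_of_lie_mem hr hJ hpr (ccomponent_le_level hp hx) fun w hw =>
      ih (by omega) (Submodule.mem_inf.2 ⟨?_, ?_⟩)
    · have hw' : w ∈ ccomponent s (-1) := by
        have := component_mem_of_mem_level hpr (H.zero_le_level (H.aligned hw)) (-1)
        rwa [hpr.self _ _ (exceptEigenspace_le _ _ hw)] at this
      convert lie_mem_ccomponent hw' hx using 2; push_cast; ring
    · have := (mem_uComponent_iff hr hJ hp (ccomponent_le_cgrade s _ hx)).1 hxu w hw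
      convert this using 2; push_cast; ring

theorem ccomponent_inf_conj_le {p : ℤ} (hp : -1 ≤ p) :
    ccomponent s p ⊓ conjSubmodule (uComponent 𝔍 p) ≤ conjSubmodule (Q 0) := fun _ hx =>
  mem_conjSubmodule.2 (H.ccomponent_inf_uComponent_le hr hJ hp
    ⟨conj_mem_ccomponent.2 hx.1, mem_conjSubmodule.1 hx.2⟩)

section

variable {pr : ℤ → Module.End ℂ (ℂ ⊗[ℝ] contactAlgebra r)} (hpr : IsComponents cgrade pr)
include hpr

theorem component_mem_zero (j : ℤ) {x : ℂ ⊗[ℝ] contactAlgebra r} (hx : x ∈ Q 0) :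
    pr j x ∈ Q 0 := by
  have h1 := H.zero_le_level hx
  rcases lt_or_ge j (-1) with hj | hj
  · rw [component_eq_zero_of_mem_level hpr h1 hj]; exact zero_mem _
  · exact H.ccomponent_inf_uComponent_le hr hJ hj ⟨component_mem_of_mem_level hpr h1 j,
      H.component_mem_uComponent' hr hJ hpr (by omega) hx⟩

theorem component_mem_conj_zero (j : ℤ) {x : ℂ ⊗[ℝ] contactAlgebra r}
    (hx : x ∈ conjSubmodule (Q 0)) : pr j x ∈ conjSubmodule (Q 0) := by
  have := H.component_mem_zero hr hJ hpr j (mem_conjSubmodule.1 hx)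
  rw [component_conj hpr j (level_le_iSup_cgrade s _ (H.conj_zero_le_level hx))] at this
  exact mem_conjSubmodule.2 this

/-- The components of low degree of an element of the Freeman sequence are isotropic. -/
theorem component_mem_conj_of_mem (n : ℕ) : ∀ m, n ≤ m → ∀ x ∈ Q m,
    pr ((n : ℤ) - 2) x ∈ conjSubmodule (uComponent 𝔍 ((n : ℤ) - 2)) := by
  induction n with
  | zero =>
    intro m _ x hx
    rw [component_eq_zero_of_mem_level hpr (H.zero_le_level (H.antitone (Nat.zero_le m) hx))
      (by norm_num)]
    exact zero_mem _
  | succ n ih =>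
    intro m hm x hx
    obtain ⟨m, rfl⟩ : ∃ m', m = m' + 1 := ⟨m - 1, by omega⟩
    have hxs := H.le_iSup_cgrade _ hx
    rw [mem_conjSubmodule, mem_uComponent_iff hr hJ (by push_cast; omega)
      (conj_mem_cgrade.2 (hpr.mem _ _))]
    intro w hw
    have hcw : conj w ∈ conjSubmodule (Q 0) := conj_mem_conjSubmodule.2 (H.aligned hw)
    have h : ⁅conj w, x⁆ ∈ Q m ⊔ conjSubmodule (Q 0) := by
      rw [← clie_skew]
      exact neg_mem (((H.mem_succ m x).1 hx).2 _ hcw)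
    have h2 : pr ((n : ℤ) - 2) ⁅conj w, x⁆ ∈ conjSubmodule (uComponent 𝔍 ((n : ℤ) - 2)) := by
      obtain ⟨a, ha, b, hb, hab⟩ := Submodule.mem_sup.1 h
      rw [← hab, map_add]
      exact add_mem (ih m (by omega) a ha)
        (H.component_mem_conj_uComponent hr hJ hpr (by omega) hb)
    rw [show (n : ℤ) - 2 = -1 + ((n + 1 : ℕ) - 2) by push_cast; ring,
      component_lie hpr (conj_mem_cgrade.2 (exceptEigenspace_le _ _ hw)) _ hxs,
      mem_conjSubmodule, conj_lie, conj_conj] at h2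
    convert h2 using 2
    push_cast; ring

/-- The homogeneous elements of degree at least `m - 1` of `Q 0` belong to the `m`-th term, since
bracketing with the conjugate of `Q 0` lowers degrees at most by one. -/
theorem zero_inf_level_le (m : ℕ) : Q 0 ⊓ level s ((m : ℤ) - 1) ≤ Q m := by
  induction m with
  | zero => exact inf_le_left
  | succ m ih =>
    rintro x ⟨hx, hxl⟩
    refine (H.mem_succ m x).2 ⟨ih ⟨hx, level_mono (by push_cast; omega) hxl⟩, fun y hy => ?_⟩
    have h : ⁅x, y⁆ ∈ level s ((m : ℤ) - 1) := by
      convert lie_mem_level hxl (H.conj_zero_le_level hy) using 2; push_cast; ring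
    refine hpr.mem_of_forall (level_le_iSup_cgrade s _ h) fun j => ?_
    rcases lt_or_ge j ((m : ℤ) - 1) with hj | hj
    · rw [component_eq_zero_of_mem_level hpr h hj]; exact zero_mem _
    · have h' := level_mono (by omega : (-1 : ℤ) ≤ (m : ℤ) - 1) h
      rw [← H.sup_conj] at h'
      obtain ⟨a, ha, b, hb, hab⟩ := Submodule.mem_sup.1 h'
      rw [← hab, map_add]
      refine add_mem (Submodule.mem_sup_left (ih ⟨H.component_mem_zero hr hJ hpr j ha, ?_⟩))
        (Submodule.mem_sup_right (H.component_mem_conj_zero hr hJ hpr j hb))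
      exact ccomponent_le_level hj (component_mem_of_mem_level hpr (H.zero_le_level ha) j)

end

theorem isGradedCRSubalgebra : IsGradedCRSubalgebra 𝔍 s (Q 0) := by
  obtain ⟨pr, hpr⟩ := exists_isComponents (iSupIndep_cgrade (r := r))
  have hs : s.toSubmodule.baseChange ℂ ≤ ⨆ p, ccomponent s p := by
    intro x hx
    have hreal (v) (hv : v ∈ s.toSubmodule) (c : ℂ) : c ⊗ₜ[ℝ] v ∈ ⨆ p, ccomponent s p := by
      rw [H.graded] at hv
      refine Submodule.iSup_induction (fun p : ℤ => s.toSubmodule ⊓ grade p)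
        (motive := fun v => c ⊗ₜ[ℝ] v ∈ ⨆ p, ccomponent s p) hv (fun p v hv => ?_) ?_ ?_
      · exact Submodule.mem_iSup_of_mem p (Submodule.tmul_mem_baseChange_of_mem c hv)
      · rw [TensorProduct.tmul_zero]; exact zero_mem _
      · intro a b ha hb
        rw [TensorProduct.tmul_add]; exact add_mem ha hb
    rw [mem_baseChange] at hx
    rw [← tmul_cre_add_tmul_cim x]
    exact add_mem (hreal _ hx.1 _) (hreal _ hx.2 _)
  refine ⟨H.graded, H.lie_mem, le_antisymm ?_ (iSup_le fun p => inf_le_left),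
    le_antisymm (le_inf ?_ ?_) ?_⟩
  · intro x hx
    refine hpr.mem_of_forall (H.le_iSup_cgrade 0 hx) fun j => ?_
    exact Submodule.mem_iSup_of_mem j ⟨H.component_mem_zero hr hJ hpr j hx, hpr.mem j x⟩
  · exact H.zero_le_level.trans
      (iSup₂_le fun p _ y hy => (mem_ccomponent.1 hy).1 : level s (-1) ≤ _)
  · intro x hx
    refine hpr.mem_of_forall (H.le_iSup_cgrade 0 hx) fun j => ?_
    rcases lt_or_ge j (-1) with hj | hj
    · rw [component_eq_zero_of_mem_level hpr (H.zero_le_level hx) hj]; exact zero_mem _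
    · exact Submodule.mem_iSup_of_mem j (Submodule.mem_iSup_of_mem hj
        (H.component_mem_uComponent' hr hJ hpr (by omega) hx))
  · rintro x ⟨hx, hxu⟩
    have hx' := hs hx
    refine hpr.mem_of_forall (iSup_mono (ccomponent_le_cgrade s) hx') fun j => ?_
    have h1 := hpr.mem_of_mem_iSup (ccomponent_le_cgrade s) hx' j
    have h2 := hpr.mem_of_mem_iSup (P := fun p => ⨆ (_ : -1 ≤ p), uComponent 𝔍 p)
      (fun p => iSup_le fun _ => exceptEigenspace_le _ _) hxu j
    rcases lt_or_ge j (-1) with hj | hj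
    · simp only [not_le.2 hj, iSup_false, Submodule.mem_bot] at h2
      rw [h2]; exact zero_mem _
    · exact H.ccomponent_inf_uComponent_le hr hJ hj
        ⟨h1, (iSup_le fun _ => le_rfl : (⨆ (_ : -1 ≤ j), uComponent 𝔍 j) ≤ _) h2⟩

/-- If the component of degree `p` has no part of maximal eigenvalue, then the Freeman sequence has
reached the isotropy after `p + 1` steps. -/
theorem le_conj_of_ccomponent_le {p : ℤ} (hp : -1 ≤ p)
    (h : ccomponent s p ≤ conjSubmodule (uComponent 𝔍 p)) {m : ℕ} (hm : (m : ℤ) = p + 1) :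
    Q m ≤ conjSubmodule (Q 0) := by
  obtain ⟨pr, hpr⟩ := exists_isComponents (iSupIndep_cgrade (r := r))
  have h' : ccomponent s p ≤ uComponent 𝔍 p := fun x hx => by
    have := h (conj_mem_ccomponent.2 hx)
    rwa [conj_mem_conjSubmodule] at this
  have hw' (w) (hw : w ∈ uComponent 𝔍 (-1)) : w ∈ ccomponent s (-1) := by
    have := component_mem_of_mem_level hpr (H.zero_le_level (H.aligned hw)) (-1)
    rwa [hpr.self _ _ (exceptEigenspace_le _ _ hw)] at this
  have hup (n : ℕ) : ccomponent s (p + n) ≤ Q 0 := by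
    induction n with
    | zero =>
      intro x hx
      have hx' : x ∈ ccomponent s p := by simpa using hx
      exact H.ccomponent_inf_uComponent_le hr hJ hp ⟨hx', h' hx'⟩
    | succ n ih =>
      intro x hx
      refine H.mem_zero_of_lie_mem hr hJ hpr (ccomponent_le_level (by push_cast; omega) hx)
        fun w hw => ih ?_
      convert lie_mem_ccomponent (hw' w hw) hx using 2; push_cast; ring
  intro x hx
  have hxl := H.zero_le_level (H.antitone (Nat.zero_le m) hx)
  refine hpr.mem_of_forall (level_le_iSup_cgrade s _ hxl) fun j => ?_
  have hj' := component_mem_of_mem_level hpr hxl j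
  rcases lt_or_ge j (-1) with hj | hj
  · rw [component_eq_zero_of_mem_level hpr hxl hj]; exact zero_mem _
  rcases lt_or_ge j p with hjp | hjp
  · refine H.ccomponent_inf_conj_le hr hJ hj ⟨hj', ?_⟩
    have := H.component_mem_conj_of_mem hr hJ hpr (j + 2).toNat m (by omega) x hx
    rwa [show (((j + 2).toNat : ℕ) : ℤ) - 2 = j by omega] at this
  · refine mem_conjSubmodule.2 (hup (j - p).toNat ?_)
    rw [show p + ((j - p).toNat : ℤ) = j by omega]
    exact conj_mem_ccomponent.2 hj'

set_option maxHeartbeats 1600000 in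
/-- Adjoining the grading element to `s` gives a `k`-nondegenerate model. -/
theorem exists_isModel (hk : 1 ≤ k) : ∃ a : LieSubalgebra ℝ (contactAlgebra r),
    a.toSubmodule = s.toSubmodule ⊔ Submodule.span ℝ {gradingElement r} ∧ IsModel k 𝔍 a := by
  obtain ⟨pr, hpr⟩ := exists_isComponents (iSupIndep_cgrade (r := r))
  set E := gradingElement r with hE
  have hEs (x) (hx : x ∈ s) : ⁅E, x⁆ ∈ s := by
    have hx' : x ∈ s.toSubmodule := hx
    rw [H.graded] at hx'
    refine Submodule.iSup_induction (fun p : ℤ => s.toSubmodule ⊓ grade p)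
      (motive := fun x => ⁅E, x⁆ ∈ s) hx' (fun p v hv => ?_) ?_ ?_
    · have := Module.End.mem_eigenspace_iff.1 hv.2
      rw [LieAlgebra.ad_apply] at this
      rw [this]; exact s.smul_mem _ hv.1
    · rw [lie_zero]; exact s.zero_mem
    · intro a b ha hb
      rw [lie_add]; exact s.add_mem ha hb
  let a : LieSubalgebra ℝ (contactAlgebra r) :=
    { s.toSubmodule ⊔ Submodule.span ℝ {E} with
      lie_mem' := by
        intro x y hx hy
        obtain ⟨u, hu, v, hv, rfl⟩ := Submodule.mem_sup.1 hx
        obtain ⟨u', hu', v', hv', rfl⟩ := Submodule.mem_sup.1 hy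
        obtain ⟨c, rfl⟩ := Submodule.mem_span_singleton.1 hv
        obtain ⟨c', rfl⟩ := Submodule.mem_span_singleton.1 hv'
        refine Submodule.mem_sup_left ?_
        have h1 : ⁅u, E⁆ ∈ s := by rw [← lie_skew]; exact s.neg_mem (hEs u hu)
        simp only [add_lie, lie_add, smul_lie, lie_smul, lie_self, smul_zero, add_zero]
        exact s.add_mem (s.add_mem (s.lie_mem hu hu') (s.smul_mem _ (hEs _ hu')))
          (s.smul_mem _ h1) }
  have ha : a.toSubmodule = s.toSubmodule ⊔ Submodule.span ℝ {E} := rfl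
  have hsa : s.toSubmodule ≤ a.toSubmodule := le_sup_left
  have hEa : E ∈ a.toSubmodule :=
    Submodule.mem_sup_right (Submodule.mem_span_singleton_self E)
  have hE0 : E ∈ grade (r := r) 0 := gradingElement_mem_grade
  have hJE : ⁅𝔍, E⁆ = 0 := by
    have := Module.End.mem_eigenspace_iff.1 hJ.mem_grade
    rw [LieAlgebra.ad_apply] at this
    rw [← lie_skew, this]; simp
  have hEeig : (1 : ℂ) ⊗ₜ[ℝ] E ∈ adEigenspace 𝔍 0 0 := by
    rw [mem_adEigenspace, cad_apply]
    refine ⟨Submodule.tmul_mem_baseChange_of_mem _ hE0, ?_⟩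
    rw [LieAlgebra.ExtendScalars.bracket_tmul, hJE]; simp
  -- the homogeneous elements of the extension
  have hreal (p) (x) (hx : x ∈ a.toSubmodule ⊓ grade p) :
      ∃ y ∈ s.toSubmodule ⊓ grade p, ∃ c : ℝ, x = y + c • E ∧ (p ≠ 0 → c = 0) := by
    obtain ⟨y, hy, v, hv, hyv⟩ := Submodule.mem_sup.1 hx.1
    obtain ⟨c, rfl⟩ := Submodule.mem_span_singleton.1 hv
    by_cases hp : p = 0
    · subst hp
      refine ⟨y, ⟨hy, ?_⟩, c, hyv.symm, fun h => absurd rfl h⟩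
      rw [← eq_sub_iff_add_eq] at hyv
      rw [hyv]; exact sub_mem hx.2 (Submodule.smul_mem _ _ hE0)
    · refine ⟨x, ⟨?_, hx.2⟩, 0, by simp, fun _ => rfl⟩
      have h1 := Module.End.mem_eigenspace_iff.1 hx.2
      rw [LieAlgebra.ad_apply, ← hyv, lie_add, lie_smul, lie_self, smul_zero, add_zero, hyv] at h1
      have h2 : x = (p : ℝ)⁻¹ • ⁅gradingElement r, y⁆ := by
        rw [h1, inv_smul_smul₀ (by exact_mod_cast hp)]
      rw [h2]
      exact s.smul_mem _ (hEs y hy)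
  have hcomp (p) (x) (hx : x ∈ ccomponent a p) : ∃ y ∈ ccomponent s p, ∃ c : ℂ,
      x = y + c • ((1 : ℂ) ⊗ₜ[ℝ] E) ∧ (p ≠ 0 → c = 0) := by
    rw [ccomponent, mem_baseChange] at hx
    obtain ⟨y, hy, c, h1, hc⟩ := hreal p _ hx.1
    obtain ⟨y', hy', c', h2, hc'⟩ := hreal p _ hx.2
    refine ⟨(1 : ℂ) ⊗ₜ[ℝ] y + Complex.I ⊗ₜ[ℝ] y', add_mem
      (Submodule.tmul_mem_baseChange_of_mem _ hy) (Submodule.tmul_mem_baseChange_of_mem _ hy'),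
      c + c' * Complex.I, ?_, fun hp => by rw [hc hp, hc' hp]; simp⟩
    apply complexification_ext
    · rw [h1]; simp [cre_smul]
    · rw [h2]; simp [cim_smul]
  have hsub (p) : ccomponent s p ≤ ccomponent a p := by
    intro x hx
    rw [mem_ccomponent, mem_baseChange] at *
    exact ⟨⟨hsa hx.1.1, hsa hx.1.2⟩, hx.2⟩
  have hEp (p : ℤ) (x y : ℂ ⊗[ℝ] contactAlgebra r) (c : ℂ) (h : x = y + c • ((1 : ℂ) ⊗ₜ[ℝ] E))
      (hc : p ≠ 0 → c = 0) (P : Submodule ℂ (ℂ ⊗[ℝ] contactAlgebra r)) (hy : y ∈ P)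
      (hP : p = 0 → (1 : ℂ) ⊗ₜ[ℝ] E ∈ P) : x ∈ P := by
    rw [h]
    by_cases hp : p = 0
    · exact add_mem hy (P.smul_mem _ (hP hp))
    · rw [hc hp, zero_smul, add_zero]; exact hy
  have hEccomp : (1 : ℂ) ⊗ₜ[ℝ] E ∈ ccomponent a 0 :=
    Submodule.tmul_mem_baseChange_of_mem _ ⟨hEa, hE0⟩
  -- the splitting of a homogeneous element
  have hsplit (p) (hp : -1 ≤ p) (y) (hy : y ∈ ccomponent s p) : ∃ u ∈ Q 0, ∃ v ∈ conjSubmodule (Q 0),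
      u ∈ ccomponent s p ⊓ uComponent 𝔍 p ∧
      v ∈ ccomponent s p ⊓ conjSubmodule (uComponent 𝔍 p) ∧ y = u + v := by
    have h := ccomponent_le_level hp hy
    rw [← H.sup_conj] at h
    obtain ⟨u, hu, v, hv, huv⟩ := Submodule.mem_sup.1 h
    refine ⟨pr p u, H.component_mem_zero hr hJ hpr p hu, pr p v,
      H.component_mem_conj_zero hr hJ hpr p hv,
      ⟨component_mem_of_mem_level hpr (H.zero_le_level hu) p,
        H.component_mem_uComponent' hr hJ hpr (by omega) hu⟩,
      ⟨component_mem_of_mem_level hpr (H.conj_zero_le_level hv) p,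
        H.component_mem_conj_uComponent hr hJ hpr (by omega) hv⟩, ?_⟩
    rw [← map_add, huv, hpr.self p y (ccomponent_le_cgrade s p hy)]
  refine ⟨a, ha, ?_, fun p hp => (H.neg p hp).trans hsa, hEa, fun p hp => ?_, fun p hp hpk => ?_,
    fun p hp => ?_⟩
  · refine le_antisymm ?_ (iSup_le fun p => inf_le_left)
    nth_rewrite 1 [ha]
    refine sup_le ?_ ?_
    · rw [H.graded]
      exact iSup_mono fun p => inf_le_inf_right _ hsa
    · rw [Submodule.span_singleton_le_iff_mem]
      exact Submodule.mem_iSup_of_mem 0 ⟨hEa, hE0⟩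
  · refine le_antisymm (fun x hx => ?_) (sup_le inf_le_left inf_le_left)
    obtain ⟨y, hy, c, hxy, hc⟩ := hcomp p x hx
    refine hEp p x y c hxy hc _ ?_ ?_
    · obtain ⟨u, -, v, -, hu, hv, rfl⟩ := hsplit p (by omega) y hy
      exact add_mem (Submodule.mem_sup_left ⟨hsub p hu.1, hu.2⟩)
        (Submodule.mem_sup_right ⟨hsub p hv.1, hv.2⟩)
    · rintro rfl
      refine Submodule.mem_sup_left ⟨hEccomp, mem_exceptEigenspace_of_ne (fun h => ?_) hEeig⟩
      have := congrArg Complex.im h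
      norm_num at this
  · intro h
    rcases hp.eq_or_lt with rfl | hp
    · have h0 : (((-2 : ℤ) : ℂ) + 2) * Complex.I = 0 := by norm_num
      rw [h0, exceptEigenspace_neg_two hJ] at h
      have hy : (1 : ℂ) ⊗ₜ[ℝ] yt r ∈ ccomponent a (-2) :=
        Submodule.tmul_mem_baseChange_of_mem _ ⟨hsa (H.neg _ (by norm_num) yt_mem), yt_mem⟩
      have := congrArg cre ((Submodule.mem_bot ℂ).1 (h hy))
      exact yt_ne_zero (by simpa using this)
    · rw [← conjSubmodule_uComponent] at h
      refine H.not_le_conj (p + 1).toNat (by omega) (H.le_conj_of_ccomponent_le hr hJ (p := p)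
        (by omega) ((hsub p).trans h) (by omega))
  · intro x hx
    rw [← conjSubmodule_uComponent]
    obtain ⟨y, hy, c, hxy, hc⟩ := hcomp p x hx
    refine hEp p x y c hxy hc _ ?_ ?_
    · obtain ⟨u, hu0, v, -, hu, hv, rfl⟩ := hsplit p (by omega) y hy
      refine add_mem ?_ hv.2
      have h1 : u ∈ Q (p + 1).toNat :=
        H.zero_inf_level_le hr hJ hpr _ ⟨hu0, ccomponent_le_level (by omega) hu.1⟩
      have h2 := H.component_mem_conj_uComponent hr hJ hpr (j := p) (by omega)
        (H.le_conj (H.antitone (by omega : k ≤ (p + 1).toNat) h1))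
      rwa [hpr.self p u (ccomponent_le_cgrade s p hu.1)] at h2
    · rintro rfl
      rw [conjSubmodule_uComponent]
      refine mem_exceptEigenspace_of_ne (fun h => ?_) hEeig
      have := congrArg Complex.im h
      norm_num at this

end IsFreemanSequence

end GradedCR

/-! ### Calculus of complex vector fields -/

section ComplexFields

variable {d : ℕ} {M : Type*} [TopologicalSpace M] [ChartedSpace (EuclideanSpace ℝ (Fin d)) M]
  [IsManifold (𝓡 d) ∞ M]

theorem bracket_add_right {U : Set M} (hU : IsOpen U) {Y Z : ∀ y : M, T d y}
    (hY : SmoothOn U Y) (hZ : SmoothOn U Z) (X : ∀ y : M, T d y) {y : M} (hy : y ∈ U) :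
    bracket X (Y + Z) y = bracket X Y y + bracket X Z y := by
  rw [bracket_swap, bracket_add_left hU hY hZ X hy, bracket_swap Y, bracket_swap Z]; abel

theorem bracket_smul_right {U : Set M} (hU : IsOpen U) {Y : ∀ y : M, T d y}
    (hY : SmoothOn U Y) (c : ℝ) (X : ∀ y : M, T d y) {y : M} (hy : y ∈ U) :
    bracket X (c • Y) y = c • bracket X Y y := by
  rw [bracket_swap, bracket_smul_left hU hY c X hy, bracket_swap Y, smul_neg, neg_neg]

theorem cre_cbracket (Z W : ∀ y : M, CT d y) (y : M) : cre (cbracket Z W y) =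
    bracket (fun y => cre (Z y)) (fun y => cre (W y)) y
      - bracket (fun y => cim (Z y)) (fun y => cim (W y)) y := by
  simp [cbracket]

theorem cim_cbracket (Z W : ∀ y : M, CT d y) (y : M) : cim (cbracket Z W y) =
    bracket (fun y => cre (Z y)) (fun y => cim (W y)) y
      + bracket (fun y => cim (Z y)) (fun y => cre (W y)) y := by
  simp [cbracket]

theorem cbracket_swap (Z W : ∀ y : M, CT d y) (y : M) : cbracket Z W y = -cbracket W Z y := by
  apply complexification_ext
  · rw [map_neg, cre_cbracket, cre_cbracket, bracket_swap (fun y => cre (Z y)),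
      bracket_swap (fun y => cim (Z y))]
    abel
  · rw [map_neg, cim_cbracket, cim_cbracket, bracket_swap (fun y => cre (Z y)),
      bracket_swap (fun y => cim (Z y))]
    abel

theorem cbracket_add_right {U : Set M} (hU : IsOpen U) {W W' : ∀ y : M, CT d y}
    (hW : CSmoothOn U W) (hW' : CSmoothOn U W') (Z : ∀ y : M, CT d y) {y : M} (hy : y ∈ U) :
    cbracket Z (W + W') y = cbracket Z W y + cbracket Z W' y := by
  rw [cbracket_swap, cbracket_add_left hU hW hW' Z hy, cbracket_swap W, cbracket_swap W']; abel

theorem CSmoothOn.sub {U : Set M} {Z Z' : ∀ y : M, CT d y} (hZ : CSmoothOn U Z)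
    (hZ' : CSmoothOn U Z') : CSmoothOn U (Z - Z') := by
  have : Z - Z' = Z + (-1 : ℂ) • Z' := by rw [neg_one_smul]; exact sub_eq_add_neg Z Z'
  rw [this]
  exact hZ.add (hZ'.smul _)

theorem cbracket_sub_left {U : Set M} (hU : IsOpen U) {Z Z' : ∀ y : M, CT d y}
    (hZ : CSmoothOn U Z) (hZ' : CSmoothOn U Z') (W : ∀ y : M, CT d y) {y : M} (hy : y ∈ U) :
    cbracket (Z - Z') W y = cbracket Z W y - cbracket Z' W y := by
  have : Z - Z' = Z + (-1 : ℂ) • Z' := by rw [neg_one_smul]; exact sub_eq_add_neg Z Z'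
  rw [this, cbracket_add_left hU hZ (hZ'.smul _) W hy, cbracket_smul_left hU hZ' _ W hy,
    neg_one_smul, sub_eq_add_neg]

theorem cbracket_sub_right {U : Set M} (hU : IsOpen U) {W W' : ∀ y : M, CT d y}
    (hW : CSmoothOn U W) (hW' : CSmoothOn U W') (Z : ∀ y : M, CT d y) {y : M} (hy : y ∈ U) :
    cbracket Z (W - W') y = cbracket Z W y - cbracket Z W' y := by
  rw [cbracket_swap, cbracket_sub_left hU hW hW' Z hy, cbracket_swap W, cbracket_swap W']; abel

theorem cbracket_congr {Z Z' W W' : ∀ y : M, CT d y} {y : M} (hZ : ∀ᶠ z in 𝓝 y, Z z = Z' z)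
    (hW : ∀ᶠ z in 𝓝 y, W z = W' z) : cbracket Z W y = cbracket Z' W' y := by
  have h1 : ∀ᶠ z in 𝓝 y, cre (Z z) = cre (Z' z) := hZ.mono fun z h => by rw [h]
  have h2 : ∀ᶠ z in 𝓝 y, cim (Z z) = cim (Z' z) := hZ.mono fun z h => by rw [h]
  have h3 : ∀ᶠ z in 𝓝 y, cre (W z) = cre (W' z) := hW.mono fun z h => by rw [h]
  have h4 : ∀ᶠ z in 𝓝 y, cim (W z) = cim (W' z) := hW.mono fun z h => by rw [h]
  simp only [cbracket, bracket_congr h1 h3, bracket_congr h2 h4, bracket_congr h1 h4,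
    bracket_congr h2 h3]

theorem bracket_eq_zero_of_eq_zero {X Y : ∀ y : M, T d y} {y : M} (hX : X y = 0)
    (hY : Y y = 0) : bracket X Y y = 0 := by
  rw [bracket, ← mlieBracketWithin_univ]
  exact mlieBracketWithin_eq_zero_of_eq_zero hX hY

theorem cbracket_eq_zero_of_eq_zero {Z W : ∀ y : M, CT d y} {y : M} (hZ : Z y = 0)
    (hW : W y = 0) : cbracket Z W y = 0 := by
  apply complexification_ext
  · rw [cre_cbracket, bracket_eq_zero_of_eq_zero (by simp [hZ]) (by simp [hW]),
      bracket_eq_zero_of_eq_zero (by simp [hZ]) (by simp [hW])]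
    simp
  · rw [cim_cbracket, bracket_eq_zero_of_eq_zero (by simp [hZ]) (by simp [hW]),
      bracket_eq_zero_of_eq_zero (by simp [hZ]) (by simp [hW])]
    simp

theorem CSmoothOn.cbracket {U : Set M} (hU : IsOpen U) {Z W : ∀ y : M, CT d y}
    (hZ : CSmoothOn U Z) (hW : CSmoothOn U W) : CSmoothOn U (cbracket Z W) := by
  have hsub {X Y : ∀ y : M, T d y} (hX : SmoothOn U X) (hY : SmoothOn U Y) :
      SmoothOn U (fun y => X y - Y y) := by
    have := hX.add (hY.smul (-1))
    rw [neg_one_smul, ← sub_eq_add_neg] at this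
    exact this
  refine ⟨?_, ?_⟩
  · simp only [cre_cbracket]
    exact hsub (hZ.1.bracket hU hW.1) (hZ.2.bracket hU hW.2)
  · simp only [cim_cbracket]
    exact (hZ.1.bracket hU hW.2).add (hZ.2.bracket hU hW.1)

/-- The Jacobi identity for a real vector field and two complex ones. -/
theorem cbracket_ofReal_jacobi {U : Set M} (hU : IsOpen U) {X : ∀ y : M, T d y}
    {Z W : ∀ y : M, CT d y} (hX : SmoothOn U X) (hZ : CSmoothOn U Z) (hW : CSmoothOn U W) {y : M}
    (hy : y ∈ U) : cbracket (ofReal X) (cbracket Z W) y =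
      cbracket (cbracket (ofReal X) Z) W y + cbracket Z (cbracket (ofReal X) W) y := by
  have hsub {A B : ∀ y : M, T d y} (hA : SmoothOn U A) (hB : SmoothOn U B) :
      bracket X (fun y => A y - B y) y = bracket X A y - bracket X B y := by
    have h : (fun y => A y - B y) = A + (-1 : ℝ) • B := by
      rw [neg_one_smul]; exact sub_eq_add_neg A B
    rw [h, bracket_add_right hU hA (hB.smul _) X hy, bracket_smul_right hU hB _ X hy,
      neg_one_smul, sub_eq_add_neg]
  have hadd {A B : ∀ y : M, T d y} (hA : SmoothOn U A) (hB : SmoothOn U B) :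
      bracket X (fun y => A y + B y) y = bracket X A y + bracket X B y :=
    bracket_add_right hU hA hB X hy
  apply complexification_ext
  · rw [congrFun (cre_cbracket_ofReal X (cbracket Z W)) y, map_add, cre_cbracket, cre_cbracket]
    simp only [cre_cbracket_ofReal, cim_cbracket_ofReal]
    simp only [cre_cbracket]
    rw [hsub (hZ.1.bracket hU hW.1) (hZ.2.bracket hU hW.2), bracket_jacobi hU hX hZ.1 hW.1 hy,
      bracket_jacobi hU hX hZ.2 hW.2 hy]
    abel
  · rw [congrFun (cim_cbracket_ofReal X (cbracket Z W)) y, map_add, cim_cbracket, cim_cbracket]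
    simp only [cre_cbracket_ofReal, cim_cbracket_ofReal]
    simp only [cim_cbracket]
    rw [hadd (hZ.1.bracket hU hW.2) (hZ.2.bracket hU hW.1), bracket_jacobi hU hX hZ.1 hW.2 hy,
      bracket_jacobi hU hX hZ.2 hW.1 hy]
    abel

/-- The complex conjugate of a complex vector field. -/
def conjField (Z : ∀ y : M, CT d y) : ∀ y : M, CT d y := fun y => conj (Z y)

theorem conjField_ofReal (X : ∀ y : M, T d y) : conjField (ofReal X) = ofReal X := by
  funext y; simp [conjField, ofReal, conj_tmul]

theorem cre_conjField (Z : ∀ y : M, CT d y) :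
    (fun y => cre (conjField Z y)) = fun y => cre (Z y) := by
  funext y; exact cre_conj _

theorem cim_conjField (Z : ∀ y : M, CT d y) :
    (fun y => cim (conjField Z y)) = (-1 : ℝ) • fun y => cim (Z y) := by
  funext y; simp [conjField, cim_conj]

theorem CSmoothOn.conjField {U : Set M} {Z : ∀ y : M, CT d y} (hZ : CSmoothOn U Z) :
    CSmoothOn U (conjField Z) := by
  refine ⟨?_, ?_⟩
  · rw [cre_conjField]; exact hZ.1
  · rw [cim_conjField]; exact hZ.2.smul _

theorem conjField_cbracket {U : Set M} (hU : IsOpen U) {Z W : ∀ y : M, CT d y}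
    (hZ : CSmoothOn U Z) (hW : CSmoothOn U W) {y : M} (hy : y ∈ U) :
    cbracket (conjField Z) (conjField W) y = conj (cbracket Z W y) := by
  apply complexification_ext
  · rw [cre_conj, cre_cbracket, cre_cbracket]
    simp only [cre_conjField, cim_conjField]
    rw [bracket_smul_left hU hZ.2 _ _ hy, bracket_smul_right hU hW.2 _ _ hy]
    simp
  · rw [cim_conj, cim_cbracket, cim_cbracket]
    simp only [cre_conjField, cim_conjField]
    rw [bracket_smul_left hU hZ.2 _ _ hy, bracket_smul_right hU hW.2 _ _ hy]
    simp only [neg_smul, one_smul]; abel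

theorem SmoothOn.mul {U : Set M} {X : ∀ y : M, T d y} {f : M → ℝ}
    (hf : ContMDiffOn (𝓡 d) 𝓘(ℝ, ℝ) ∞ f U) (hX : SmoothOn U X) :
    SmoothOn U (fun y => f y • X y) :=
  ContMDiffOn.smul_section (V := TangentSpace (𝓡 d) (M := M)) hf hX

theorem CSmoothOn.mul {U : Set M} {Z : ∀ y : M, CT d y} {f : M → ℝ}
    (hf : ContMDiffOn (𝓡 d) 𝓘(ℝ, ℝ) ∞ f U) (hZ : CSmoothOn U Z) :
    CSmoothOn U (fun y => f y • Z y) := by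
  refine ⟨?_, ?_⟩
  · simp only [map_smul]; exact hZ.1.mul hf
  · simp only [map_smul]; exact hZ.2.mul hf

theorem CSmoothOn.sum {U : Set M} {ι : Type*} (s : Finset ι) {Z : ι → ∀ y : M, CT d y}
    (hZ : ∀ i, CSmoothOn U (Z i)) : CSmoothOn U (fun y => ∑ i ∈ s, Z i y) := by
  classical
  induction s using Finset.induction_on with
  | empty => simpa using! CSmoothOn.zero U
  | insert i s hi ih => simpa only [Finset.sum_insert hi] using! (hZ i).add ih

theorem bracket_mul_left {U : Set M} (hU : IsOpen U) {X : ∀ y : M, T d y} {f : M → ℝ}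
    (hf : ContMDiffOn (𝓡 d) 𝓘(ℝ, ℝ) ∞ f U) (hX : SmoothOn U X) (Y : ∀ y : M, T d y) {y : M}
    (hy : y ∈ U) : bracket (fun z => f z • X z) Y y =
      f y • bracket X Y y - (mvfderiv (𝓡 d) f y (Y y)) • X y := by
  have h := mlieBracket_smul_left (W := Y)
    ((hf.contMDiffAt (hU.mem_nhds hy)).mdifferentiableAt (by simp)) (hX.mdiffAt hU hy)
  refine h.trans ?_
  rw [neg_smul, add_comm, ← sub_eq_add_neg]
  rfl

/-- The Leibniz rule, up to a multiple of the field that is multiplied by a function. -/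
theorem cbracket_mul_left {U : Set M} (hU : IsOpen U) {Z : ∀ y : M, CT d y} {f : M → ℝ}
    (hf : ContMDiffOn (𝓡 d) 𝓘(ℝ, ℝ) ∞ f U) (hZ : CSmoothOn U Z) (W : ∀ y : M, CT d y) {y : M}
    (hy : y ∈ U) : ∃ a : ℂ, cbracket (fun z => f z • Z z) W y = f y • cbracket Z W y + a • Z y := by
  refine ⟨-((mvfderiv (𝓡 d) f y (cre (W y)) : ℝ) + (mvfderiv (𝓡 d) f y (cim (W y)) : ℝ) *
    Complex.I), ?_⟩
  apply complexification_ext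
  · rw [map_add, map_smul, cre_smul, cre_cbracket, cre_cbracket]
    simp only [map_smul]
    rw [bracket_mul_left hU hf hZ.1 _ hy, bracket_mul_left hU hf hZ.2 _ hy]
    simp
    module
  · rw [map_add, map_smul, cim_smul, cim_cbracket, cim_cbracket]
    simp only [map_smul]
    rw [bracket_mul_left hU hf hZ.1 _ hy, bracket_mul_left hU hf hZ.2 _ hy]
    simp
    module

theorem cbracket_sum_mul_left {U : Set M} (hU : IsOpen U) {ι : Type*} (s : Finset ι)
    {Z : ι → ∀ y : M, CT d y} {f : ι → M → ℝ}
    (hf : ∀ i, ContMDiffOn (𝓡 d) 𝓘(ℝ, ℝ) ∞ (f i) U) (hZ : ∀ i, CSmoothOn U (Z i))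
    (W : ∀ y : M, CT d y) {y : M} (hy : y ∈ U) : ∃ a : ι → ℂ,
      cbracket (fun z => ∑ i ∈ s, f i z • Z i z) W y =
        ∑ i ∈ s, (f i y • cbracket (Z i) W y + a i • Z i y) := by
  classical
  choose a ha using fun i => cbracket_mul_left hU (hf i) (hZ i) W hy
  refine ⟨a, ?_⟩
  induction s using Finset.induction_on with
  | empty => simpa using! cbracket_zero_left W y
  | insert i s hi ih =>
    rw [Finset.sum_insert hi, ← ih, ← ha, ← cbracket_add_left hU ((hZ i).mul (hf i))
      (CSmoothOn.sum s fun i => (hZ i).mul (hf i)) W hy]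
    congr 1
    funext z
    exact Finset.sum_insert hi

end ComplexFields

/-! ### Frames of complex subbundles -/

section Frames

variable {d : ℕ} {M : Type*} [TopologicalSpace M] [ChartedSpace (EuclideanSpace ℝ (Fin d)) M]
  [IsManifold (𝓡 d) ∞ M]

/-- The complex fields `B i` form on `U` a smooth frame over the reals of the family `F` of complex
tangent subspaces. -/
structure IsRealFrameOn {ι : Type*} (U : Set M) (F : ∀ y : M, Submodule ℂ (CT d y))
    (B : ι → ∀ y : M, CT d y) : Prop where
  isSectionOn : ∀ i, IsSectionOn U F (B i)
  linearIndependent : ∀ y ∈ U, LinearIndependent ℝ fun i => B i y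
  mem_span : ∀ y ∈ U, ∀ w ∈ F y, w ∈ Submodule.span ℝ (Set.range fun i => B i y)

theorem IsRealFrameOn.mono {ι : Type*} {U V : Set M} {F : ∀ y : M, Submodule ℂ (CT d y)}
    {B : ι → ∀ y : M, CT d y} (h : IsRealFrameOn U F B) (hV : V ⊆ U) : IsRealFrameOn V F B :=
  ⟨fun i => (h.isSectionOn i).mono hV, fun y hy => h.linearIndependent y (hV hy),
    fun y hy => h.mem_span y (hV hy)⟩

theorem linearIndependent_basisOneI_smul {ι V : Type*} [AddCommGroup V] [Module ℝ V]
    {v : ι → ℂ ⊗[ℝ] V} (h : LinearIndependent ℂ v) :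
    LinearIndependent ℝ fun p : Fin 2 × ι => Complex.basisOneI p.1 • v p.2 :=
  linearIndependent_smul Complex.basisOneI.linearIndependent h

theorem sum_smul_mem_span_basisOneI_smul {ι V : Type*} [Fintype ι] [AddCommGroup V] [Module ℝ V]
    (v : ι → ℂ ⊗[ℝ] V) (c : ι → ℂ) : ∑ i, c i • v i ∈
      Submodule.span ℝ (Set.range fun p : Fin 2 × ι => Complex.basisOneI p.1 • v p.2) := by
  refine sum_mem fun i _ => ?_
  have e : c i • v i = (c i).re • (Complex.basisOneI 0 • v i) +
      (c i).im • (Complex.basisOneI 1 • v i) := by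
    rw [← smul_assoc, ← smul_assoc, ← add_smul]
    congr 1
    simp
  rw [e]
  exact add_mem (Submodule.smul_mem _ _ (Submodule.subset_span ⟨(0, i), rfl⟩))
    (Submodule.smul_mem _ _ (Submodule.subset_span ⟨(1, i), rfl⟩))

/-- A complex frame `Z` gives the real frame `Z`, `i Z`. -/
theorem IsCSubbundle.exists_isRealFrameOn {F : ∀ y : M, Submodule ℂ (CT d y)}
    (hF : IsCSubbundle F) (x : M) : ∃ U : Set M, IsOpen U ∧ x ∈ U ∧
      ∃ (r : ℕ) (B : Fin 2 × Fin r → ∀ y : M, CT d y), IsRealFrameOn U F B := by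
  obtain ⟨U, hU, hx, r, Z, hZ, h⟩ := hF x
  have hmem (y) (hy : y ∈ U) (i) : Z i y ∈ F y := by
    rw [← (h y hy).2]; exact Submodule.subset_span ⟨i, rfl⟩
  refine ⟨U, hU, hx, r, fun p y => Complex.basisOneI p.1 • Z p.2 y, fun p => ⟨(hZ p.2).smul _, ?_⟩,
    fun y hy => ?_, fun y hy w hw => ?_⟩
  · exact fun y hy => (F y).smul_mem _ (hmem y hy _)
  · exact linearIndependent_basisOneI_smul (V := T d y) (v := fun i => Z i y) (h y hy).1
  · rw [← (h y hy).2, Submodule.mem_span_range_iff_exists_fun] at hw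
    obtain ⟨c, rfl⟩ := hw
    exact sum_smul_mem_span_basisOneI_smul (V := T d y) (fun i => Z i y) c

theorem IsRealFrameOn.sup {ι κ : Type*} {U : Set M} {F G : ∀ y : M, Submodule ℂ (CT d y)}
    {B : ι → ∀ y : M, CT d y} {C : κ → ∀ y : M, CT d y} (hB : IsRealFrameOn U F B)
    (hC : IsRealFrameOn U G C) (h : ∀ y ∈ U, F y ⊓ G y = ⊥) :
    IsRealFrameOn U (fun y => F y ⊔ G y) (Sum.elim B C) := by
  refine ⟨?_, fun y hy => ?_, fun y hy w hw => ?_⟩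
  · rintro (i | j)
    · exact ⟨(hB.isSectionOn i).1, fun y hy =>
        Submodule.mem_sup_left ((hB.isSectionOn i).2 y hy)⟩
    · exact ⟨(hC.isSectionOn j).1, fun y hy =>
        Submodule.mem_sup_right ((hC.isSectionOn j).2 y hy)⟩
  · have e : (fun i => Sum.elim B C i y) = Sum.elim (fun i => B i y) fun j => C j y := by
      funext i; cases i <;> rfl
    rw [e]
    refine (hB.linearIndependent y hy).sum_type (hC.linearIndependent y hy) ?_
    rw [Submodule.disjoint_def]
    intro v h1 h2
    have h1' : v ∈ F y := (Submodule.span_le (p := (F y).restrictScalars ℝ)).2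
      (by rintro _ ⟨i, rfl⟩; exact (hB.isSectionOn i).2 y hy) h1
    have h2' : v ∈ G y := (Submodule.span_le (p := (G y).restrictScalars ℝ)).2
      (by rintro _ ⟨i, rfl⟩; exact (hC.isSectionOn i).2 y hy) h2
    have : v ∈ F y ⊓ G y := ⟨h1', h2'⟩
    rwa [h y hy, Submodule.mem_bot] at this
  · obtain ⟨u, hu, v, hv, rfl⟩ := Submodule.mem_sup.1 hw
    refine add_mem (Submodule.span_mono ?_ (hB.mem_span y hy u hu))
      (Submodule.span_mono ?_ (hC.mem_span y hy v hv))
    · rintro _ ⟨i, rfl⟩; exact ⟨Sum.inl i, rfl⟩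
    · rintro _ ⟨i, rfl⟩; exact ⟨Sum.inr i, rfl⟩

/-- The coefficients with respect to a family of vectors which depends smoothly on parameters and is
linearly independent at `y₀` are smooth at `y₀`. -/
theorem contMDiffAt_coeff {ι E : Type*} [Fintype ι] [NormedAddCommGroup E] [NormedSpace ℝ E]
    [FiniteDimensional ℝ E] {y₀ : M} {b : ι → M → E} {w : M → E} {c : ι → M → ℝ}
    (hb : ∀ i, ContMDiffAt (𝓡 d) 𝓘(ℝ, E) ∞ (b i) y₀) (hw : ContMDiffAt (𝓡 d) 𝓘(ℝ, E) ∞ w y₀)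
    (hli : LinearIndependent ℝ fun i => b i y₀)
    (hc : ∀ᶠ y in 𝓝 y₀, w y = ∑ i, c i y • b i y) (i : ι) :
    ContMDiffAt (𝓡 d) 𝓘(ℝ, ℝ) ∞ (c i) y₀ := by
  classical
  obtain ⟨l, hl⟩ := (Fintype.linearCombination ℝ fun i => b i y₀).exists_leftInverse_of_injective
    (LinearMap.ker_eq_bot'.2 fun v hv => funext (Fintype.linearIndependent_iff.1 hli v hv))
  set L : E →L[ℝ] (ι → ℝ) := LinearMap.toContinuousLinearMap l
  -- the matrix of the family with respect to its value at `y₀`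
  let Φ : (ι → E) →L[ℝ] ((ι → ℝ) →L[ℝ] (ι → ℝ)) := ∑ j,
    (ContinuousLinearMap.smulRightL ℝ (ι → ℝ) (ι → ℝ) (ContinuousLinearMap.proj j)) ∘L L ∘L
      ContinuousLinearMap.proj j
  have hΦ (e : ι → E) (v : ι → ℝ) : Φ e v = L (∑ j, v j • e j) := by
    simp [Φ]
  have h1 : Φ (fun j => b j y₀) = 1 := by
    ext1 v
    rw [hΦ]
    exact LinearMap.congr_fun hl v
  have hbp : ContMDiffAt (𝓡 d) 𝓘(ℝ, ι → E) ∞ (fun y j => b j y) y₀ :=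
    contMDiffAt_pi_space.2 hb
  have hA : ContMDiffAt (𝓡 d) 𝓘(ℝ, (ι → ℝ) →L[ℝ] (ι → ℝ)) ∞ (fun y => Φ fun j => b j y) y₀ :=
    Φ.contDiff.contDiffAt.comp_contMDiffAt hbp
  have hinv : ContDiffAt ℝ ∞ Ring.inverse (Φ fun j => b j y₀) := by
    rw [h1]; exact contDiffAt_ringInverse ℝ (1 : ((ι → ℝ) →L[ℝ] (ι → ℝ))ˣ)
  have hA' := hinv.comp_contMDiffAt (f := fun y => Φ fun j => b j y) hA
  have hv : ContMDiffAt (𝓡 d) 𝓘(ℝ, ι → ℝ) ∞ (fun y => L (w y)) y₀ :=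
    L.contDiff.contDiffAt.comp_contMDiffAt hw
  have hsol := hA'.clm_apply hv
  have hunit : ∀ᶠ y in 𝓝 y₀, IsUnit (Φ fun j => b j y) :=
    hA.continuousAt.eventually (Units.isOpen.mem_nhds (by change IsUnit (Φ _); rw [h1]; exact isUnit_one))
  have hev : (fun y j => c j y) =ᶠ[𝓝 y₀]
      fun y => (Ring.inverse (Φ fun j => b j y)) (L (w y)) := by
    filter_upwards [hc, hunit] with y hy hu
    have : L (w y) = Φ (fun j => b j y) fun j => c j y := by rw [hΦ, hy]
    rw [this, ← mul_apply_eq_comp, Ring.inverse_mul_cancel _ hu]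
    rfl
  exact contMDiffAt_pi_space.1 (hsol.congr_of_eventuallyEq hev) i

theorem IsRealFrameOn.exists_coeff {ι : Type*} [Fintype ι] {U : Set M} (hU : IsOpen U)
    {F : ∀ y : M, Submodule ℂ (CT d y)} {B : ι → ∀ y : M, CT d y} (hB : IsRealFrameOn U F B)
    {Z : ∀ y : M, CT d y} (hZ : IsSectionOn U F Z) : ∃ c : ι → M → ℝ,
      (∀ i, ContMDiffOn (𝓡 d) 𝓘(ℝ, ℝ) ∞ (c i) U) ∧ ∀ y ∈ U, Z y = ∑ i, c i y • B i y := by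
  have hex (y : M) : ∃ c : ι → ℝ, y ∈ U → Z y = ∑ i, c i • B i y := by
    by_cases hy : y ∈ U
    · obtain ⟨c, hc⟩ := (Submodule.mem_span_range_iff_exists_fun ℝ).1
        (hB.mem_span y hy _ (hZ.2 y hy))
      exact ⟨c, fun _ => hc.symm⟩
    · exact ⟨0, fun h => absurd h hy⟩
  choose c hc using hex
  refine ⟨fun i y => c y i, fun i y₀ hy₀ => ContMDiffAt.contMDiffWithinAt ?_, hc⟩
  set e := trivializationAt (EuclideanSpace ℝ (Fin d)) (TangentSpace (𝓡 d) (M := M)) y₀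
  -- the two parts of a complex tangent vector in the trivialization at `y₀`
  let τ (y : M) : CT d y →ₗ[ℝ] EuclideanSpace ℝ (Fin d) × EuclideanSpace ℝ (Fin d) :=
    ((e.continuousLinearMapAt ℝ y : T d y →ₗ[ℝ] _) ∘ₗ cre).prod
      ((e.continuousLinearMapAt ℝ y : T d y →ₗ[ℝ] _) ∘ₗ cim)
  have hbase : ∀ᶠ y in 𝓝 y₀, y ∈ e.baseSet :=
    e.open_baseSet.mem_nhds (FiberBundle.mem_baseSet_trivializationAt' y₀)
  have hreal {X : ∀ y : M, T d y} (hX : SmoothOn U X) : ContMDiffAt (𝓡 d)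
      𝓘(ℝ, EuclideanSpace ℝ (Fin d)) ∞ (fun y => e.continuousLinearMapAt ℝ y (X y)) y₀ := by
    refine ((Bundle.contMDiffAt_section y₀).1 (hX.at hU hy₀)).congr_of_eventuallyEq ?_
    filter_upwards [hbase] with y hy
    exact congrFun (e.coe_linearMapAt_of_mem hy) (X y)
  have hτ {W : ∀ y : M, CT d y} (hW : CSmoothOn U W) : ContMDiffAt (𝓡 d)
      𝓘(ℝ, EuclideanSpace ℝ (Fin d) × EuclideanSpace ℝ (Fin d)) ∞ (fun y => τ y (W y)) y₀ :=
    (hreal hW.1).prodMk_space (hreal hW.2)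
  refine contMDiffAt_coeff (b := fun i y => τ y (B i y)) (w := fun y => τ y (Z y))
    (c := fun i y => c y i)
    (fun i => hτ (hB.isSectionOn i).1) (hτ hZ.1) ?_ ?_ i
  · have hinj : Function.Injective (τ y₀) := by
      intro v w hvw
      have hy : y₀ ∈ e.baseSet := FiberBundle.mem_baseSet_trivializationAt' y₀
      have h := (Prod.ext_iff.1 hvw)
      have hi : Function.Injective (e.continuousLinearMapAt ℝ y₀) :=
        Function.LeftInverse.injective (e.symmL_continuousLinearMapAt hy)
      exact complexification_ext (hi h.1) (hi h.2)
    exact (hB.linearIndependent y₀ hy₀).map' (τ y₀) (LinearMap.ker_eq_bot.2 hinj)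
  · filter_upwards [hU.mem_nhds hy₀] with y hy
    rw [hc y hy, map_sum]
    simp only [map_smul]

/-- The bracket with a smooth field is tensorial on the sections of a subbundle `F`, modulo `F`. -/
theorem cbracket_mem_of_eq_zero {F : ∀ y : M, Submodule ℂ (CT d y)} (hF : IsCSubbundle F)
    {U : Set M} (hU : IsOpen U) {Z : ∀ y : M, CT d y} (hZ : IsSectionOn U F Z)
    (W : ∀ y : M, CT d y) {y : M} (hy : y ∈ U) (h0 : Z y = 0) : cbracket Z W y ∈ F y := by
  obtain ⟨V, hV, hyV, r, B, hB⟩ := hF.exists_isRealFrameOn y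
  have hUV := hU.inter hV
  have hB' := hB.mono (Set.inter_subset_right : U ∩ V ⊆ V)
  obtain ⟨c, hc, hZc⟩ := hB'.exists_coeff hUV (hZ.mono Set.inter_subset_left)
  have hyUV : y ∈ U ∩ V := ⟨hy, hyV⟩
  obtain ⟨a, ha⟩ := cbracket_sum_mul_left hUV Finset.univ hc (fun i => (hB'.isSectionOn i).1) W hyUV
  have hev : ∀ᶠ z in 𝓝 y, z ∈ U ∩ V := hUV.mem_nhds hyUV
  rw [cbracket_congr (hev.mono hZc) (Filter.Eventually.of_forall fun _ => rfl), ha]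
  have hc0 : ∀ i, c i y = 0 := by
    rw [hZc y hyUV] at h0
    exact Fintype.linearIndependent_iff.1 (hB'.linearIndependent y hyUV) _ h0
  refine sum_mem fun i _ => ?_
  rw [hc0 i, zero_smul, zero_add]
  exact (F y).smul_mem _ ((hB'.isSectionOn i).2 y hyUV)

/-- A section of a direct sum of two subbundles is locally the sum of sections of the summands. -/
theorem IsSectionOn.exists_add {F G : ∀ y : M, Submodule ℂ (CT d y)} (hF : IsCSubbundle F)
    (hG : IsCSubbundle G) (hFG : ∀ y, F y ⊓ G y = ⊥) {U : Set M} (hU : IsOpen U)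
    {Z : ∀ y : M, CT d y} (hZ : IsSectionOn U (fun y => F y ⊔ G y) Z) {x : M} (hx : x ∈ U) :
    ∃ V : Set M, IsOpen V ∧ x ∈ V ∧ V ⊆ U ∧ ∃ A B : ∀ y : M, CT d y, IsSectionOn V F A ∧
      IsSectionOn V G B ∧ ∀ y ∈ V, Z y = A y + B y := by
  obtain ⟨V, hV, hxV, r, B, hB⟩ := hF.exists_isRealFrameOn x
  obtain ⟨V', hV', hxV', r', B', hB'⟩ := hG.exists_isRealFrameOn x
  have hO : IsOpen (U ∩ V ∩ V') := (hU.inter hV).inter hV'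
  have h1 := hB.mono (fun z hz => hz.1.2 : U ∩ V ∩ V' ⊆ V)
  have h2 := hB'.mono (fun z hz => hz.2 : U ∩ V ∩ V' ⊆ V')
  obtain ⟨c, hc, hZc⟩ := (h1.sup h2 fun y _ => hFG y).exists_coeff hO
    (hZ.mono fun z hz => hz.1.1)
  refine ⟨U ∩ V ∩ V', hO, ⟨⟨hx, hxV⟩, hxV'⟩, fun z hz => hz.1.1,
    fun y => ∑ i, c (Sum.inl i) y • B i y, fun y => ∑ j, c (Sum.inr j) y • B' j y,
    ⟨CSmoothOn.sum _ fun i => (h1.isSectionOn i).1.mul (hc _), fun y hy => sum_mem fun i _ => ?_⟩,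
    ⟨CSmoothOn.sum _ fun i => (h2.isSectionOn i).1.mul (hc _), fun y hy => sum_mem fun i _ => ?_⟩,
    fun y hy => ?_⟩
  · exact ((F y).restrictScalars ℝ).smul_mem _ ((h1.isSectionOn i).2 y hy)
  · exact ((G y).restrictScalars ℝ).smul_mem _ ((h2.isSectionOn i).2 y hy)
  · rw [hZc y hy, Fintype.sum_sum_type]
    rfl

/-- Every vector of a subbundle is the value of a local section. -/
theorem IsCSubbundle.exists_section {F : ∀ y : M, Submodule ℂ (CT d y)} (hF : IsCSubbundle F)
    {x : M} {v : CT d x} (hv : v ∈ F x) : ∃ U : Set M, IsOpen U ∧ x ∈ U ∧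
      ∃ Z : ∀ y : M, CT d y, IsSectionOn U F Z ∧ Z x = v := by
  obtain ⟨U, hU, hx, r, B, hB⟩ := hF.exists_isRealFrameOn x
  obtain ⟨c, hc⟩ := (Submodule.mem_span_range_iff_exists_fun ℝ).1 (hB.mem_span x hx v hv)
  exact ⟨U, hU, hx, fun y => ∑ i, c i • B i y, ⟨CSmoothOn.sum _ fun i =>
    (hB.isSectionOn i).1.mul contMDiffOn_const, fun y hy => sum_mem fun i _ =>
      ((F y).restrictScalars ℝ).smul_mem _ ((hB.isSectionOn i).2 y hy)⟩, hc⟩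

theorem IsCSubbundle.conjSubmodule {F : ∀ y : M, Submodule ℂ (CT d y)} (hF : IsCSubbundle F) :
    IsCSubbundle fun y => conjSubmodule (F y) := by
  intro x
  obtain ⟨U, hU, hx, r, Z, hZ, h⟩ := hF x
  refine ⟨U, hU, hx, r, fun i => conjField (Z i), fun i => (hZ i).conjField, fun y hy => ⟨?_, ?_⟩⟩
  · rw [Fintype.linearIndependent_iff]
    intro c hc i
    have h' := congrArg conj hc
    simp only [conjField, map_sum, LinearMap.map_smulₛₗ, conj_conj, map_zero] at h'
    have := Fintype.linearIndependent_iff.1 (h y hy).1 _ h' i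
    simpa using this
  · change _ = CR.conjSubmodule (F y)
    rw [← (h y hy).2, CR.conjSubmodule, Submodule.map_span, ← Set.range_comp]
    rfl

end Frames

/-! ### Infinitesimal CR automorphisms preserve the Freeman sequence -/

namespace CRHypersurface

variable {n : ℕ} {M : Type*} [TopologicalSpace M]
  [ChartedSpace (EuclideanSpace ℝ (Fin (2 * n + 1))) M] [IsManifold (𝓡 (2 * n + 1)) ∞ M]
  {S : CRHypersurface n M}

theorem mem_D10_iff {y : M} {w : CT (2 * n + 1) y} :
    w ∈ S.D10 y ↔ ∃ a : S.D y, cre w = a ∧ cim w = -(S.J y a : T (2 * n + 1) y) := by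
  constructor
  · intro hw
    induction hw using Submodule.span_induction with
    | mem w hw =>
      obtain ⟨a, rfl⟩ := hw
      exact ⟨a, by simp, by simp⟩
    | zero => exact ⟨0, by simp, by simp⟩
    | add u v _ _ hu hv =>
      obtain ⟨a, h1, h2⟩ := hu
      obtain ⟨b, h3, h4⟩ := hv
      exact ⟨a + b, by simp [h1, h3], by simp [h2, h4]; abel⟩
    | smul c u _ hu =>
      obtain ⟨a, h1, h2⟩ := hu
      refine ⟨c.re • a + c.im • S.J y a, by simp [cre_smul, h1, h2], ?_⟩
      simp [cim_smul, h1, h2, S.J_J]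
      abel
  · rintro ⟨a, h1, h2⟩
    refine Submodule.subset_span ⟨a, complexification_ext ?_ ?_⟩
    · simp [h1]
    · simp [h2]

theorem mem_D01_iff {y : M} {w : CT (2 * n + 1) y} :
    w ∈ S.D01 y ↔ ∃ a : S.D y, cre w = a ∧ cim w = (S.J y a : T (2 * n + 1) y) := by
  rw [D01, mem_conjSubmodule, mem_D10_iff, cre_conj, cim_conj]
  simp

theorem D10_inf_D01 (y : M) : S.D10 y ⊓ S.D01 y = ⊥ := by
  refine (Submodule.eq_bot_iff _).2 fun w hw => ?_
  obtain ⟨a, h1, h2⟩ := mem_D10_iff.1 hw.1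
  obtain ⟨b, h3, h4⟩ := mem_D01_iff.1 hw.2
  have hab : a = b := Subtype.ext (h1.symm.trans h3)
  subst hab
  have h5 : (S.J y a : T (2 * n + 1) y) = 0 := by
    have h := h4.symm.trans h2
    rw [eq_neg_iff_add_eq_zero, ← two_smul ℝ] at h
    exact (smul_eq_zero.1 h).resolve_left two_ne_zero
  have h6 : S.J y a = 0 := Subtype.ext h5
  have h7 : a = 0 := by rw [← neg_eq_zero, ← S.J_J, h6, map_zero]
  subst h7
  exact complexification_ext (by simpa using h1) (by simpa using h2)

theorem D10_sup_D01 (y : M) : S.D10 y ⊔ S.D01 y = (S.D y).baseChange ℂ := by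
  refine le_antisymm (sup_le ?_ ?_) fun w hw => ?_
  · intro w hw
    obtain ⟨a, h1, h2⟩ := mem_D10_iff.1 hw
    rw [mem_baseChange, h1, h2]
    exact ⟨a.2, neg_mem (S.J y a).2⟩
  · intro w hw
    obtain ⟨a, h1, h2⟩ := mem_D01_iff.1 hw
    rw [mem_baseChange, h1, h2]
    exact ⟨a.2, (S.J y a).2⟩
  · have hreal (a : S.D y) : (1 : ℂ) ⊗ₜ[ℝ] (a : T (2 * n + 1) y) ∈ S.D10 y ⊔ S.D01 y := by
      have e : (1 : ℂ) ⊗ₜ[ℝ] (a : T (2 * n + 1) y) =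
          (2⁻¹ : ℂ) • ((1 : ℂ) ⊗ₜ[ℝ] (a : T (2 * n + 1) y) -
            Complex.I ⊗ₜ[ℝ] (S.J y a : T (2 * n + 1) y)) +
          (2⁻¹ : ℂ) • ((1 : ℂ) ⊗ₜ[ℝ] (a : T (2 * n + 1) y) +
            Complex.I ⊗ₜ[ℝ] (S.J y a : T (2 * n + 1) y)) := by
        module
      rw [e]
      refine add_mem (Submodule.mem_sup_left (Submodule.smul_mem _ _ ?_))
        (Submodule.mem_sup_right (Submodule.smul_mem _ _ ?_))
      · exact Submodule.subset_span ⟨a, rfl⟩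
      · exact mem_D01_iff.2 ⟨a, by simp, by simp⟩
    rw [mem_baseChange] at hw
    rw [← tmul_cre_add_tmul_cim w]
    refine add_mem (hreal ⟨_, hw.1⟩) ?_
    have := Submodule.smul_mem _ Complex.I (hreal ⟨_, hw.2⟩)
    rwa [TensorProduct.smul_tmul', smul_eq_mul, mul_one] at this

theorem freeman_succ_le (m : ℕ) (y : M) : S.freeman (m + 1) y ≤ S.freeman m y := by
  rintro _ ⟨U, _, hy, Z, hZ, rfl, _⟩
  exact hZ.2 y hy

theorem freeman_le_D10 (m : ℕ) (y : M) : S.freeman m y ≤ S.D10 y := by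
  induction m with
  | zero => exact le_rfl
  | succ m ih => exact (freeman_succ_le m y).trans ih

theorem freeman_inf_D01 (m : ℕ) (y : M) : S.freeman m y ⊓ S.D01 y = ⊥ :=
  eq_bot_iff.2 ((inf_le_inf_right _ (freeman_le_D10 m y)).trans (D10_inf_D01 y).le)

theorem IsRegular.isCSubbundle_D01 (hreg : S.IsRegular) : IsCSubbundle S.D01 :=
  (hreg 0).conjSubmodule

/-- Any section of a term of the Freeman sequence with value in the next term is in the kernel of
the higher order Levi form. -/
theorem cbracket_mem_freeman_sup_D01 (hreg : S.IsRegular) {m : ℕ} {U V : Set M} (hU : IsOpen U)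
    (hV : IsOpen V) {Z W : ∀ y : M, CT (2 * n + 1) y} (hZ : IsSectionOn U (S.freeman m) Z)
    (hW : IsSectionOn V S.D01 W) {y : M} (hyU : y ∈ U) (hyV : y ∈ V)
    (hy : Z y ∈ S.freeman (m + 1) y) : cbracket Z W y ∈ S.freeman m y ⊔ S.D01 y := by
  obtain ⟨U', hU', hy', Z', hZ', hZZ', h⟩ := hy
  have hO := hU.inter hU'
  have h1 := hZ.mono (Set.inter_subset_left : U ∩ U' ⊆ U)
  have h2 := hZ'.mono (Set.inter_subset_right : U ∩ U' ⊆ U')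
  have h3 : cbracket (Z - Z') W y ∈ S.freeman m y :=
    cbracket_mem_of_eq_zero (hreg m) hO ⟨h1.1.sub h2.1, fun z hz =>
      sub_mem (h1.2 z hz) (h2.2 z hz)⟩ W ⟨hyU, hy'⟩ (by simp [hZZ'])
  rw [cbracket_sub_left hO h1.1 h2.1 W ⟨hyU, hy'⟩] at h3
  have h4 := add_mem (Submodule.mem_sup_left (T := S.D01 y) h3) (h V W hV hyV hW)
  rwa [sub_add_cancel] at h4

theorem IsInfAut.cbracket_mem_D01 {U V : Set M} {X : ∀ y : M, T (2 * n + 1) y}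
    (hX : S.IsInfAut U X) (hV : IsOpen V) (hs : V ⊆ U) {Z : ∀ y : M, CT (2 * n + 1) y}
    (hZ : IsSectionOn V S.D01 Z) {y : M} (hy : y ∈ V) : cbracket (ofReal X) Z y ∈ S.D01 y := by
  have hc : IsSectionOn V S.D10 (conjField Z) := by
    refine ⟨hZ.1.conjField, fun z hz => ?_⟩
    exact mem_conjSubmodule.1 (hZ.2 z hz)
  have h := hX.2 V _ hV hs hc y hy
  rw [D01, mem_conjSubmodule]
  rwa [← conjField_cbracket hV (csmoothOn_ofReal (hX.1.mono hs)) hZ.1 hy, conjField_ofReal]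

/-- Infinitesimal CR automorphisms preserve the Freeman sequence. -/
theorem IsInfAut.cbracket_mem_freeman (hreg : S.IsRegular) {U : Set M}
    {X : ∀ y : M, T (2 * n + 1) y} (hX : S.IsInfAut U X) (m : ℕ) :
    ∀ {V : Set M} {Z : ∀ y : M, CT (2 * n + 1) y}, IsOpen V → V ⊆ U →
      IsSectionOn V (S.freeman m) Z → ∀ {y : M}, y ∈ V → cbracket (ofReal X) Z y ∈ S.freeman m y := by
  induction m with
  | zero =>
    intro V Z hV hs hZ y hy
    exact hX.2 _ _ hV hs hZ y hy
  | succ m ih =>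
    intro V Z hV hs hZ y hy
    have hZm : IsSectionOn V (S.freeman m) Z := ⟨hZ.1, fun z hz => freeman_succ_le m z (hZ.2 z hz)⟩
    have hXs {V'} (hV' : V' ⊆ V) : CSmoothOn V' (ofReal X) := csmoothOn_ofReal (hX.1.mono
      (hV'.trans hs))
    refine ⟨V, hV, hy, cbracket (ofReal X) Z, ⟨(hXs le_rfl).cbracket hV hZ.1,
      fun z hz => ih hV hs hZm hz⟩, rfl, fun V' W hV' hyV' hW => ?_⟩
    have hO := hV.inter hV'
    have hyO : y ∈ V ∩ V' := ⟨hy, hyV'⟩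
    have hZO := hZm.mono (Set.inter_subset_left : V ∩ V' ⊆ V)
    have hWO := hW.mono (Set.inter_subset_right : V ∩ V' ⊆ V')
    have hOs : V ∩ V' ⊆ U := Set.inter_subset_left.trans hs
    have hLW : IsSectionOn (V ∩ V') S.D01 (cbracket (ofReal X) W) :=
      ⟨(hXs Set.inter_subset_left).cbracket hO hWO.1, fun z hz => hX.cbracket_mem_D01 hO hOs hWO hz⟩
    have hj := cbracket_ofReal_jacobi hO (hX.1.mono hOs) hZO.1 hWO.1 hyO
    rw [← sub_eq_iff_eq_add] at hj
    rw [← hj]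
    refine sub_mem ?_ (cbracket_mem_freeman_sup_D01 hreg hO hO hZO hLW hyO hyO (hZ.2 y hy))
    -- `[Z, W]` is locally the sum of sections of the two bundles, which `X` preserves
    have hZW : IsSectionOn (V ∩ V') (fun z => S.freeman m z ⊔ S.D01 z) (cbracket Z W) :=
      ⟨hZO.1.cbracket hO hWO.1, fun z hz =>
        cbracket_mem_freeman_sup_D01 hreg hO hO hZO hWO hz hz (hZ.2 z hz.1)⟩
    obtain ⟨V₁, hV₁, hyV₁, hV₁s, A, B, hA, hB, hAB⟩ :=
      hZW.exists_add (hreg m) hreg.isCSubbundle_D01 (freeman_inf_D01 m) hO hyO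
    have hev : ∀ᶠ z in 𝓝 y, z ∈ V₁ := hV₁.mem_nhds hyV₁
    rw [cbracket_congr (Filter.Eventually.of_forall fun _ => rfl) (W' := A + B) (hev.mono hAB),
      cbracket_add_right hV₁ hA.1 hB.1 _ hyV₁]
    exact add_mem (Submodule.mem_sup_left (ih hV₁ (hV₁s.trans hOs) hA hyV₁))
      (Submodule.mem_sup_right (hX.cbracket_mem_D01 hV₁ (hV₁s.trans hOs) hB hyV₁))

end CRHypersurface

/-! ### The CR algebra of a transitive Lie algebra of infinitesimal CR automorphisms -/

namespace CRHypersurface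

variable {n : ℕ} {M : Type*} [TopologicalSpace M]
  [ChartedSpace (EuclideanSpace ℝ (Fin (2 * n + 1))) M] [IsManifold (𝓡 (2 * n + 1)) ∞ M]
  {S : CRHypersurface n M} {x : M} {g : LieSubalgebra ℝ (S.Inf x)}

/-- The complex field `Ξ` represents on `U` the element `ξ` of the complexification of `g`. -/
structure Represents (ξ : ℂ ⊗[ℝ] g) (U : Set M) (Ξ : ∀ y : M, CT (2 * n + 1) y) : Prop where
  isOpen : IsOpen U
  mem : x ∈ U
  inf_cre : S.IsInfAut U fun y => cre (Ξ y)
  inf_cim : S.IsInfAut U fun y => cim (Ξ y)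
  germ_cre : germ ⟨fun y => cre (Ξ y), U, isOpen, mem, inf_cre⟩ = ((cre ξ : g) : S.Inf x)
  germ_cim : germ ⟨fun y => cim (Ξ y), U, isOpen, mem, inf_cim⟩ = ((cim ξ : g) : S.Inf x)

theorem exists_represents (ξ : ℂ ⊗[ℝ] g) : ∃ U Ξ, Represents ξ U Ξ := by
  obtain ⟨X, hX⟩ := germ_surjective (S := S) (cre ξ : g).1
  obtain ⟨Y, hY⟩ := germ_surjective (S := S) (cim ξ : g).1
  obtain ⟨U, hU, hxU, hXU⟩ := X.2
  obtain ⟨V, hV, hxV, hYV⟩ := Y.2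
  have e1 : (fun y => cre ((1 : ℂ) ⊗ₜ[ℝ] X.1 y + Complex.I ⊗ₜ[ℝ] Y.1 y)) = X.1 := by
    funext y; simp
  have e2 : (fun y => cim ((1 : ℂ) ⊗ₜ[ℝ] X.1 y + Complex.I ⊗ₜ[ℝ] Y.1 y)) = Y.1 := by
    funext y; simp
  refine ⟨U ∩ V, fun y => (1 : ℂ) ⊗ₜ[ℝ] X.1 y + Complex.I ⊗ₜ[ℝ] Y.1 y, hU.inter hV, ⟨hxU, hxV⟩,
    ?_, ?_, ?_, ?_⟩
  · rw [e1]; exact hXU.mono Set.inter_subset_left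
  · rw [e2]; exact hYV.mono Set.inter_subset_right
  · rw [← hX]; congr 1; exact Subtype.ext e1
  · rw [← hY]; congr 1; exact Subtype.ext e2

variable (g) in
/-- The complexified evaluation at `x`. -/
def evC : ℂ ⊗[ℝ] g →ₗ[ℂ] CT (2 * n + 1) x := (evOn g).baseChange ℂ

theorem cre_evC (ξ : ℂ ⊗[ℝ] g) : cre (evC g ξ) = evOn g (cre ξ) := cre_baseChange _ _

theorem cim_evC (ξ : ℂ ⊗[ℝ] g) : cim (evC g ξ) = evOn g (cim ξ) := cim_baseChange _ _

theorem evC_conj (ξ : ℂ ⊗[ℝ] g) : evC g (conj ξ) = conj (evC g ξ) := (conj_baseChange _ _).symm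

theorem IsTransitive.evC_surjective (h : IsTransitive g) : Function.Surjective (evC g) := by
  intro v
  obtain ⟨a, ha⟩ := h (cre v)
  obtain ⟨b, hb⟩ := h (cim v)
  refine ⟨(1 : ℂ) ⊗ₜ[ℝ] a + Complex.I ⊗ₜ[ℝ] b, complexification_ext ?_ ?_⟩
  · rw [cre_evC]; simpa using ha
  · rw [cim_evC]; simpa using hb

namespace Represents

variable {ξ η : ℂ ⊗[ℝ] g} {U V : Set M} {Ξ H : ∀ y : M, CT (2 * n + 1) y}

theorem csmoothOn (h : Represents ξ U Ξ) : CSmoothOn U Ξ := ⟨h.inf_cre.1, h.inf_cim.1⟩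

theorem eval (h : Represents ξ U Ξ) : evC g ξ = Ξ x := by
  apply complexification_ext
  · rw [cre_evC]
    exact (congrArg ev h.germ_cre).symm
  · rw [cim_evC]
    exact (congrArg ev h.germ_cim).symm

theorem evC_lie (h : Represents ξ U Ξ) (h' : Represents η V H) :
    evC g ⁅ξ, η⁆ = cbracket Ξ H x := by
  have key {a b : g} {A B : S.preInf x} (ha : germ A = (a : S.Inf x)) (hb : germ B = (b : S.Inf x)) :
      evOn g ⁅a, b⁆ = CR.bracket A.1 B.1 x := by
    change ev (⁅(a : S.Inf x), (b : S.Inf x)⁆) = _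
    rw [← ha, ← hb]; rfl
  apply complexification_ext
  · rw [cre_evC, cre_lie, map_sub, cre_cbracket, key h.germ_cre h'.germ_cre,
      key h.germ_cim h'.germ_cim]
  · rw [cim_evC, cim_lie, map_add, cim_cbracket, key h.germ_cre h'.germ_cim,
      key h.germ_cim h'.germ_cre]

theorem cbracket_eq (h : Represents ξ U Ξ) (Z : ∀ y : M, CT (2 * n + 1) y) {y : M} (hy : y ∈ U) :
    cbracket Ξ Z y = cbracket (ofReal fun y => cre (Ξ y)) Z y +
      Complex.I • cbracket (ofReal fun y => cim (Ξ y)) Z y := by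
  have h1 := csmoothOn_ofReal h.inf_cre.1
  have h2 := csmoothOn_ofReal h.inf_cim.1
  have e : Ξ = (ofReal fun y => cre (Ξ y)) + Complex.I • ofReal fun y => cim (Ξ y) := by
    funext z
    apply complexification_ext
    · simp [ofReal, cre_smul]
    · simp [ofReal, cim_smul]
  nth_rewrite 1 [e]
  rw [cbracket_add_left h.isOpen h1 (h2.smul _) Z hy, cbracket_smul_left h.isOpen h2 _ Z hy]

theorem cbracket_mem_freeman (hreg : S.IsRegular) (h : Represents ξ U Ξ) (hV : IsOpen V)
    (hxV : x ∈ V) {m : ℕ} {Z : ∀ y : M, CT (2 * n + 1) y} (hZ : IsSectionOn V (S.freeman m) Z) :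
    cbracket Ξ Z x ∈ S.freeman m x := by
  have hO := h.isOpen.inter hV
  have hZ' := hZ.mono (Set.inter_subset_right : U ∩ V ⊆ V)
  rw [h.cbracket_eq Z h.mem]
  exact add_mem (h.inf_cre.cbracket_mem_freeman hreg m hO Set.inter_subset_left hZ' ⟨h.mem, hxV⟩)
    (Submodule.smul_mem _ _
      (h.inf_cim.cbracket_mem_freeman hreg m hO Set.inter_subset_left hZ' ⟨h.mem, hxV⟩))

theorem cbracket_mem_D01 (h : Represents ξ U Ξ) (hV : IsOpen V)
    (hxV : x ∈ V) {Z : ∀ y : M, CT (2 * n + 1) y} (hZ : IsSectionOn V S.D01 Z) :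
    cbracket Ξ Z x ∈ S.D01 x := by
  have hO := h.isOpen.inter hV
  have hZ' := hZ.mono (Set.inter_subset_right : U ∩ V ⊆ V)
  rw [h.cbracket_eq Z h.mem]
  exact add_mem (h.inf_cre.cbracket_mem_D01 hO Set.inter_subset_left hZ' ⟨h.mem, hxV⟩)
    (Submodule.smul_mem _ _
      (h.inf_cim.cbracket_mem_D01 hO Set.inter_subset_left hZ' ⟨h.mem, hxV⟩))

/-- At `x`, the bracket of two infinitesimal automorphisms is opposite to that of two fields with the
same values at `x`, up to brackets of the automorphisms with these fields. -/
theorem evC_lie_add_cbracket (h : Represents ξ U Ξ) (h' : Represents η V H)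
    {U' V' : Set M} (hU' : IsOpen U') (hV' : IsOpen V') (hxU' : x ∈ U') (hxV' : x ∈ V')
    {Z W : ∀ y : M, CT (2 * n + 1) y} (hZ : CSmoothOn U' Z) (hW : CSmoothOn V' W)
    (hZx : evC g ξ = Z x) (hWx : evC g η = W x) :
    evC g ⁅ξ, η⁆ + cbracket Z W x = cbracket Ξ W x - cbracket H Z x := by
  have hO : IsOpen (U ∩ V ∩ (U' ∩ V')) := (h.isOpen.inter h'.isOpen).inter (hU'.inter hV')
  have hx : x ∈ U ∩ V ∩ (U' ∩ V') := ⟨⟨h.mem, h'.mem⟩, hxU', hxV'⟩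
  have s1 : CSmoothOn (U ∩ V ∩ (U' ∩ V')) Ξ := h.csmoothOn.mono fun z hz => hz.1.1
  have s2 : CSmoothOn (U ∩ V ∩ (U' ∩ V')) H := h'.csmoothOn.mono fun z hz => hz.1.2
  have s3 : CSmoothOn (U ∩ V ∩ (U' ∩ V')) Z := hZ.mono fun z hz => hz.2.1
  have s4 : CSmoothOn (U ∩ V ∩ (U' ∩ V')) W := hW.mono fun z hz => hz.2.2
  have h0 : cbracket (Ξ - Z) (H - W) x = 0 := cbracket_eq_zero_of_eq_zero
    (by rw [Pi.sub_apply, ← h.eval, hZx, sub_self])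
    (by rw [Pi.sub_apply, ← h'.eval, hWx, sub_self])
  rw [cbracket_sub_left hO s1 s3 _ hx, cbracket_sub_right hO s2 s4 _ hx,
    cbracket_sub_right hO s2 s4 _ hx, cbracket_swap Z H] at h0
  rw [h.evC_lie h', ← sub_eq_zero, ← h0]
  abel

end Represents

variable (g) in
/-- The elements of the complexification of `g` with value at `x` in the Freeman term. -/
def qFreeman (m : ℕ) : Submodule ℂ (ℂ ⊗[ℝ] g) := (S.freeman m x).comap (evC g)

theorem qFreeman_zero : qFreeman g 0 = q g := rfl

theorem mem_qFreeman {m : ℕ} {ξ : ℂ ⊗[ℝ] g} : ξ ∈ qFreeman g m ↔ evC g ξ ∈ S.freeman m x := Iff.rfl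

theorem mem_conj_q {ξ : ℂ ⊗[ℝ] g} : ξ ∈ conjSubmodule (q g) ↔ evC g ξ ∈ S.D01 x := by
  rw [mem_conjSubmodule, D01, mem_conjSubmodule, ← evC_conj]
  rfl

theorem IsTransitive.mem_sup_conj_q (ht : IsTransitive g) {m : ℕ} {ξ : ℂ ⊗[ℝ] g} :
    ξ ∈ qFreeman g m ⊔ conjSubmodule (q g) ↔ evC g ξ ∈ S.freeman m x ⊔ S.D01 x := by
  constructor
  · intro h
    obtain ⟨a, ha, b, hb, rfl⟩ := Submodule.mem_sup.1 h
    rw [map_add]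
    exact add_mem (Submodule.mem_sup_left ha) (Submodule.mem_sup_right (mem_conj_q.1 hb))
  · intro h
    obtain ⟨a, ha, b, hb, hab⟩ := Submodule.mem_sup.1 h
    obtain ⟨α, rfl⟩ := ht.evC_surjective a
    refine Submodule.mem_sup.2 ⟨α, ha, ξ - α, mem_conj_q.2 ?_, by abel⟩
    rw [map_sub, ← hab, add_sub_cancel_left]
    exact hb

theorem lie_mem_q (hreg : S.IsRegular) {ξ η : ℂ ⊗[ℝ] g} (hξ : ξ ∈ q g) (hη : η ∈ q g) :
    ⁅ξ, η⁆ ∈ q g := by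
  obtain ⟨U, Ξ, h⟩ := exists_represents ξ
  obtain ⟨V, H, h'⟩ := exists_represents η
  obtain ⟨U', hU', hxU', Z, hZ, hZx⟩ := (hreg 0).exists_section (x := x) (v := evC g ξ) hξ
  obtain ⟨V', hV', hxV', W, hW, hWx⟩ := (hreg 0).exists_section (x := x) (v := evC g η) hη
  have e := h.evC_lie_add_cbracket h' hU' hV' hxU' hxV' hZ.1 hW.1 hZx.symm hWx.symm
  have h1 : cbracket Z W x ∈ S.D10 x := S.integrable (U' ∩ V') Z W (hU'.inter hV')
    (hZ.mono Set.inter_subset_left) (hW.mono Set.inter_subset_right) x ⟨hxU', hxV'⟩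
  change evC g ⁅ξ, η⁆ ∈ S.D10 x
  rw [eq_sub_of_add_eq e]
  exact sub_mem (sub_mem (h.cbracket_mem_freeman hreg hV' hxV' (m := 0) hW)
    (h'.cbracket_mem_freeman hreg hU' hxU' (m := 0) hZ)) h1

theorem IsTransitive.q_sup_conj_q (ht : IsTransitive g) :
    q g ⊔ conjSubmodule (q g) = (filtNegOne g).baseChange ℂ := by
  ext ξ
  refine (ht.mem_sup_conj_q (m := 0)).trans ?_
  change evC g ξ ∈ S.D10 x ⊔ S.D01 x ↔ _
  rw [D10_sup_D01, mem_baseChange, mem_baseChange, cre_evC, cim_evC]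
  rfl

theorem lie_mem_iff_cbracket_mem (hreg : S.IsRegular) (ht : IsTransitive g) {m : ℕ}
    {ξ η : ℂ ⊗[ℝ] g} {U V : Set M} (hU : IsOpen U) (hV : IsOpen V) (hxU : x ∈ U) (hxV : x ∈ V)
    {Z W : ∀ y : M, CT (2 * n + 1) y} (hZ : IsSectionOn U (S.freeman m) Z)
    (hW : IsSectionOn V S.D01 W) (hZx : evC g ξ = Z x) (hWx : evC g η = W x) :
    ⁅ξ, η⁆ ∈ qFreeman g m ⊔ conjSubmodule (q g) ↔ cbracket Z W x ∈ S.freeman m x ⊔ S.D01 x := by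
  obtain ⟨U', Ξ, h⟩ := exists_represents ξ
  obtain ⟨V', H, h'⟩ := exists_represents η
  have e := h.evC_lie_add_cbracket h' hU hV hxU hxV hZ.1 hW.1 hZx hWx
  have h1 : cbracket Ξ W x - cbracket H Z x ∈ S.freeman m x ⊔ S.D01 x :=
    sub_mem (Submodule.mem_sup_right (h.cbracket_mem_D01 hV hxV hW))
      (Submodule.mem_sup_left (h'.cbracket_mem_freeman hreg hU hxU hZ))
  rw [← e] at h1
  rw [ht.mem_sup_conj_q]
  exact ⟨fun h2 => by simpa using sub_mem h1 h2, fun h2 => by simpa using sub_mem h1 h2⟩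

/-- The Freeman sequence of the CR algebra is that of the CR hypersurface. -/
theorem mem_qFreeman_succ_iff (hreg : S.IsRegular) (ht : IsTransitive g) (m : ℕ) (ξ : ℂ ⊗[ℝ] g) :
    ξ ∈ qFreeman g (m + 1) ↔ ξ ∈ qFreeman g m ∧
      ∀ η ∈ conjSubmodule (q g), ⁅ξ, η⁆ ∈ qFreeman g m ⊔ conjSubmodule (q g) := by
  constructor
  · rintro ⟨U, hU, hxU, Z, hZ, hZx, h⟩
    refine ⟨?_, fun η hη => ?_⟩
    · rw [mem_qFreeman, ← hZx]; exact hZ.2 x hxU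
    · obtain ⟨V, hV, hxV, W, hW, hWx⟩ := hreg.isCSubbundle_D01.exists_section (mem_conj_q.1 hη)
      exact (lie_mem_iff_cbracket_mem hreg ht hU hV hxU hxV hZ hW hZx.symm hWx.symm).2
        (h V W hV hxV hW)
  · rintro ⟨hξ, h⟩
    obtain ⟨U, hU, hxU, Z, hZ, hZx⟩ := (hreg m).exists_section hξ
    refine ⟨U, hU, hxU, Z, hZ, hZx, fun V W hV hxV hW => ?_⟩
    obtain ⟨η, hη⟩ := ht.evC_surjective (W x)
    refine (lie_mem_iff_cbracket_mem hreg ht hU hV hxU hxV hZ hW hZx.symm hη).1 (h η ?_)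
    rw [mem_conj_q, hη]
    exact hW.2 x hxV

theorem qFreeman_le_conj_q {k : ℕ} (h : S.freeman k x = ⊥) :
    qFreeman g k ≤ conjSubmodule (q g) := by
  intro ξ hξ
  rw [mem_qFreeman, h, Submodule.mem_bot] at hξ
  rw [mem_conj_q, hξ]
  exact zero_mem _

theorem not_qFreeman_le_conj_q (ht : IsTransitive g) {m : ℕ} (h : S.freeman m x ≠ ⊥) :
    ¬ qFreeman g m ≤ conjSubmodule (q g) := by
  intro hle
  refine h (eq_bot_iff.2 fun v hv => ?_)
  obtain ⟨ξ, rfl⟩ := ht.evC_surjective v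
  rw [← freeman_inf_D01 m x]
  exact ⟨hv, mem_conj_q.1 (hle hv)⟩

end CRHypersurface

/-! ### Splittings of the contact filtration -/

section Splitting

variable {g : Type*} [LieRing g] [LieAlgebra ℝ g]

theorem contactFiltration_neg_one (g1 : Submodule ℝ g) : contactFiltration g1 (-1) = g1 := rfl

theorem contactFiltration_neg_two (g1 : Submodule ℝ g) : contactFiltration g1 (-2) =
    g1 ⊔ Submodule.span ℝ {ζ | ∃ η ∈ g1, ∃ ξ ∈ g1, ζ = ⁅η, ξ⁆} := rfl

theorem mem_contactFiltration_succ {g1 : Submodule ℝ g} {p : ℤ} (hp : -1 ≤ p) {ξ : g} :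
    ξ ∈ contactFiltration g1 (p + 1) ↔
      ξ ∈ contactFiltration g1 p ∧ ∀ η ∈ g1, ⁅ξ, η⁆ ∈ contactFiltration g1 p := by
  rw [contactFiltration, contactFiltration, if_pos hp, if_pos (by omega),
    show (p + 1 + 1).toNat = (p + 1).toNat + 1 by omega]
  rfl

theorem mem_contactFiltration_zero {g1 : Submodule ℝ g} {ξ : g} :
    ξ ∈ contactFiltration g1 0 ↔ ξ ∈ g1 ∧ ∀ η ∈ g1, ⁅ξ, η⁆ ∈ g1 :=
  mem_contactFiltration_succ (p := -1) le_rfl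

theorem tmul_mem_baseChange_iff {V : Type*} [AddCommGroup V] [Module ℝ V] {P : Submodule ℝ V}
    {v : V} : (1 : ℂ) ⊗ₜ[ℝ] v ∈ P.baseChange ℂ ↔ v ∈ P := by
  simp [mem_baseChange]

theorem lie_mem_baseChange {P : Submodule ℝ g} (hP : ∀ a ∈ P, ∀ b ∈ P, ⁅a, b⁆ ∈ P)
    {ξ η : ℂ ⊗[ℝ] g} (hξ : ξ ∈ P.baseChange ℂ) (hη : η ∈ P.baseChange ℂ) :
    ⁅ξ, η⁆ ∈ P.baseChange ℂ := by
  have h1 := mem_baseChange.1 hξ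
  have h2 := mem_baseChange.1 hη
  refine mem_baseChange.2 ?_
  rw [cre_lie, cim_lie]
  exact ⟨sub_mem (hP _ h1.1 _ h2.1) (hP _ h1.2 _ h2.2),
    add_mem (hP _ h1.1 _ h2.2) (hP _ h1.2 _ h2.1)⟩

namespace IsSplitting

variable {F G : ℤ → Submodule ℝ g} (h : IsSplitting F G)
include h

theorem le_filtration {p j : ℤ} (hj : p ≤ j) : G j ≤ F p := by
  rw [h.filtration]; exact le_iSup₂_of_le j hj le_rfl

theorem eq_zero {p j : ℤ} (hj : j < p) {v : g} (hv : v ∈ G j) (hv' : v ∈ F p) : v = 0 := by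
  have hind := h.isInternal.submodule_iSupIndep j
  rw [Submodule.disjoint_def] at hind
  refine hind v hv ?_
  rw [h.filtration] at hv'
  exact (iSup₂_le fun i hi => le_iSup₂_of_le (f := fun i (_ : i ≠ j) => G i) i
    (by omega) le_rfl : (⨆ i, ⨆ (_ : p ≤ i), G i) ≤ _) hv'

theorem exists_add {p : ℤ} {v : g} (hv : v ∈ F p) : ∃ u ∈ G p, ∃ w ∈ F (p + 1), v = u + w := by
  have hle : F p ≤ G p ⊔ F (p + 1) := by
    rw [h.filtration p]
    refine iSup₂_le fun j hj => ?_
    rcases hj.eq_or_lt with rfl | hj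
    · exact le_sup_left
    · exact (h.le_filtration (by omega)).trans le_sup_right
  obtain ⟨u, hu, w, hw, huw⟩ := Submodule.mem_sup.1 (hle hv)
  exact ⟨u, hu, w, hw, huw.symm⟩

theorem lie_mem_filtration {i j : ℤ} {a b : g} (ha : a ∈ G i) (hb : b ∈ F j) :
    ⁅a, b⁆ ∈ F (i + j) := by
  rw [h.filtration] at hb
  refine (iSup₂_le fun p hp => ?_ : (⨆ p, ⨆ (_ : j ≤ p), G p) ≤
    (F (i + j)).comap (LieAlgebra.ad ℝ g a)) hb
  exact fun b hb => h.le_filtration (by omega) (h.lie_mem i p a ha b hb)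

end IsSplitting

variable {g1 : Submodule ℝ g} {G : ℤ → Submodule ℝ g}

namespace IsSplitting

variable (h : IsSplitting (contactFiltration g1) G)
include h

theorem exists_add_zero {v : g} (hv : v ∈ g1) :
    ∃ u ∈ G (-1), ∃ w ∈ contactFiltration g1 0, v = u + w :=
  h.exists_add (p := -1) hv

theorem mem_of_mem_neg_one {v : g} (hv : v ∈ G (-1)) : v ∈ g1 :=
  h.le_filtration (p := -1) le_rfl hv

/-- The bracket of `g_{-1}` is nondegenerate. -/
theorem eq_zero_of_lie_neg_one {v : g} (hv : v ∈ G (-1)) (h0 : ∀ u ∈ G (-1), ⁅v, u⁆ = 0) :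
    v = 0 := by
  have hv1 := h.mem_of_mem_neg_one hv
  refine h.eq_zero (p := 0) (by norm_num) hv (mem_contactFiltration_zero.2 ⟨hv1, fun η hη => ?_⟩)
  obtain ⟨u, hu, w, hw, rfl⟩ := h.exists_add_zero hη
  rw [lie_add, h0 u hu, zero_add, ← lie_skew]
  exact neg_mem ((mem_contactFiltration_zero.1 hw).2 v hv1)

/-- The grading is transitive in nonnegative degrees. -/
theorem eq_zero_of_lie {p : ℤ} (hp : 0 ≤ p) {ξ : g} (hξ : ξ ∈ G p)
    (h0 : ∀ u ∈ G (-1), ⁅u, ξ⁆ = 0) : ξ = 0 := by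
  refine h.eq_zero (p := p + 1) (by omega) hξ ((mem_contactFiltration_succ (by omega)).2
    ⟨h.le_filtration le_rfl hξ, fun η hη => ?_⟩)
  obtain ⟨u, hu, w, hw, rfl⟩ := h.exists_add_zero hη
  rw [lie_add, ← lie_skew, h0 u hu, neg_zero, zero_add]
  simpa using h.lie_mem_filtration hξ hw

theorem neg_one_ne_bot (hLevi : ∃ η ∈ g1, ∃ ξ ∈ g1, ⁅η, ξ⁆ ∉ g1) : G (-1) ≠ ⊥ := by
  rintro hbot
  obtain ⟨η, hη, ξ, hξ, hn⟩ := hLevi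
  obtain ⟨u, hu, w, hw, rfl⟩ := h.exists_add_zero hη
  rw [hbot, Submodule.mem_bot] at hu
  rw [hu, zero_add] at hn
  exact hn ((mem_contactFiltration_zero.1 hw).2 ξ hξ)

variable (hcod : ∀ e ∉ g1, ∀ v, ∃ c : ℝ, v - c • e ∈ g1)
  (hLevi : ∃ η ∈ g1, ∃ ξ ∈ g1, ⁅η, ξ⁆ ∉ g1)
include hcod

theorem exists_eq_smul {et v : g} (het : et ∈ G (-2)) (het0 : et ≠ 0) (hv : v ∈ G (-2)) :
    ∃ c : ℝ, v = c • et := by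
  obtain ⟨c, hc⟩ := hcod et
    (fun h' => het0 (h.eq_zero (p := -1) (by norm_num) het
      ((contactFiltration_neg_one g1).ge h'))) v
  exact ⟨c, sub_eq_zero.1 (h.eq_zero (p := -1) (by norm_num)
    (sub_mem hv (Submodule.smul_mem _ c het))
    ((contactFiltration_neg_one g1).ge hc))⟩

include hLevi

omit h in
theorem contactFiltration_neg_two_eq_top : contactFiltration g1 (-2) = ⊤ := by
  obtain ⟨η, hη, ξ, hξ, hn⟩ := hLevi
  rw [contactFiltration_neg_two, eq_top_iff]
  intro v _
  obtain ⟨c, hc⟩ := hcod _ hn v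
  rw [← sub_add_cancel v (c • ⁅η, ξ⁆)]
  exact add_mem (Submodule.mem_sup_left hc) (Submodule.mem_sup_right
    (Submodule.smul_mem _ _ (Submodule.subset_span ⟨η, hη, ξ, hξ, rfl⟩)))

theorem eq_bot_of_lt {j : ℤ} (hj : j < -2) : G j = ⊥ :=
  (Submodule.eq_bot_iff _).2 fun v hv => h.eq_zero hj hv (by
    rw [contactFiltration_neg_two_eq_top hcod hLevi]; trivial)

theorem exists_mem_neg_two : ∃ et ∈ G (-2), et ≠ 0 := by
  obtain ⟨η, hη, ξ, hξ, hn⟩ := hLevi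
  obtain ⟨u, hu, w, hw, huw⟩ := h.exists_add (p := -2) (v := ⁅η, ξ⁆)
    (by rw [contactFiltration_neg_two_eq_top hcod ⟨η, hη, ξ, hξ, hn⟩]; trivial)
  refine ⟨u, hu, ?_⟩
  rintro rfl
  rw [zero_add] at huw
  exact hn (huw ▸ hw)

end IsSplitting

end Splitting

/-! ### The structure of the CR algebra in low degrees -/

namespace CRHypersurface

variable {n : ℕ} {M : Type*} [TopologicalSpace M]
  [ChartedSpace (EuclideanSpace ℝ (Fin (2 * n + 1))) M] [IsManifold (𝓡 (2 * n + 1)) ∞ M]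
  {S : CRHypersurface n M} {x : M} {g : LieSubalgebra ℝ (S.Inf x)}

theorem conj_lie_mem_q (hreg : S.IsRegular) {ξ η : ℂ ⊗[ℝ] g} (hξ : ξ ∈ conjSubmodule (q g))
    (hη : η ∈ conjSubmodule (q g)) : ⁅ξ, η⁆ ∈ conjSubmodule (q g) := by
  rw [mem_conjSubmodule] at *
  rw [conj_lie]; exact lie_mem_q hreg hξ hη

theorem lie_mem_filtNegOne_of_mem_qFreeman_one (hreg : S.IsRegular) (ht : IsTransitive g)
    {ξ η : ℂ ⊗[ℝ] g} (hξ : ξ ∈ qFreeman g 1) (hη : η ∈ (filtNegOne g).baseChange ℂ) :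
    ⁅ξ, η⁆ ∈ (filtNegOne g).baseChange ℂ := by
  obtain ⟨h0, h1⟩ := (mem_qFreeman_succ_iff hreg ht 0 ξ).1 hξ
  rw [← ht.q_sup_conj_q] at hη ⊢
  obtain ⟨a, ha, b, hb, rfl⟩ := Submodule.mem_sup.1 hη
  rw [clie_add]
  exact add_mem (Submodule.mem_sup_left (lie_mem_q hreg h0 ha)) (h1 b hb)

theorem mem_filtration_zero_of_evOn_eq_zero (hreg : S.IsRegular) (ht : IsTransitive g) {ξ : g}
    (h : evOn g ξ = 0) : ξ ∈ filtration g 0 := by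
  refine mem_contactFiltration_zero.2 ⟨?_, fun η hη => ?_⟩
  · change evOn g ξ ∈ S.D x
    rw [h]; exact zero_mem _
  · have h0 : evC g ((1 : ℂ) ⊗ₜ[ℝ] ξ) = 0 := by simp [evC, h]
    have h1 : (1 : ℂ) ⊗ₜ[ℝ] ξ ∈ qFreeman g 1 := by
      rw [mem_qFreeman, h0]; exact zero_mem _
    have := lie_mem_filtNegOne_of_mem_qFreeman_one hreg ht h1 (tmul_mem_baseChange_iff.2 hη)
    rwa [LieAlgebra.ExtendScalars.bracket_tmul, one_mul, tmul_mem_baseChange_iff] at this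

/-- The Cauchy characteristic space consists of the values of `g^0`. -/
theorem evOn_mem_reF0_iff (hreg : S.IsRegular) (ht : IsTransitive g) {ξ : g} :
    evOn g ξ ∈ S.reF0 x ↔ ξ ∈ filtration g 0 := by
  constructor
  · rintro ⟨z, hz, hzξ⟩
    obtain ⟨a, rfl⟩ := ht.evC_surjective z
    rw [← sub_add_cancel ξ (cre a)]
    refine add_mem (mem_filtration_zero_of_evOn_eq_zero hreg ht ?_) ?_
    · rw [map_sub, ← cre_evC, hzξ, sub_self]
    · have ha : a ∈ qFreeman g 1 := hz
      have ha0 : a ∈ (filtNegOne g).baseChange ℂ := by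
        rw [← ht.q_sup_conj_q]
        exact Submodule.mem_sup_left ((mem_qFreeman_succ_iff hreg ht 0 a).1 ha).1
      refine mem_contactFiltration_zero.2 ⟨(mem_baseChange.1 ha0).1, fun η hη => ?_⟩
      have := lie_mem_filtNegOne_of_mem_qFreeman_one hreg ht ha (tmul_mem_baseChange_iff.2 hη)
      have := (mem_baseChange.1 this).1
      rw [cre_lie] at this
      simpa using this
  · intro hξ
    obtain ⟨h1, h2⟩ := mem_contactFiltration_zero.1 hξ
    -- the holomorphic part of the value of `ξ`
    obtain ⟨a, ha⟩ := ht.evC_surjective ((2⁻¹ : ℂ) • ((1 : ℂ) ⊗ₜ[ℝ] evOn g ξ -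
      Complex.I ⊗ₜ[ℝ] (S.J x ⟨evOn g ξ, h1⟩ : T (2 * n + 1) x)))
    have haq : a ∈ q g := by
      change evC g a ∈ S.D10 x
      rw [ha]
      exact Submodule.smul_mem _ _ (Submodule.subset_span ⟨⟨evOn g ξ, h1⟩, rfl⟩)
    have hker : evC g ((1 : ℂ) ⊗ₜ[ℝ] ξ - a - conj a) = 0 := by
      rw [map_sub, map_sub, evC_conj, ha]
      apply complexification_ext
      · simp [evC, cre_smul]
        module
      · simp [evC, cim_smul]
    have hkq : (1 : ℂ) ⊗ₜ[ℝ] ξ - a - conj a ∈ conjSubmodule (q g) := by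
      rw [mem_conj_q, hker]; exact zero_mem _
    have ha1 : a ∈ qFreeman g 1 := by
      refine (mem_qFreeman_succ_iff hreg ht 0 a).2 ⟨haq, fun η hη => ?_⟩
      have e : ⁅a, η⁆ = ⁅(1 : ℂ) ⊗ₜ[ℝ] ξ, η⁆ - ⁅conj a, η⁆ -
          ⁅(1 : ℂ) ⊗ₜ[ℝ] ξ - a - conj a, η⁆ := by
        rw [csub_lie, csub_lie]; abel
      have hη1 : η ∈ (filtNegOne g).baseChange ℂ := by
        rw [← ht.q_sup_conj_q]; exact Submodule.mem_sup_right hη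
      rw [e]
      refine sub_mem (sub_mem ?_ ?_) ?_
      · refine ht.q_sup_conj_q.ge ?_
        rw [mem_baseChange] at hη1 ⊢
        rw [cre_lie, cim_lie]
        simpa using And.intro (h2 _ hη1.1) (h2 _ hη1.2)
      · exact Submodule.mem_sup_right (conj_lie_mem_q hreg (conj_mem_conjSubmodule.2 haq) hη)
      · exact Submodule.mem_sup_right (conj_lie_mem_q hreg hkq hη)
    refine ⟨(2 : ℂ) • evC g a, Submodule.smul_mem _ _ ha1, ?_⟩
    rw [ha]
    simp

theorem J_mem_reF0 {v : S.D x} (hv : (v : T (2 * n + 1) x) ∈ S.reF0 x) :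
    (S.J x v : T (2 * n + 1) x) ∈ S.reF0 x := by
  obtain ⟨z, hz, hzv⟩ := hv
  have hz' : z ∈ S.freeman 1 x := hz
  obtain ⟨a, h1, h2⟩ := mem_D10_iff.1 (freeman_le_D10 1 x hz')
  have hav : a = v := Subtype.ext (h1.symm.trans hzv)
  have hI : Complex.I • z ∈ S.freeman 1 x := (S.freeman 1 x).smul_mem Complex.I hz'
  refine ⟨Complex.I • z, hI, ?_⟩
  rw [cre_smul, h2, hav]
  simp only [Complex.I_re, Complex.I_im, zero_smul, one_smul, zero_sub, neg_neg]

/-- The Levi form does not vanish. -/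
theorem exists_lie_not_mem (hreg : S.IsRegular) (ht : IsTransitive g) {k : ℕ} (hk : 1 ≤ k)
    (hnd : S.IsNondegenerateAt k x) :
    ∃ η ∈ filtNegOne g, ∃ ξ ∈ filtNegOne g, ⁅η, ξ⁆ ∉ filtNegOne g := by
  by_contra hcon
  have hP : ∀ a ∈ filtNegOne g, ∀ b ∈ filtNegOne g, ⁅a, b⁆ ∈ filtNegOne g := fun a ha b hb =>
    by_contra fun h => hcon ⟨a, ha, b, hb, h⟩
  have key (m : ℕ) : qFreeman g m = q g := by
    induction m with
    | zero => rfl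
    | succ m ih =>
      refine le_antisymm (fun ξ hξ => ?_) (fun ξ hξ => ?_)
      · rw [← ih]
        exact ((mem_qFreeman_succ_iff hreg ht m ξ).1 hξ).1
      · refine (mem_qFreeman_succ_iff hreg ht m ξ).2 ⟨ih.ge hξ, fun η hη => ?_⟩
        rw [ih, ht.q_sup_conj_q]
        refine lie_mem_baseChange hP (ht.q_sup_conj_q.le ?_) (ht.q_sup_conj_q.le ?_)
        · exact Submodule.mem_sup_left hξ
        · exact Submodule.mem_sup_right hη
  exact not_qFreeman_le_conj_q ht (hnd.1 0 hk)
    (((key 0).trans (key k).symm).le.trans (qFreeman_le_conj_q hnd.2))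

/-- The term `g^{-1}` of the contact filtration has codimension one. -/
theorem exists_sub_smul_mem {e : g} (he : e ∉ filtNegOne g) (v : g) :
    ∃ c : ℝ, v - c • e ∈ filtNegOne g := by
  have h1 : Module.finrank ℝ (T (2 * n + 1) x ⧸ S.D x) = 1 := by
    have : FiniteDimensional ℝ (T (2 * n + 1) x) :=
      inferInstanceAs (FiniteDimensional ℝ (EuclideanSpace ℝ (Fin (2 * n + 1))))
    have h := (S.D x).finrank_quotient_add_finrank
    have hT : Module.finrank ℝ (T (2 * n + 1) x) = 2 * n + 1 :=
      finrank_euclideanSpace_fin (𝕜 := ℝ) (n := 2 * n + 1)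
    rw [S.finrank_D, hT] at h
    omega
  have h2 : (S.D x).mkQ (evOn g e) ≠ 0 := by
    rw [Submodule.mkQ_apply, Ne, Submodule.Quotient.mk_eq_zero]; exact he
  obtain ⟨c, hc⟩ := (finrank_eq_one_iff_of_nonzero' _ h2).1 h1 ((S.D x).mkQ (evOn g v))
  refine ⟨c, ?_⟩
  change evOn g (v - c • e) ∈ S.D x
  rw [← Submodule.Quotient.mk_eq_zero, ← Submodule.mkQ_apply, map_sub, map_smul, map_sub, map_smul,
    hc, sub_self]

end CRHypersurface

namespace CRHypersurface

/-! ### Existence of a realization -/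

section Existence

variable {n : ℕ} {M : Type*} [TopologicalSpace M]
  [ChartedSpace (EuclideanSpace ℝ (Fin (2 * n + 1))) M] [IsManifold (𝓡 (2 * n + 1)) ∞ M]
  {S : CRHypersurface n M} {x : M} {g : LieSubalgebra ℝ (S.Inf x)}

/-- The complex structure of `D / Re F`, where `F` is the Freeman bundle of index `0`, as a relation
between elements of `g`. -/
def JRel (v w : g) : Prop := ∃ hv : evOn g v ∈ S.D x,
  (S.J x ⟨evOn g v, hv⟩ : T (2 * n + 1) x) - evOn g w ∈ S.reF0 x

theorem JRel.add {v w v' w' : g} (h : JRel v w) (h' : JRel v' w') : JRel (v + v') (w + w') := by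
  obtain ⟨hv, h⟩ := h
  obtain ⟨hv', h'⟩ := h'
  have hvv : evOn g (v + v') ∈ S.D x := by rw [map_add]; exact add_mem hv hv'
  refine ⟨hvv, ?_⟩
  have e : (⟨evOn g (v + v'), hvv⟩ : S.D x) = ⟨evOn g v, hv⟩ + ⟨evOn g v', hv'⟩ :=
    Subtype.ext (map_add _ _ _)
  rw [e, map_add, map_add, Submodule.coe_add, add_sub_add_comm]
  exact add_mem h h'

theorem JRel.smul {v w : g} (c : ℝ) (h : JRel v w) : JRel (c • v) (c • w) := by
  obtain ⟨hv, h⟩ := h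
  have hcv : evOn g (c • v) ∈ S.D x := by rw [map_smul]; exact Submodule.smul_mem _ c hv
  refine ⟨hcv, ?_⟩
  have e : (⟨evOn g (c • v), hcv⟩ : S.D x) = c • ⟨evOn g v, hv⟩ :=
    Subtype.ext (map_smul _ _ _)
  rw [e, map_smul, map_smul, Submodule.coe_smul, ← smul_sub]
  exact Submodule.smul_mem _ c h

/-- Where the values are related exactly by `J`, the relation gives elements of `q`. -/
theorem tmul_sub_mem_q {v w : g} (hv : evOn g v ∈ S.D x)
    (h : evOn g w = S.J x ⟨evOn g v, hv⟩) :
    (1 : ℂ) ⊗ₜ[ℝ] v - Complex.I ⊗ₜ[ℝ] w ∈ q g :=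
  Submodule.subset_span ⟨⟨evOn g v, hv⟩, by simp [h]⟩

section Transitive

variable (hreg : S.IsRegular) (ht : IsTransitive g)
include hreg ht

theorem JRel.exists_exact {v w : g} (h : JRel v w) : ∃ hv : evOn g v ∈ S.D x,
    ∃ w', evOn g w' = S.J x ⟨evOn g v, hv⟩ ∧ w' - w ∈ filtration g 0 := by
  obtain ⟨hv, h⟩ := h
  obtain ⟨w', hw'⟩ := ht (S.J x ⟨evOn g v, hv⟩)
  refine ⟨hv, w', hw', (evOn_mem_reF0_iff hreg ht).1 ?_⟩
  rw [map_sub, hw']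
  exact h

theorem JRel.mem_filtNegOne {v w : g} (h : JRel v w) : w ∈ filtNegOne g := by
  obtain ⟨hv, w', hw', hww⟩ := h.exists_exact hreg ht
  have h1 : w' ∈ filtNegOne g := by
    change evOn g w' ∈ S.D x
    rw [hw']; exact (S.J x _).2
  have := sub_mem h1 (mem_contactFiltration_zero.1 hww).1
  rwa [sub_sub_cancel] at this

/-- The Levi form is Hermitian. -/
theorem JRel.lie_add_lie_mem {v w v' w' : g} (h : JRel v w) (h' : JRel v' w') :
    ⁅w, v'⁆ + ⁅v, w'⁆ ∈ filtNegOne g := by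
  obtain ⟨hv, u, hu, huw⟩ := h.exists_exact hreg ht
  obtain ⟨hv', u', hu', huw'⟩ := h'.exists_exact hreg ht
  have h1 := lie_mem_q hreg (tmul_sub_mem_q hv hu) (tmul_sub_mem_q hv' hu')
  have h2 := mem_baseChange.1 (ht.q_sup_conj_q.le (Submodule.mem_sup_left h1))
  have h3 : ⁅v, u'⁆ + ⁅u, v'⁆ ∈ filtNegOne g := by
    have := h2.2
    rw [cim_lie] at this
    simp only [map_sub, cre_tmul, cim_tmul, Complex.one_re, Complex.one_im, Complex.I_re,
      Complex.I_im, one_smul, zero_smul, sub_zero, zero_sub, lie_neg, neg_lie] at this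
    rw [← neg_add] at this
    exact (neg_mem_iff (S := Submodule ℝ g)).1 this
  have h4 : ⁅u - w, v'⁆ ∈ filtNegOne g := (mem_contactFiltration_zero.1 huw).2 v' hv'
  have h5 : ⁅u' - w', v⁆ ∈ filtNegOne g := (mem_contactFiltration_zero.1 huw').2 v hv
  have e : ⁅w, v'⁆ + ⁅v, w'⁆ = ⁅v, u'⁆ + ⁅u, v'⁆ - ⁅u - w, v'⁆ + ⁅u' - w', v⁆ := by
    rw [sub_lie, sub_lie, ← lie_skew v u', ← lie_skew v w']; abel
  rw [e]
  exact add_mem (sub_mem h3 h4) h5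

theorem JRel.neg_swap {v w : g} (h : JRel v w) : JRel w (-v) := by
  have hw : evOn g w ∈ S.D x := h.mem_filtNegOne hreg ht
  obtain ⟨hv, h⟩ := h
  refine ⟨hw, ?_⟩
  have h1 := neg_mem (J_mem_reF0 (v := S.J x ⟨evOn g v, hv⟩ - ⟨evOn g w, hw⟩) h)
  rw [map_sub, S.J_J] at h1
  convert h1 using 1
  simp

variable {G : ℤ → Submodule ℝ g} (hG : IsSplitting (filtration g) G)
include hG

theorem exists_JRel {v : g} (hv : v ∈ G (-1)) : ∃ w ∈ G (-1), JRel v w := by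
  have hv1 : evOn g v ∈ S.D x := hG.mem_of_mem_neg_one hv
  obtain ⟨ξ, hξ⟩ := ht (S.J x ⟨evOn g v, hv1⟩)
  have hξ1 : ξ ∈ filtNegOne g := by
    change evOn g ξ ∈ S.D x
    rw [hξ]; exact (S.J x _).2
  obtain ⟨w, hw, u, hu, rfl⟩ := hG.exists_add_zero hξ1
  refine ⟨w, hw, hv1, ?_⟩
  rw [← hξ, map_add, add_sub_cancel_left]
  exact (evOn_mem_reF0_iff hreg ht).2 hu

theorem JRel.unique {v w w' : g} (hw : w ∈ G (-1)) (hw' : w' ∈ G (-1)) (h : JRel v w)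
    (h' : JRel v w') : w = w' := by
  obtain ⟨hv, h⟩ := h
  obtain ⟨_, h'⟩ := h'
  refine sub_eq_zero.1 (hG.eq_zero (p := 0) (by norm_num) (sub_mem hw hw') ?_)
  refine (evOn_mem_reF0_iff hreg ht).1 ?_
  have := sub_mem h' h
  rwa [sub_sub_sub_cancel_left, ← map_sub] at this

/-- The complex structure of `g_{-1}` induced by that of the CR distribution. -/
theorem exists_complexStructure : ∃ J : G (-1) →ₗ[ℝ] G (-1),
    ∀ v : G (-1), JRel (v : g) (J v : g) := by
  choose j hj hrel using fun v : G (-1) => exists_JRel hreg ht hG v.2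
  refine ⟨⟨⟨fun v => ⟨j v, hj v⟩, fun v w => Subtype.ext ?_⟩, fun c v => Subtype.ext ?_⟩, hrel⟩
  · exact JRel.unique hreg ht hG (hj _) (add_mem (hj v) (hj w)) (hrel _) ((hrel v).add (hrel w))
  · exact JRel.unique hreg ht hG (hj _) (Submodule.smul_mem _ c (hj v)) (hrel _) ((hrel v).smul c)

theorem finiteDimensional_neg_one : FiniteDimensional ℝ (G (-1)) := by
  have : FiniteDimensional ℝ (T (2 * n + 1) x) :=
    inferInstanceAs (FiniteDimensional ℝ (EuclideanSpace ℝ (Fin (2 * n + 1))))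
  refine FiniteDimensional.of_injective ((evOn g).comp (G (-1)).subtype)
    (LinearMap.ker_eq_bot.1 (LinearMap.ker_eq_bot'.2 fun v hv => Subtype.ext ?_))
  exact hG.eq_zero (p := 0) (by norm_num) v.2 (mem_filtration_zero_of_evOn_eq_zero hreg ht hv)

theorem exists_isRealization {k : ℕ} (hk : 1 ≤ k) (hnd : S.IsNondegenerateAt k x) :
    ∃ (r : ℕ) (φ : g →ₗ⁅ℝ⁆ contactAlgebra r) (𝔍 : contactAlgebra r), IsRealization G φ 𝔍 := by
  have hLevi := exists_lie_not_mem hreg ht hk hnd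
  have hcod (e : g) (he : e ∉ filtNegOne g) (v : g) := exists_sub_smul_mem he v
  obtain ⟨et, het, het0⟩ := hG.exists_mem_neg_two hcod hLevi
  obtain ⟨J, hJ⟩ := exists_complexStructure hreg ht hG
  have := finiteDimensional_neg_one hreg ht hG
  obtain ⟨r, φ, 𝔍, h1, h2, h3, h4, h5⟩ := exists_realization hG.isInternal hG.lie_mem
    (fun j hj => hG.eq_bot_of_lt hcod hLevi hj) het het0
    (fun v hv => hG.exists_eq_smul hcod het het0 hv)
    (fun v hv h0 => hG.eq_zero_of_lie_neg_one hv h0) (hG.neg_one_ne_bot hLevi)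
    (fun p hp ξ hξ h0 => hG.eq_zero_of_lie hp hξ h0) J
    (fun v => Subtype.ext (JRel.unique hreg ht hG (J (J v)).2 (neg_mem v.2) (hJ (J v))
      ((hJ v).neg_swap hreg ht)))
    (fun v w => hG.eq_zero (p := -1) (by norm_num)
      (add_mem (hG.lie_mem (-1) (-1) _ (J v).2 _ w.2) (hG.lie_mem (-1) (-1) _ v.2 _ (J w).2))
      ((hJ v).lie_add_lie_mem hreg ht (hJ w)))
  refine ⟨r, φ, 𝔍, h1, h2, h3, h4, fun v hv w hw hvw => ?_⟩
  have hw' : w = J ⟨v, hv⟩ := h1 (hvw.trans (h5 ⟨v, hv⟩).symm)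
  rw [hw']
  exact hJ ⟨v, hv⟩

end Transitive

end Existence

/-! ### Realizations and the Freeman sequence -/

section Realization

variable {n : ℕ} {M : Type*} [TopologicalSpace M]
  [ChartedSpace (EuclideanSpace ℝ (Fin (2 * n + 1))) M] [IsManifold (𝓡 (2 * n + 1)) ∞ M]
  {S : CRHypersurface n M} {x : M} {g : LieSubalgebra ℝ (S.Inf x)} {G : ℤ → Submodule ℝ g} {r : ℕ}
  {φ : g →ₗ⁅ℝ⁆ contactAlgebra r} {𝔍 : contactAlgebra r}

theorem range_eq_iSup (φ : g →ₗ⁅ℝ⁆ contactAlgebra r) (hG : IsSplitting (filtration g) G) :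
    φ.range.toSubmodule = ⨆ p, (G p).map (φ : g →ₗ[ℝ] contactAlgebra r) := by
  rw [← Submodule.map_iSup, hG.isInternal.submodule_iSup_eq_top, Submodule.map_top]
  rfl

theorem IsRealization.range_inf_grade (h : IsRealization G φ 𝔍)
    (hG : IsSplitting (filtration g) G) (p : ℤ) :
    φ.range.toSubmodule ⊓ grade p = (G p).map (φ : g →ₗ[ℝ] contactAlgebra r) := by
  have hind : iSupIndep (grade (r := r)) :=
    (Module.End.eigenspaces_iSupIndep _).comp Int.cast_injective
  obtain ⟨pr, hpr⟩ := exists_isComponents hind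
  refine le_antisymm (fun y hy => ?_) (le_inf ?_ (h.map_le p))
  · obtain ⟨h1, h2⟩ := Submodule.mem_inf.1 hy
    rw [range_eq_iSup φ hG] at h1
    have := hpr.mem_of_mem_iSup h.map_le h1 p
    rwa [hpr.self p y h2] at this
  · rw [range_eq_iSup φ hG]; exact le_iSup (fun p => (G p).map (φ : g →ₗ[ℝ] contactAlgebra r)) p

theorem IsRealization.pos (h : IsRealization G φ 𝔍) (hne : G (-1) ≠ ⊥) : 0 < r := by
  rcases Nat.eq_zero_or_pos r with rfl | hr
  · refine absurd ((Submodule.eq_bot_iff _).2 fun v hv => h.injective ?_) hne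
    obtain ⟨a, b, hab⟩ := exists_eq_of_mem_grade_neg_one (h.map_le (-1) ⟨v, hv, rfl⟩)
    rw [map_zero]
    simpa using hab
  · exact hr

theorem map_baseChange (f : g →ₗ[ℝ] contactAlgebra r) (P : Submodule ℝ g) :
    (P.baseChange ℂ).map (f.baseChange ℂ) = (P.map f).baseChange ℂ := by
  ext y
  constructor
  · rintro ⟨z, hz, rfl⟩
    have hz' := mem_baseChange.1 hz
    rw [mem_baseChange, cre_baseChange, cim_baseChange]
    exact ⟨⟨_, hz'.1, rfl⟩, ⟨_, hz'.2, rfl⟩⟩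
  · intro hy
    obtain ⟨⟨a, ha, hay⟩, ⟨b, hb, hby⟩⟩ := mem_baseChange.1 hy
    refine ⟨(1 : ℂ) ⊗ₜ[ℝ] a + Complex.I ⊗ₜ[ℝ] b, ?_, ?_⟩
    · exact mem_baseChange.2 (by simpa using ⟨ha, hb⟩)
    · apply complexification_ext
      · rw [cre_baseChange]; simpa using hay
      · rw [cim_baseChange]; simpa using hby

theorem baseChange_iSup {V : Type*} {ι : Sort*} [AddCommGroup V] [Module ℝ V]
    (P : ι → Submodule ℝ V) : (⨆ i, P i).baseChange ℂ = ⨆ i, (P i).baseChange ℂ := by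
  refine le_antisymm ?_ (iSup_le fun i => Submodule.baseChange_mono ℂ (le_iSup P i))
  have hle : (⨆ i, P i) ≤ ((⨆ i, (P i).baseChange ℂ).restrictScalars ℝ).comap
      (TensorProduct.mk ℝ ℂ V 1) := iSup_le fun i v hv =>
    Submodule.mem_iSup_of_mem (p := fun i => (P i).baseChange ℂ) i
      (Submodule.tmul_mem_baseChange_of_mem 1 hv)
  rw [Submodule.baseChange_eq_span, Submodule.span_le]
  rintro _ ⟨v, hv, rfl⟩
  exact hle hv

/-- A realization carries the Freeman sequence of the CR algebra to that of its image. -/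
theorem IsRealization.isFreemanSequence (hreg : S.IsRegular) (ht : IsTransitive g) {k : ℕ}
    (hnd : S.IsNondegenerateAt k x) (hG : IsSplitting (filtration g) G) (h : IsRealization G φ 𝔍)
    (hal : IsAligned φ 𝔍) : IsFreemanSequence 𝔍 φ.range k fun m =>
      (qFreeman g m).map ((φ : g →ₗ[ℝ] contactAlgebra r).baseChange ℂ) where
  graded := by
    simp only [h.range_inf_grade hG]
    exact range_eq_iSup φ hG
  neg p hp := by
    rw [← h.map_neg p hp, range_eq_iSup φ hG]
    exact le_iSup (fun p => (G p).map (φ : g →ₗ[ℝ] contactAlgebra r)) p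
  lie_mem := by
    rintro _ ⟨a, ha, rfl⟩ _ ⟨b, hb, rfl⟩
    exact ⟨⁅a, b⁆, lie_mem_q hreg ha hb, baseChange_lie φ a b⟩
  sup_conj := by
    have hfilt : filtNegOne g = ⨆ j, ⨆ (_ : (-1 : ℤ) ≤ j), G j :=
      (contactFiltration_neg_one (filtNegOne g)).symm.trans (hG.filtration (-1))
    rw [conjSubmodule_map_baseChange, ← Submodule.map_sup, qFreeman_zero, ht.q_sup_conj_q,
      map_baseChange, hfilt, level]
    simp only [Submodule.map_iSup, baseChange_iSup, ccomponent, h.range_inf_grade hG]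
  mem_succ m y := by
    have hinj := baseChange_injective (f := (φ : g →ₗ[ℝ] contactAlgebra r)) h.injective
    rw [conjSubmodule_map_baseChange, ← Submodule.map_sup]
    constructor
    · rintro ⟨ξ, hξ, rfl⟩
      obtain ⟨h1, h2⟩ := (mem_qFreeman_succ_iff hreg ht m ξ).1 hξ
      refine ⟨⟨ξ, h1, rfl⟩, ?_⟩
      rintro _ ⟨η, hη, rfl⟩
      exact ⟨⁅ξ, η⁆, h2 η hη, baseChange_lie φ ξ η⟩
    · rintro ⟨⟨ξ, h1, rfl⟩, h2⟩
      refine ⟨ξ, (mem_qFreeman_succ_iff hreg ht m ξ).2 ⟨h1, fun η hη => ?_⟩, rfl⟩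
      obtain ⟨ζ, hζ, hζe⟩ := h2 _ ⟨η, hη, rfl⟩
      rw [← baseChange_lie φ ξ η] at hζe
      rwa [← hinj hζe]
  le_conj := by
    rw [conjSubmodule_map_baseChange]
    exact Submodule.map_mono (qFreeman_le_conj_q hnd.2)
  not_le_conj m hm hle := by
    rw [conjSubmodule_map_baseChange, Submodule.map_le_map_iff_of_injective
      (baseChange_injective (f := (φ : g →ₗ[ℝ] contactAlgebra r)) h.injective)] at hle
    exact not_qFreeman_le_conj_q ht (hnd.1 m hm) hle
  aligned := hal

end Realization

end CRHypersurface

end CR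

end

theorem mainTheorem5 {n : ℕ} {M : Type*} [TopologicalSpace M]
    [ChartedSpace (EuclideanSpace ℝ (Fin (2 * n + 1))) M]
    [IsManifold (modelWithCornersSelf ℝ (EuclideanSpace ℝ (Fin (2 * n + 1)))) ∞ M]
    (S : CR.CRHypersurface n M) (hreg : S.IsRegular) (x : M) (k : ℕ) (hk : 1 ≤ k)
    (hnd : S.IsNondegenerateAt k x)
    (g : LieSubalgebra ℝ (S.Inf x)) (htrans : CR.CRHypersurface.IsTransitive g)
    (G : ℤ → Submodule ℝ g)
    (hG : CR.IsSplitting (CR.CRHypersurface.filtration g) G) :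
    (∃ (r : ℕ) (φ : g →ₗ⁅ℝ⁆ CR.contactAlgebra r) (𝔍 : CR.contactAlgebra r),
      CR.CRHypersurface.IsRealization G φ 𝔍) ∧
    ∀ (r : ℕ) (φ : g →ₗ⁅ℝ⁆ CR.contactAlgebra r) (𝔍 : CR.contactAlgebra r),
      CR.CRHypersurface.IsRealization G φ 𝔍 → CR.CRHypersurface.IsAligned φ 𝔍 →
        CR.IsGradedCRSubalgebra 𝔍 φ.range (CR.CRHypersurface.qImage φ) ∧
        ∃ a : LieSubalgebra ℝ (CR.contactAlgebra r),
          a.toSubmodule = φ.range.toSubmodule ⊔ Submodule.span ℝ {CR.gradingElement r} ∧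
          CR.IsModel k 𝔍 a := by
  have hLevi := CR.CRHypersurface.exists_lie_not_mem hreg htrans hk hnd
  refine ⟨CR.CRHypersurface.exists_isRealization hreg htrans hG hk hnd, fun r φ 𝔍 h hal => ?_⟩
  have hr := h.pos (hG.neg_one_ne_bot hLevi)
  have H := h.isFreemanSequence hreg htrans hnd hG hal
  exact ⟨H.isGradedCRSubalgebra hr h.isComplexStructure,
    H.exists_isModel hr h.isComplexStructure hk⟩
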